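/- **Setting.** Let $\varepsilon(\boldsymbol s)$, $\boldsymbol s\in\mathbb Z^2$, be i.i.d. random variables with mean $0$ and variance $1$. Let $q_1,q_2>0$ with $Q:=\frac1{q_1}+\frac1{q_2}\in(1,2)$, let $B=(b_{ij})_{i,j=1,2}$ be a real nondegenerate matrix, let $L_\pm$ be continuous functions on $[-1,1]$ with $L_+(1)=L_-(1)$ and $L_+(-1)=L_-(-1)$, and put $$\rho(\boldsymbol u)=|u_1|^{q_1}+|u_2|^{q_2},\qquad L(\boldsymbol u)=L_+\Big(\frac{u_1}{\rho(\boldsymbol u)^{1/q_1}}\Big)\mathbf 1(u_2\ge0)+L_-\Big(\frac{u_1}{\rho(\boldsymbol u)^{1/q_1}}\Big)\mathbf 1(u_2<0),\qquad a_\infty(\boldsymbol u)=\rho(\boldsymbol u)^{-1}L(\boldsymbol u)$$ for $\boldsymbol u\in\mathbb R^2\setminus\{\boldsymbol 0\}$. Let $b:\mathbb Z^2\to\mathbb R$ satisfy $b(\boldsymbol t)=\rho(B\boldsymbol t)^{-1}(L(B\boldsymbol t)+o(1))$ as $|\boldsymbol t|\to\infty$, and let $X(\boldsymbol t)=\sum_{\boldsymbol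 s\in\mathbb Z^2}b(\boldsymbol t-\boldsymbol s)\varepsilon(\boldsymbol s)$, $\boldsymbol t\in\mathbb Z^2$ (convergence in $L^2$). For $\gamma,\lambda>0$ and $\boldsymbol x\in\mathbb R_+^2=(0,\infty)^2$ let $$S_{\lambda,\gamma}(\boldsymbol x)=\sum_{\boldsymbol t\in(0,\lambda x_1]\times(0,\lambda^\gamma x_2]\cap\mathbb Z^2}X(\boldsymbol t).$$ Let $W$ be a real Gaussian white noise on $\mathbb R^2$ with Lebesgue intensity and, for a $2\times2$ matrix $D$, let $$\tilde V_D(\boldsymbol x)=|\det B|^{-1/2}\int_{\mathbb R^2}\Big\{\int_{(0,x_1]\times(0,x_2]}a_\infty(D\boldsymbol t-\boldsymbol u)\,d\boldsymbol t\Big\}W(d\boldsymbol u),\qquad \boldsymbol x\in\mathbb R^2_+ .$$ Write $\tilde V_{22},\tilde V_{21},\tilde V_{20},\tilde V_{11},\tilde V_{00}$ for $\tilde V_D$ with $D$ equal, respectively, to $$\begin{bmatrix}0&0\\0&b_{22}\end{bmatrix},\quad\begin{bmatrix}0&0\\b_{21}&0\end{bmatrix},\quad\begin{bmatrix}0&0\\b_{21}&b_{22}\end{bmatrix},\quad\begin{bmatrix}b_{11}&0\\0&0\end{bmatrix},\quad\begin{bmatrix}b_{11}&0\\0&b_{22}\end{bmatrix}.$$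 Let $\tilde Q_1=Q-\frac1{2q_1}$ and $\tilde H_i=1-\frac{q_i}2(2-Q)$, $i=1,2$. For $0<\mathcal H_1,\mathcal H_2\le1$ let $B_{\mathcal H_1,\mathcal H_2}$ be the fractional Brownian sheet, i.e. the centred Gaussian random field on $\mathbb R^2_+$ with covariance $\frac14\prod_{i=1}^2(x_i^{2\mathcal H_i}+y_i^{2\mathcal H_i}-|x_i-y_i|^{2\mathcal H_i})$. **Theorem.** Let $q_1<q_2$ and $\tilde Q_1>1$. Then the series defining $X$ converges in $L^2$, and the following holds, where $\Rightarrow$ and $\overset{fdd}{=}$ denote weak convergence as $\lambda\to\infty$ and equality of finite-dimensional distributions of random fields on $\mathbb R^2_+$. (i) (Incongruous scaling, critical point $\gamma_0=1$.) If $b_{21}b_{22}\ne0$, then $\tilde V_{22},\tilde V_{21},\tilde V_{20}$ are well defined, $\tilde V_{22}\overset{fdd}{=}\tilde\sigma_{22}B_{1,\tilde H_2}$ and $\tilde V_{21}\overset{fdd}{=}\tilde\sigma_{21}B_{\tilde H_2,1}$ with $\tilde\sigma_{ij}^2=\mathrm E|\tilde V_{ij}(1,1)|^2$, and $$\lambda^{-(1+\gamma\tilde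 H_2)}S_{\lambda,\gamma}\Rightarrow\tilde V_{22}\ (\gamma>1),\qquad \lambda^{-(\gamma+\tilde H_2)}S_{\lambda,\gamma}\Rightarrow\tilde V_{21}\ (0<\gamma<1),\qquad \lambda^{-(1+\tilde H_2)}S_{\lambda,1}\Rightarrow\tilde V_{20}\ (\gamma=1).$$ (ii) (Congruous scaling, critical point $\gamma_0=q_1/q_2$.) If $b_{21}=0$, then $\tilde V_{22},\tilde V_{11},\tilde V_{00}$ are well defined, $\tilde V_{22}\overset{fdd}{=}\tilde\sigma_{22}B_{1,\tilde H_2}$ and $\tilde V_{11}\overset{fdd}{=}\tilde\sigma_{11}B_{\tilde H_1,1}$, and $$\lambda^{-(1+\gamma\tilde H_2)}S_{\lambda,\gamma}\Rightarrow\tilde V_{22}\ \Big(\gamma>\frac{q_1}{q_2}\Big),\qquad \lambda^{-(\gamma+\tilde H_1)}S_{\lambda,\gamma}\Rightarrow\tilde V_{11}\ \Big(0<\gamma<\frac{q_1}{q_2}\Big),\qquad \lambda^{-(1+\frac{q_1}{q_2}\tilde H_2)}S_{\lambda,\gamma}\Rightarrow\tilde V_{00}\ \Big(\gamma=\frac{q_1}{q_2}\Big).$$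 Moreover, if $L_+$ and $L_-$ do not both vanish identically on $[-1,1]$, then the two unbalanced limits differ even up to a constant: for no $a>0$ is $\tilde V_{22}\overset{fdd}{=}a\tilde V_{21}$ in case (i), or $\tilde V_{22}\overset{fdd}{=}a\tilde V_{11}$ in case (ii). -/

import Mathlib

open MeasureTheory ProbabilityTheory Filter Topology
open scoped ENNReal NNReal Matrix

noncomputable section

namespace AnisoScaling

/-! ### The coefficients -/

/-- `ρ(u) = |u₁|^{q₁} + |u₂|^{q₂}`. -/
def rho (q₁ q₂ : ℝ) (u : Fin 2 → ℝ) : ℝ := |u 0| ^ q₁ + |u 1| ^ q₂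

/-- The angular function `L(u)`, equal to `L₊(u₁ / ρ(u)^{1/q₁})` if `u₂ ≥ 0` and to
`L₋(u₁ / ρ(u)^{1/q₁})` if `u₂ < 0` (relevant for `u ≠ 0` only). -/
def angular (q₁ q₂ : ℝ) (Lplus Lminus : ℝ → ℝ) (u : Fin 2 → ℝ) : ℝ :=
  if 0 ≤ u 1 then Lplus (u 0 / rho q₁ q₂ u ^ (1 / q₁))
  else Lminus (u 0 / rho q₁ q₂ u ^ (1 / q₁))

/-- `a_∞(u) = ρ(u)⁻¹ L(u)` (for `u ≠ 0`; the value at the single point `0` is irrelevant). -/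
def aInfty (q₁ q₂ : ℝ) (Lplus Lminus : ℝ → ℝ) (u : Fin 2 → ℝ) : ℝ :=
  (rho q₁ q₂ u)⁻¹ * angular q₁ q₂ Lplus Lminus u

/-- `Q = 1/q₁ + 1/q₂`. -/
def bigQ (q₁ q₂ : ℝ) : ℝ := 1 / q₁ + 1 / q₂

/-- `Q̃ = Q - 1/(2 q)`, to be used with `q = q₁` or `q = q₂`. -/
def Qtilde (q₁ q₂ q : ℝ) : ℝ := bigQ q₁ q₂ - 1 / (2 * q)

/-- `H̃ = 1 - (q/2) (2 - Q)`, to be used with `q = q₁` or `q = q₂`. -/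
def Htilde (q₁ q₂ q : ℝ) : ℝ := 1 - q / 2 * (2 - bigQ q₁ q₂)

/-- The innovations are i.i.d. with mean zero and variance one. -/
structure IsStandardIID {Ω : Type*} [MeasurableSpace Ω] (P : Measure Ω)
    (ε : (Fin 2 → ℤ) → Ω → ℝ) : Prop where
  indep : iIndepFun ε P
  identDistrib : ∀ s, IdentDistrib (ε s) (ε 0) P P
  memLp : MemLp (ε 0) 2 P
  mean_zero : ∫ ω, ε 0 ω ∂P = 0
  variance_one : ∫ ω, (ε 0 ω) ^ 2 ∂P = 1

/-- The conditions on the parameters `q₁, q₂, L₊, L₋, B` and on the moving-average coefficients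
`b(t) = ρ(Bt)⁻¹ (L(Bt) + o(1))` as `|t| → ∞`, `t ∈ ℤ²`. -/
structure IsCoefficients (q₁ q₂ : ℝ) (Lplus Lminus : ℝ → ℝ) (B : Matrix (Fin 2) (Fin 2) ℝ)
    (b : (Fin 2 → ℤ) → ℝ) : Prop where
  q₁_pos : 0 < q₁
  q₂_pos : 0 < q₂
  one_lt_Q : 1 < bigQ q₁ q₂
  Q_lt_two : bigQ q₁ q₂ < 2
  continuousOn_Lplus : ContinuousOn Lplus (Set.Icc (-1) 1)
  continuousOn_Lminus : ContinuousOn Lminus (Set.Icc (-1) 1)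
  L_one : Lplus 1 = Lminus 1
  L_neg_one : Lplus (-1) = Lminus (-1)
  det_ne_zero : B.det ≠ 0
  asymptotics : ∃ o : (Fin 2 → ℤ) → ℝ, Tendsto o cofinite (𝓝 0) ∧
    ∀ t : Fin 2 → ℤ, t ≠ 0 →
      b t = (rho q₁ q₂ (B *ᵥ fun i => (t i : ℝ)))⁻¹ *
        (angular q₁ q₂ Lplus Lminus (B *ᵥ fun i => (t i : ℝ)) + o t)

/-! ### The linear random field and its partial sums -/

/-- `X(t) = ∑_{s ∈ ℤ²} b(t - s) ε(s)`, the series converging (unconditionally) in `L²`. -/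
def IsLinearField {Ω : Type*} [MeasurableSpace Ω] (P : Measure Ω)
    (b : (Fin 2 → ℤ) → ℝ) (ε X : (Fin 2 → ℤ) → Ω → ℝ) : Prop :=
  ∀ t, MemLp (X t) 2 P ∧
    Tendsto (fun F : Finset (Fin 2 → ℤ) =>
      eLpNorm (fun ω => X t ω - ∑ s ∈ F, b (t - s) * ε s ω) 2 P) atTop (𝓝 0)

/-- The partial sum of `X` over `t ∈ (0, r x₁] × (0, r^γ x₂] ∩ ℤ²`, where `r` is the scaling
parameter that tends to infinity. -/
def partialSum {Ω : Type*} (X : (Fin 2 → ℤ) → Ω → ℝ) (γ r : ℝ) (x : Fin 2 → ℝ) (ω : Ω) : ℝ :=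
  ∑ t ∈ Fintype.piFinset fun i => Finset.Ioc (0 : ℤ) ⌊(![r, r ^ γ] : Fin 2 → ℝ) i * x i⌋, X t ω

/-! ### The limit fields -/

/-- `I` is the stochastic integral `h ↦ ∫ h(u) W(du)`, `h ∈ L²(ℝ²)`, with respect to a real Gaussian
white noise on `ℝ²` with intensity Lebesgue measure, that is, an isonormal Gaussian process on
`L²(ℝ²)`: `I` is linear and `I(h)` is centred Gaussian with variance `‖h‖²` (by linearity all finite
families `I(h₁), …, I(hₙ)` are then jointly Gaussian with covariances `⟨hᵢ, hⱼ⟩`). The white noise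
itself is the random measure `W(A) = I(1_A)`. -/
def IsWhiteNoiseIntegral {Ω' : Type*} [MeasurableSpace Ω'] (P' : Measure Ω')
    (I : Lp ℝ 2 (volume : Measure (Fin 2 → ℝ)) →ₗ[ℝ] Lp ℝ 2 P') : Prop :=
  ∀ h, P'.map (I h : Ω' → ℝ) = gaussianReal 0 (‖h‖₊ ^ 2)

/-- The rectangle `(0, x] = (0, x₁] × (0, x₂]`. -/
def rect (x : Fin 2 → ℝ) : Set (Fin 2 → ℝ) := Set.univ.pi fun i => Set.Ioc 0 (x i)

/-- The integrand `u ↦ |det B|^{-1/2} ∫_{(0,x]} a_∞(D t - u) dt` of the limit field `Ṽ_D(x)`. -/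
def kernel (q₁ q₂ : ℝ) (Lplus Lminus : ℝ → ℝ) (B D : Matrix (Fin 2) (Fin 2) ℝ)
    (x u : Fin 2 → ℝ) : ℝ :=
  |B.det| ^ (-(1 / 2) : ℝ) * ∫ t in rect x, aInfty q₁ q₂ Lplus Lminus (D *ᵥ t - u)

/-- The field `Ṽ_D` is well defined: for each `x ∈ ℝ²₊` the inner integral converges absolutely
for almost every `u`, and the resulting function of `u` is in `L²(ℝ²)`. -/
def WellDefined (q₁ q₂ : ℝ) (Lplus Lminus : ℝ → ℝ) (B D : Matrix (Fin 2) (Fin 2) ℝ) : Prop :=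
  ∀ x : Fin 2 → ℝ, (∀ i, 0 < x i) →
    (∀ᵐ u : Fin 2 → ℝ,
      IntegrableOn (fun t => aInfty q₁ q₂ Lplus Lminus (D *ᵥ t - u)) (rect x)) ∧
    MemLp (kernel q₁ q₂ Lplus Lminus B D x) 2 volume

open scoped Classical in
/-- The element of `L²(ℝ²)` given by a square integrable function (and `0` for other functions). -/
def toL2 (f : (Fin 2 → ℝ) → ℝ) : Lp ℝ 2 (volume : Measure (Fin 2 → ℝ)) :=
  if hf : MemLp f 2 volume then hf.toLp f else 0

/-- `Ṽ_D(x) = |det B|^{-1/2} ∫_{ℝ²} {∫_{(0,x]} a_∞(D t - u) dt} W(du)`. -/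
def Vtilde {Ω' : Type*} [MeasurableSpace Ω'] {P' : Measure Ω'}
    (I : Lp ℝ 2 (volume : Measure (Fin 2 → ℝ)) →ₗ[ℝ] Lp ℝ 2 P')
    (q₁ q₂ : ℝ) (Lplus Lminus : ℝ → ℝ) (B D : Matrix (Fin 2) (Fin 2) ℝ) (x : Fin 2 → ℝ) :
    Ω' → ℝ :=
  I (toL2 (kernel q₁ q₂ Lplus Lminus B D x))

/-- `B̃₀₀`. -/
def Bt00 (B : Matrix (Fin 2) (Fin 2) ℝ) : Matrix (Fin 2) (Fin 2) ℝ := !![B 0 0, 0; 0, B 1 1]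

/-- `B̃₂₀`. -/
def Bt20 (B : Matrix (Fin 2) (Fin 2) ℝ) : Matrix (Fin 2) (Fin 2) ℝ := !![0, 0; B 1 0, B 1 1]

/-- `B̃₁₁`. -/
def Bt11 (B : Matrix (Fin 2) (Fin 2) ℝ) : Matrix (Fin 2) (Fin 2) ℝ := !![B 0 0, 0; 0, 0]

/-- `B̃₂₁`. -/
def Bt21 (B : Matrix (Fin 2) (Fin 2) ℝ) : Matrix (Fin 2) (Fin 2) ℝ := !![0, 0; B 1 0, 0]

/-- `B̃₂₂`. -/
def Bt22 (B : Matrix (Fin 2) (Fin 2) ℝ) : Matrix (Fin 2) (Fin 2) ℝ := !![0, 0; 0, B 1 1]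

/-! ### Finite-dimensional distributions -/

/-- Weak convergence, as `r → ∞`, of the finite-dimensional distributions of the random fields
`S r`, indexed by `ℝ²₊`, to those of `V`. -/
def FddTendsto {Ω Ω' : Type*} [MeasurableSpace Ω] [MeasurableSpace Ω']
    (P : Measure Ω) [IsProbabilityMeasure P] (P' : Measure Ω') [IsProbabilityMeasure P']
    (S : ℝ → (Fin 2 → ℝ) → Ω → ℝ) (V : (Fin 2 → ℝ) → Ω' → ℝ) : Prop :=
  ∀ (n : ℕ) (x : Fin n → Fin 2 → ℝ), (∀ k i, 0 < x k i) →
    TendstoInDistribution (fun (r : ℝ) (ω : Ω) (k : Fin n) => S r (x k) ω) atTop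
      (fun (ω' : Ω') (k : Fin n) => V (x k) ω') (fun _ => P) P'

/-- Equality of the finite-dimensional distributions of two random fields indexed by `ℝ²₊`. -/
def FddEq {Ω' : Type*} [MeasurableSpace Ω'] (P' : Measure Ω')
    (U V : (Fin 2 → ℝ) → Ω' → ℝ) : Prop :=
  ∀ (n : ℕ) (x : Fin n → Fin 2 → ℝ), (∀ k i, 0 < x k i) →
    P'.map (fun ω' (k : Fin n) => U (x k) ω') = P'.map (fun ω' (k : Fin n) => V (x k) ω')

/-- On `ℝ²₊` the random field `V` is distributed as `σ` times a fractional Brownian sheet with Hurst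
parameters `H₁, H₂`: it is Gaussian with mean zero and covariance
`(σ²/4) ∏ᵢ (xᵢ^{2Hᵢ} + yᵢ^{2Hᵢ} - |xᵢ - yᵢ|^{2Hᵢ})`. -/
structure IsScaledFBS {Ω' : Type*} [MeasurableSpace Ω'] (P' : Measure Ω')
    (σ H₁ H₂ : ℝ) (V : (Fin 2 → ℝ) → Ω' → ℝ) : Prop where
  H₁_mem : H₁ ∈ Set.Ioc (0 : ℝ) 1
  H₂_mem : H₂ ∈ Set.Ioc (0 : ℝ) 1
  gaussian : IsGaussianProcess (fun x : {x : Fin 2 → ℝ // ∀ i, 0 < x i} => V x.1) P'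
  mean_zero : ∀ x : Fin 2 → ℝ, (∀ i, 0 < x i) → ∫ ω', V x ω' ∂P' = 0
  covariance : ∀ x y : Fin 2 → ℝ, (∀ i, 0 < x i) → (∀ i, 0 < y i) →
    ∫ ω', V x ω' * V y ω' ∂P' = σ ^ 2 * (1 / 4 *
      ((x 0 ^ (2 * H₁) + y 0 ^ (2 * H₁) - |x 0 - y 0| ^ (2 * H₁)) *
       (x 1 ^ (2 * H₂) + y 1 ^ (2 * H₂) - |x 1 - y 1| ^ (2 * H₂))))

/-- The standard deviation `(E |V(1,1)|²)^{1/2}`. -/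
def sigmaOf {Ω' : Type*} [MeasurableSpace Ω'] (P' : Measure Ω')
    (V : (Fin 2 → ℝ) → Ω' → ℝ) : ℝ :=
  √(∫ ω', (V 1 ω') ^ 2 ∂P')

end AnisoScaling

end

/-!
The partial sums of `X` are linear forms in the innovations, so their limit laws follow from the
`L²` behaviour of deterministic kernels.

*Probability.* A linear form `∑ₛ g(s) ε(s)` is asymptotically centred Gaussian as soon as `∑ₛ g(s)²`
converges and `maxₛ |g(s)|` tends to zero (`tendsto_charFun_of_isL2Series`), and by the Cramér–Wold
device (`tendstoInDistribution_of_charFun_linearComb`) this suffices for the finite-dimensional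
distributions. Spread out over the cells of a lattice `T⁻¹ ℤ²` and normalised in `L²`, the
coefficients become a step function `stepFun T g` on the plane. If these step functions converge in
`L²(ℝ²)` to `h` while the cells shrink, both conditions hold with variance `∫ h²`, which is the
variance of the white noise integral of `h` (`tendsto_of_stepFun`).

*Scaling.* Let `δ_ν = diag(ν^{1/q₁}, ν^{1/q₂})` be the dilations with `ρ(δ_ν w) = ν ρ(w)` and
`T = B⁻¹ δ_ν`. With `ℓ = (r, r^γ)` the step function of the partial sum over `(0, ℓ₁x₁] × (0, ℓ₂x₂]`
is the integral over `τ ∈ (0, x]` of `ν b(⌈ℓτ⌉ - ⌈Tu⌉)`. Since `B (ℓτ - Tu) = δ_ν (Aτ - u)` with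
`A = δ_ν⁻¹ B diag(ℓ)`, and `a_∞` is homogeneous, this integrand is close to `a_∞(Aτ - u)`, and it
converges to `a_∞(Dτ - u)` if `A → D`. With `ν = r^κ` the entries of `A` are multiples of powers of
`r`; in each of the regimes `κ` is chosen so that the largest of these powers is constant, and `D`
consists of the entries of `B` that survive (`fddTendsto_partialSum`).

*Domination.* All kernels are bounded by a multiple of `1/ρ(Aτ - u)`. Away from the singularity this
is at most a multiple of `1/(1 + ρ(u))`, which is square integrable as `Q < 2`. Near the singularity
the inequality of arithmetic and geometric means bounds `1/ρ` by a product of an `L²` function of one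
coordinate and an `L¹` function of the other, as `Q̃₁ > 1`. Integration over `τ` smooths the latter
whenever the corresponding row of `A` does not vanish, and the Cauchy–Schwarz inequality gives an
`L²` bound that is uniform in `A` (`lintegral_sq_average_le`, `tendsto_lintegral_sq_average`).

*The unbalanced limits.* If `D` has a single nonzero entry, in row `j`, the kernel depends linearly
on one coordinate of `x`. In the other coordinate the field has stationary increments and is
self-similar with index `1 - (q_j/2)(2 - Q) < 1`. This yields the covariance of a fractional Brownian
sheet (`integral_lineKernel_mul`). Two sheets with parameters `(1, H)` and `(H', 1)`, `H < 1`, have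
non-proportional variances, unless the first one vanishes, which it does only if `L₊` and `L₋` do.
-/

noncomputable section

namespace AnisoScaling

/-! ### Series in the innovations -/

variable {Ω : Type*} [MeasurableSpace Ω] {P : Measure Ω}

/-- `Y = ∑ₛ g(s) ε(s)`, the series converging unconditionally in `L²`. -/
def IsL2Series (P : Measure Ω) (ε : (Fin 2 → ℤ) → Ω → ℝ) (g : (Fin 2 → ℤ) → ℝ) (Y : Ω → ℝ) :
    Prop :=
  MemLp Y 2 P ∧
    Tendsto (fun F : Finset (Fin 2 → ℤ) => eLpNorm (fun ω => Y ω - ∑ s ∈ F, g s * ε s ω) 2 P)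
      atTop (𝓝 0)

lemma IsStandardIID.memLp' {ε : (Fin 2 → ℤ) → Ω → ℝ} (hε : IsStandardIID P ε) (s : Fin 2 → ℤ) :
    MemLp (ε s) 2 P :=
  (hε.identDistrib s).memLp_iff.2 hε.memLp

lemma IsL2Series.const_mul {ε : (Fin 2 → ℤ) → Ω → ℝ} {g : (Fin 2 → ℤ) → ℝ} {Y : Ω → ℝ}
    (h : IsL2Series P ε g Y) (c : ℝ) :
    IsL2Series P ε (fun s => c * g s) (fun ω => c * Y ω) := by
  refine ⟨h.1.const_mul c, ?_⟩
  have h1 : ∀ F : Finset (Fin 2 → ℤ),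
      eLpNorm (fun ω => c * Y ω - ∑ s ∈ F, c * g s * ε s ω) 2 P
        = ‖c‖ₑ * eLpNorm (fun ω => Y ω - ∑ s ∈ F, g s * ε s ω) 2 P := by
    intro F
    rw [← eLpNorm_const_smul]
    congr 1
    ext ω
    simp [mul_sub, Finset.mul_sum, mul_assoc]
  simp_rw [h1]
  simpa using ENNReal.Tendsto.const_mul h.2 (Or.inr (by simp : ‖c‖ₑ ≠ ∞))

lemma IsL2Series.sum {ε : (Fin 2 → ℤ) → Ω → ℝ} (hε : IsStandardIID P ε) {κ : Type*} (T : Finset κ)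
    {g : κ → (Fin 2 → ℤ) → ℝ} {Y : κ → Ω → ℝ} (h : ∀ k ∈ T, IsL2Series P ε (g k) (Y k)) :
    IsL2Series P ε (fun s => ∑ k ∈ T, g k s) (fun ω => ∑ k ∈ T, Y k ω) := by
  refine ⟨memLp_finsetSum T fun k hk => (h k hk).1, ?_⟩
  have h0 : Tendsto (fun F : Finset (Fin 2 → ℤ) =>
      ∑ k ∈ T, eLpNorm (fun ω => Y k ω - ∑ s ∈ F, g k s * ε s ω) 2 P) atTop (𝓝 0) := by
    simpa using tendsto_finsetSum T fun k hk => (h k hk).2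
  refine tendsto_of_tendsto_of_tendsto_of_le_of_le tendsto_const_nhds h0 (fun _ => zero_le)
    fun F => ?_
  have h1 : (fun ω => ∑ k ∈ T, Y k ω - ∑ s ∈ F, (∑ k ∈ T, g k s) * ε s ω)
      = ∑ k ∈ T, fun ω => Y k ω - ∑ s ∈ F, g k s * ε s ω := by
    ext ω
    simp only [Finset.sum_apply, Finset.sum_sub_distrib, Finset.sum_mul]
    rw [Finset.sum_comm]
  simp only [h1]
  refine eLpNorm_sum_le (fun k hk => ?_) (by norm_num)
  exact ((h k hk).1.aestronglyMeasurable).sub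
    (memLp_finsetSum F fun s _ => (hε.memLp' s).const_mul (g k s)).aestronglyMeasurable

/-- The innovations are orthonormal in `L²`, so that square summable coefficients give a convergent
series. -/
lemma exists_isL2Series {ε : (Fin 2 → ℤ) → Ω → ℝ} (hε : IsStandardIID P ε) {g : (Fin 2 → ℤ) → ℝ}
    (hg : Summable fun s => g s ^ 2) : ∃ Y, IsL2Series P ε g Y := by
  let e : (Fin 2 → ℤ) → Lp ℝ 2 P := fun s => (hε.memLp' s).toLp
  have he : Orthonormal ℝ e := by
    rw [orthonormal_iff_ite]
    intro s t
    rw [L2.inner_def]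
    have h1 : ∫ ω, inner ℝ (e s ω) (e t ω) ∂P = ∫ ω, ε s ω * ε t ω ∂P := by
      refine integral_congr_ae ?_
      filter_upwards [(hε.memLp' s).coeFn_toLp, (hε.memLp' t).coeFn_toLp] with ω h2 h3
      simp only [e, h2, h3, RCLike.inner_apply, conj_trivial]
      ring
    rw [h1]
    split_ifs with hst
    · subst hst
      have := ((hε.identDistrib s).comp (measurable_id.pow_const 2)).integral_eq
      simp only [Function.comp_def, id] at this
      simp only [← pow_two]
      rw [this, hε.variance_one]
    · have hi : IndepFun (ε s) (ε t) P := hε.indep.indepFun hst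
      have := hi.integral_mul_eq_mul_integral (hε.memLp' s).aestronglyMeasurable
        (hε.memLp' t).aestronglyMeasurable
      simp only [Pi.mul_apply] at this
      rw [this, (hε.identDistrib s).integral_eq, hε.mean_zero, zero_mul]
  have hs : Summable fun s => g s • e s := by
    have h2 := (he.orthogonalFamily).summable_iff_norm_sq_summable (f := g)
    simp only [LinearIsometry.toSpanSingleton_apply, Real.norm_eq_abs, sq_abs] at h2
    exact h2.2 hg
  obtain ⟨Y, hY⟩ := hs
  refine ⟨Y, Lp.memLp Y, ?_⟩
  have h3 : Tendsto (fun F : Finset (Fin 2 → ℤ) => ‖Y - ∑ s ∈ F, g s • e s‖ₑ) atTop (𝓝 0) := by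
    have : Tendsto (fun F : Finset (Fin 2 → ℤ) => Y - ∑ s ∈ F, g s • e s) atTop (𝓝 (Y - Y)) :=
      tendsto_const_nhds.sub hY
    simpa using this.enorm
  refine h3.congr fun F => ?_
  rw [Lp.enorm_def]
  refine eLpNorm_congr_ae ?_
  have h4 : ∀ᵐ ω ∂P, ∀ s, e s ω = ε s ω := ae_all_iff.2 fun s => (hε.memLp' s).coeFn_toLp
  have h5 : ∀ᵐ ω ∂P, ∀ s, (g s • e s : Lp ℝ 2 P) ω = g s * e s ω :=
    ae_all_iff.2 fun s => by
      filter_upwards [Lp.coeFn_smul (g s) (e s)] with ω h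
      simpa using h
  filter_upwards [Lp.coeFn_sub Y (∑ s ∈ F, g s • e s), h4, h5,
    Lp.coeFn_finsetSum F fun s => g s • e s] with ω h6 h7 h8 h9
  rw [h6]
  simp only [Pi.sub_apply, h9, Finset.sum_apply, h8, h7]

lemma norm_prod_sub_prod_le {ι : Type*} (F : Finset ι) (z w : ι → ℂ) (hz : ∀ i, ‖z i‖ ≤ 1)
    (hw : ∀ i, ‖w i‖ ≤ 1) : ‖∏ i ∈ F, z i - ∏ i ∈ F, w i‖ ≤ ∑ i ∈ F, ‖z i - w i‖ := by
  classical
  induction F using Finset.induction_on with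
  | empty => simp
  | insert a F ha ih =>
    rw [Finset.prod_insert ha, Finset.prod_insert ha, Finset.sum_insert ha]
    have h1 : z a * ∏ i ∈ F, z i - w a * ∏ i ∈ F, w i
        = (z a - w a) * ∏ i ∈ F, z i + w a * (∏ i ∈ F, z i - ∏ i ∈ F, w i) := by ring
    have h2 : ‖∏ i ∈ F, z i‖ ≤ 1 := by
      rw [norm_prod]
      exact Finset.prod_le_one (fun _ _ => norm_nonneg _) fun i _ => hz i
    rw [h1]
    refine (norm_add_le _ _).trans ?_
    rw [norm_mul, norm_mul]
    have := mul_le_mul_of_nonneg_left h2 (norm_nonneg (z a - w a))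
    have := mul_le_mul (hw a) ih (norm_nonneg _) zero_le_one
    linarith

/-! ### The central limit theorem -/

section CentralLimit

variable [IsProbabilityMeasure P]
  {Ω' : Type*} [MeasurableSpace Ω'] {P' : Measure Ω'} [IsProbabilityMeasure P']

/-- To second order at `0` the characteristic function of a centred variable with unit variance
agrees with that of the standard normal law. -/
lemma charFun_sub_exp_le {X : Ω → ℝ} (hX : AEMeasurable X P) (h0 : ∫ ω, X ω ∂P = 0)
    (h1 : ∫ ω, X ω ^ 2 ∂P = 1) {η : ℝ} (hη : 0 < η) :
    ∃ δ > 0, ∀ x : ℝ, |x| ≤ δ →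
      ‖charFun (P.map X) x - Complex.exp (-(x ^ 2 / 2 : ℝ))‖ ≤ η * x ^ 2 := by
  have h2 := taylor_charFun_two hX h0 (by simpa using h1)
  have h3 : (fun x : ℝ => Complex.exp (-(x ^ 2 / 2 : ℝ)) - (1 - (x : ℂ) ^ 2 / 2))
      =o[𝓝 0] fun x : ℝ => x ^ 2 := by
    have h4 : (fun z : ℂ => Complex.exp z - 1 - z) =o[𝓝 0] fun z : ℂ => z := by
      have := (Complex.hasDerivAt_exp 0).isLittleO
      simpa using this
    have h5 : Tendsto (fun x : ℝ => (-(x ^ 2 / 2 : ℝ) : ℂ)) (𝓝 0) (𝓝 0) := by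
      have : Continuous fun x : ℝ => (-(x ^ 2 / 2 : ℝ) : ℂ) := by fun_prop
      simpa using this.tendsto 0
    have h6 := h4.comp_tendsto h5
    have h7 : (fun x : ℝ => (-(x ^ 2 / 2 : ℝ) : ℂ)) =O[𝓝 0] fun x : ℝ => x ^ 2 := by
      refine Asymptotics.IsBigO.of_bound 1 (Eventually.of_forall fun x => ?_)
      simp only [norm_neg, Complex.norm_real, Real.norm_eq_abs, one_mul, abs_div, abs_pow, sq_abs]
      rw [abs_of_pos (by norm_num : (0 : ℝ) < 2)]
      nlinarith [sq_nonneg x]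
    refine (h6.trans_isBigO h7).congr_left fun x => ?_
    simp only [Function.comp_apply]
    push_cast
    ring
  have h8 := (h2.sub h3).def hη
  rw [Metric.eventually_nhds_iff] at h8
  obtain ⟨δ, hδ, h9⟩ := h8
  refine ⟨δ / 2, by positivity, fun x hx => ?_⟩
  have h10 := h9 (y := x) (by rw [Real.dist_eq, sub_zero]; linarith)
  simpa using h10

/-- The error in the Gaussian approximation of a series is at most the sum of the errors of its
terms. -/
lemma IsL2Series.charFun_sub_exp_le {ε : (Fin 2 → ℤ) → Ω → ℝ} (hε : IsStandardIID P ε)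
    {g : (Fin 2 → ℤ) → ℝ} {Y : Ω → ℝ} (h : IsL2Series P ε g Y) (hg : Summable fun s => g s ^ 2)
    {η : ℝ} (hb : ∀ s, ‖charFun (P.map (ε 0)) (g s) - Complex.exp (-(g s ^ 2 / 2 : ℝ))‖
      ≤ η * g s ^ 2) :
    ‖charFun (P.map Y) 1 - Complex.exp (-((∑' s, g s ^ 2) / 2 : ℝ))‖ ≤ η * ∑' s, g s ^ 2 := by
  have hεm : ∀ s, AEMeasurable (ε s) P := fun s => (hε.memLp' s).aestronglyMeasurable.aemeasurable
  let S : Finset (Fin 2 → ℤ) → Ω → ℝ := fun F ω => ∑ s ∈ F, g s * ε s ω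
  have hSm : ∀ F, MemLp (S F) 2 P := fun F => memLp_finsetSum F fun s _ => (hε.memLp' s).const_mul _
  have hprod : ∀ F, charFun (P.map (S F)) 1 = ∏ s ∈ F, charFun (P.map (ε 0)) (g s) := by
    intro F
    have hind : iIndepFun (fun s ω => g s * ε s ω) P :=
      hε.indep.comp (fun s x => g s * x) fun s => measurable_const_mul _
    have := (hind.restrict F).charFun_map_fun_finsetSum_eq_prod (s := F)
      (fun s _ => (hεm s).const_mul _)
    rw [show S F = fun ω => ∑ s ∈ F, g s * ε s ω from rfl, this, Finset.prod_apply]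
    refine Finset.prod_congr rfl fun s _ => ?_
    rw [charFun_map_mul_comp (hεm s), mul_one, (hε.identDistrib s).map_eq]
  have hlim : Tendsto (fun F => charFun (P.map (S F)) 1) atTop (𝓝 (charFun (P.map Y) 1)) := by
    rw [tendsto_iff_norm_sub_tendsto_zero]
    have h2 : Tendsto (fun F => (eLpNorm (fun ω => Y ω - S F ω) 2 P).toReal) atTop (𝓝 0) := by
      rw [← ENNReal.toReal_zero]
      exact (ENNReal.tendsto_toReal ENNReal.zero_ne_top).comp h.2
    refine squeeze_zero (fun _ => norm_nonneg _) (fun F => ?_) h2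
    have hd : MemLp (fun ω => Y ω - S F ω) 2 P := h.1.sub (hSm F)
    have key : ∀ Z : Ω → ℝ, AEMeasurable Z P →
        charFun (P.map Z) 1 = ∫ ω, Complex.exp (Z ω * Complex.I) ∂P := by
      intro Z hZ
      rw [charFun_apply_real, integral_map hZ (by fun_prop)]
      simp
    have hint : ∀ Z : Ω → ℝ, AEMeasurable Z P →
        Integrable (fun ω => Complex.exp (Z ω * Complex.I)) P := by
      intro Z hZ
      refine Integrable.of_bound (C := 1) ?_ (Eventually.of_forall fun ω => ?_)
      · exact (Complex.continuous_exp.measurable.comp_aemeasurable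
          ((Complex.measurable_ofReal.comp_aemeasurable hZ).mul_const _)).aestronglyMeasurable
      · rw [Complex.norm_exp_ofReal_mul_I]
    have hYm := h.1.aestronglyMeasurable.aemeasurable
    have hFm := (hSm F).aestronglyMeasurable.aemeasurable
    rw [key _ hFm, key _ hYm, ← integral_sub (hint _ hFm) (hint _ hYm)]
    have h1 : ∫ ω, ‖Y ω - S F ω‖ ∂P ≤ (eLpNorm (fun ω => Y ω - S F ω) 2 P).toReal := by
      rw [integral_norm_eq_lintegral_enorm hd.aestronglyMeasurable, ← eLpNorm_one_eq_lintegral_enorm]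
      exact ENNReal.toReal_mono hd.2.ne
        (eLpNorm_le_eLpNorm_of_exponent_le (by norm_num) hd.aestronglyMeasurable)
    refine (norm_integral_le_of_norm_le (hd.integrable (by norm_num)).norm
      (Eventually.of_forall fun ω => ?_)).trans h1
    have h3 : Complex.exp (S F ω * Complex.I) - Complex.exp (Y ω * Complex.I)
        = Complex.exp (Y ω * Complex.I) *
          (Complex.exp (Complex.I * ((S F ω - Y ω : ℝ) : ℂ)) - 1) := by
      rw [mul_sub, ← Complex.exp_add, mul_one]
      congr 2
      push_cast
      ring
    rw [h3, norm_mul, Complex.norm_exp_ofReal_mul_I, one_mul]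
    refine (Real.norm_exp_I_mul_ofReal_sub_one_le).trans ?_
    rw [← norm_neg, neg_sub]
  have hexp : Tendsto (fun F : Finset (Fin 2 → ℤ) =>
      Complex.exp (-((∑ s ∈ F, g s ^ 2) / 2 : ℝ))) atTop
      (𝓝 (Complex.exp (-((∑' s, g s ^ 2) / 2 : ℝ)))) := by
    have hc : Continuous fun x : ℝ => Complex.exp (-(x / 2 : ℝ)) := by fun_prop
    exact (hc.tendsto _).comp hg.hasSum
  have hη : ∀ F : Finset (Fin 2 → ℤ), ‖charFun (P.map (S F)) 1 -
      Complex.exp (-((∑ s ∈ F, g s ^ 2) / 2 : ℝ))‖ ≤ η * ∑ s ∈ F, g s ^ 2 := by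
    intro F
    have h4 : Complex.exp (-((∑ s ∈ F, g s ^ 2) / 2 : ℝ))
        = ∏ s ∈ F, Complex.exp (-(g s ^ 2 / 2 : ℝ)) := by
      rw [← Complex.exp_sum]
      congr 1
      push_cast
      rw [Finset.sum_neg_distrib, Finset.sum_div]
    have : IsProbabilityMeasure (P.map (ε 0)) := Measure.isProbabilityMeasure_map (hεm 0)
    rw [hprod, h4, Finset.mul_sum]
    refine (norm_prod_sub_prod_le F _ _ (fun s => norm_charFun_le_one _) fun s => ?_).trans
      (Finset.sum_le_sum fun s _ => hb s)
    rw [← Complex.ofReal_neg, Complex.norm_exp_ofReal]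
    exact Real.exp_le_one_iff.2 (by nlinarith [sq_nonneg (g s)])
  exact le_of_tendsto_of_tendsto (hlim.sub hexp).norm (hg.hasSum.const_mul η)
    (Eventually.of_forall hη)

/-- A central limit theorem of Lindeberg type for linear forms in i.i.d. variables. -/
lemma tendsto_charFun_of_isL2Series {ε : (Fin 2 → ℤ) → Ω → ℝ} (hε : IsStandardIID P ε)
    {ι : Type*} {l : Filter ι} {g : ι → (Fin 2 → ℤ) → ℝ} {Y : ι → Ω → ℝ} {v : ℝ}
    (hY : ∀ᶠ i in l, IsL2Series P ε (g i) (Y i)) (hg : ∀ᶠ i in l, Summable fun s => g i s ^ 2)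
    (hv : Tendsto (fun i => ∑' s, g i s ^ 2) l (𝓝 v))
    (hmax : ∀ δ > 0, ∀ᶠ i in l, ∀ s, |g i s| ≤ δ) :
    Tendsto (fun i => charFun (P.map (Y i)) 1) l (𝓝 (Complex.exp (-(v / 2 : ℝ)))) := by
  have hexp : Tendsto (fun i => Complex.exp (-((∑' s, g i s ^ 2) / 2 : ℝ))) l
      (𝓝 (Complex.exp (-(v / 2 : ℝ)))) := by
    have hc : Continuous fun x : ℝ => Complex.exp (-(x / 2 : ℝ)) := by fun_prop
    exact (hc.tendsto _).comp hv
  suffices h : Tendsto (fun i => charFun (P.map (Y i)) 1 -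
      Complex.exp (-((∑' s, g i s ^ 2) / 2 : ℝ))) l (𝓝 0) by
    simpa using h.add hexp
  rw [Metric.tendsto_nhds]
  intro c hc
  have hv0 : ∀ᶠ i in l, ∑' s, g i s ^ 2 < |v| + 1 :=
    hv.eventually (gt_mem_nhds (by linarith [le_abs_self v]))
  have hη : 0 < c / 2 / (|v| + 1) := by positivity
  obtain ⟨δ, hδ, h1⟩ := charFun_sub_exp_le (hε.memLp' 0).aestronglyMeasurable.aemeasurable
    hε.mean_zero hε.variance_one hη
  filter_upwards [hY, hg, hv0, hmax δ hδ] with i h2 h3 h4 h5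
  rw [dist_zero_right]
  refine (h2.charFun_sub_exp_le hε h3 fun s => h1 _ (h5 s)).trans_lt ?_
  calc c / 2 / (|v| + 1) * ∑' s, g i s ^ 2 ≤ c / 2 / (|v| + 1) * (|v| + 1) := by gcongr
    _ = c / 2 := by field_simp
    _ < c := by linarith

/-- The Cramér–Wold device, with all characteristic functions taken at the point `1`. -/
lemma tendstoInDistribution_of_charFun_linearComb {n : ℕ} {Y : ℝ → Fin n → Ω → ℝ}
    {Z : Fin n → Ω' → ℝ} (hY : ∀ r k, AEMeasurable (Y r k) P) (hZ : ∀ k, AEMeasurable (Z k) P')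
    (h : ∀ θ : Fin n → ℝ, Tendsto (fun r => charFun (P.map fun ω => ∑ k, θ k * Y r k ω) 1) atTop
      (𝓝 (charFun (P'.map fun ω => ∑ k, θ k * Z k ω) 1))) :
    TendstoInDistribution (fun (r : ℝ) (ω : Ω) (k : Fin n) => Y r k ω) atTop
      (fun (ω' : Ω') (k : Fin n) => Z k ω') (fun _ => P) P' := by
  have key : TendstoInDistribution (fun (r : ℝ) (ω : Ω) => WithLp.toLp 2 fun k => Y r k ω) atTop
      (fun (ω' : Ω') => WithLp.toLp 2 fun k => Z k ω') (fun _ => P) P' := by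
    have hYm : ∀ r, AEMeasurable (fun ω => WithLp.toLp 2 fun k => Y r k ω) P := fun r =>
      (WithLp.measurable_toLp 2 _).comp_aemeasurable (aemeasurable_pi_lambda _ (hY r))
    have hZm : AEMeasurable (fun ω => WithLp.toLp 2 fun k => Z k ω) P' :=
      (WithLp.measurable_toLp 2 _).comp_aemeasurable (aemeasurable_pi_lambda _ hZ)
    refine ⟨hYm, hZm, tendsto_of_seq_tendsto fun r hr =>
      ProbabilityMeasure.tendsto_of_tendsto_charFun fun t => ?_⟩
    have h1 := (h fun k => t k).comp hr
    convert! h1 using 1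
    · ext m
      change charFun (P.map fun ω => WithLp.toLp 2 fun k => Y (r m) k ω) t =
        charFun (P.map fun ω => ∑ k, t k * Y (r m) k ω) 1
      rw [charFun_apply, charFun_apply_real, integral_map (hYm _) (by fun_prop),
        integral_map (by fun_prop) (by fun_prop)]
      simp [PiLp.inner_apply]
    · congr 1
      change charFun (P'.map fun ω => WithLp.toLp 2 fun k => Z k ω) t =
        charFun (P'.map fun ω => ∑ k, t k * Z k ω) 1
      rw [charFun_apply, charFun_apply_real, integral_map hZm (by fun_prop),
        integral_map (by fun_prop) (by fun_prop)]
      simp [PiLp.inner_apply]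
  exact key.continuous_comp (g := fun (x : EuclideanSpace ℝ (Fin n)) (k : Fin n) => x k)
    (by fun_prop)

end CentralLimit

/-! ### The white noise integral -/

section WhiteNoise

variable {Ω' : Type*} [MeasurableSpace Ω'] {P' : Measure Ω'}
  {I : Lp ℝ 2 (volume : Measure (Fin 2 → ℝ)) →ₗ[ℝ] Lp ℝ 2 P'}

lemma IsWhiteNoiseIntegral.charFun_one (hI : IsWhiteNoiseIntegral P' I)
    (h : Lp ℝ 2 (volume : Measure (Fin 2 → ℝ))) :
    charFun (P'.map (I h : Ω' → ℝ)) 1 = Complex.exp (-(‖h‖ ^ 2 / 2 : ℝ)) := by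
  rw [hI h, charFun_gaussianReal]
  congr 1
  push_cast
  simp

lemma coeFn_map_sum {κ : Type*} (I : Lp ℝ 2 (volume : Measure (Fin 2 → ℝ)) →ₗ[ℝ] Lp ℝ 2 P')
    (T : Finset κ) (c : κ → ℝ) (h : κ → Lp ℝ 2 (volume : Measure (Fin 2 → ℝ))) :
    (fun ω => ∑ k ∈ T, c k * (I (h k) : Ω' → ℝ) ω) =ᵐ[P'] (I (∑ k ∈ T, c k • h k) : Ω' → ℝ) := by
  have h1 : ∀ᵐ ω ∂P', ∀ k ∈ T, (c k • I (h k) : Lp ℝ 2 P') ω = c k * (I (h k) : Ω' → ℝ) ω := by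
    refine (Finset.eventually_all T).2 fun k _ => ?_
    filter_upwards [Lp.coeFn_smul (c k) (I (h k))] with ω h
    simpa using h
  rw [map_sum]
  simp only [map_smul]
  filter_upwards [Lp.coeFn_finsetSum T fun k => c k • I (h k), h1] with ω h2 h3
  rw [h2, Finset.sum_apply]
  exact Finset.sum_congr rfl fun k hk => (h3 k hk).symm

lemma IsWhiteNoiseIntegral.isGaussianProcess (hI : IsWhiteNoiseIntegral P' I) {κ : Type*}
    (h : κ → Lp ℝ 2 (volume : Measure (Fin 2 → ℝ))) :
    IsGaussianProcess (fun k => (I (h k) : Ω' → ℝ)) P' := by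
  refine ⟨fun J => ⟨isGaussian_of_map_eq_gaussianReal fun L => ?_⟩⟩
  have hm : AEMeasurable (fun ω => J.restrict fun k => (I (h k) : Ω' → ℝ) ω) P' :=
    aemeasurable_pi_lambda _ fun k => (Lp.aestronglyMeasurable _).aemeasurable
  classical
  refine ⟨0, ‖∑ k : J, L (fun j => if k = j then 1 else 0) • h k‖₊ ^ 2, ?_⟩
  rw [AEMeasurable.map_map_of_aemeasurable (by fun_prop) hm, ← hI]
  refine Measure.map_congr (EventuallyEq.trans (Eventually.of_forall fun ω => ?_)
    (coeFn_map_sum I Finset.univ (fun k : J => L (fun j => if k = j then 1 else 0)) fun k => h k))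
  have h3 := LinearMap.pi_apply_eq_sum_univ L.toLinearMap
    (J.restrict fun k => (I (h k) : Ω' → ℝ) ω)
  simp only [ContinuousLinearMap.coe_coe] at h3
  rw [Function.comp_apply]
  refine h3.trans (Finset.sum_congr rfl fun k _ => ?_)
  rw [smul_eq_mul, mul_comm, Finset.restrict_def]

lemma IsWhiteNoiseIntegral.integral_eq_zero (hI : IsWhiteNoiseIntegral P' I)
    (h : Lp ℝ 2 (volume : Measure (Fin 2 → ℝ))) : ∫ ω, (I h : Ω' → ℝ) ω ∂P' = 0 := by
  have h1 : ∫ x, x ∂(P'.map (I h : Ω' → ℝ)) = ∫ ω, (I h : Ω' → ℝ) ω ∂P' :=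
    integral_map (Lp.aestronglyMeasurable _).aemeasurable (by fun_prop)
  rw [← h1, hI h, integral_id_gaussianReal]

lemma IsWhiteNoiseIntegral.integral_sq (hI : IsWhiteNoiseIntegral P' I)
    (h : Lp ℝ 2 (volume : Measure (Fin 2 → ℝ))) :
    ∫ ω, (I h : Ω' → ℝ) ω ^ 2 ∂P' = ‖h‖ ^ 2 := by
  have h1 : ∫ x, x ^ 2 ∂(P'.map (I h : Ω' → ℝ)) = ∫ ω, (I h : Ω' → ℝ) ω ^ 2 ∂P' :=
    integral_map (Lp.aestronglyMeasurable _).aemeasurable (by fun_prop)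
  have h2 := variance_fun_id_gaussianReal (μ := 0) (v := ‖h‖₊ ^ 2)
  rw [variance_of_integral_eq_zero (by fun_prop) (by simp)] at h2
  rw [← h1, hI h]
  simpa using h2

/-- Being a linear isometry, the white noise integral preserves inner products. -/
lemma IsWhiteNoiseIntegral.integral_mul (hI : IsWhiteNoiseIntegral P' I)
    (f g : Lp ℝ 2 (volume : Measure (Fin 2 → ℝ))) :
    ∫ ω, (I f : Ω' → ℝ) ω * (I g : Ω' → ℝ) ω ∂P' = inner ℝ f g := by
  have hn : ∀ h, ‖I h‖ = ‖h‖ := by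
    intro h
    have h1 : ‖I h‖ ^ 2 = ‖h‖ ^ 2 := by
      rw [← hI.integral_sq h, ← real_inner_self_eq_norm_sq, L2.inner_def]
      refine integral_congr_ae (Eventually.of_forall fun ω => ?_)
      simp [pow_two]
    exact (pow_left_inj₀ (norm_nonneg _) (norm_nonneg _) two_ne_zero).1 h1
  have h2 := (LinearIsometry.mk I hn).inner_map_map f g
  simp only [LinearIsometry.coe_mk] at h2
  rw [← h2, L2.inner_def]
  refine integral_congr_ae (Eventually.of_forall fun ω => ?_)
  simp [mul_comm]

end WhiteNoise

/-! ### Averages over rectangles -/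

lemma lintegral_fin_two {i j : Fin 2} (hij : i ≠ j) {G : ℝ → ℝ → ℝ≥0∞}
    (hG : Measurable (Function.uncurry G)) :
    ∫⁻ w : Fin 2 → ℝ, G (w i) (w j) = ∫⁻ x, ∫⁻ y, G x y := by
  have h01 : ∀ {G : ℝ → ℝ → ℝ≥0∞}, Measurable (Function.uncurry G) →
      ∫⁻ w : Fin 2 → ℝ, G (w 0) (w 1) = ∫⁻ p : ℝ × ℝ, G p.1 p.2 := fun {G} hG =>
    (volume_preserving_finTwoArrow ℝ).lintegral_comp hG
  have hG' : Measurable (Function.uncurry fun x y => G y x) := hG.comp measurable_swap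
  fin_cases i <;> fin_cases j
  · exact absurd rfl hij
  · exact (h01 hG).trans (lintegral_prod _ hG.aemeasurable)
  · exact (h01 hG').trans (lintegral_prod_symm _ hG'.aemeasurable)
  · exact absurd rfl hij

lemma lintegral_comp_affine {a : ℝ} (ha : a ≠ 0) (b : ℝ) {ψ : ℝ → ℝ≥0∞} (hψ : Measurable ψ) :
    ∫⁻ x, ψ (a * x + b) = ENNReal.ofReal |a⁻¹| * ∫⁻ x, ψ x := by
  have h1 : ∫⁻ x, ψ (a * x + b) = ∫⁻ y, ψ (y + b) ∂(Measure.map (a * ·) volume) :=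
    (lintegral_map (f := fun y => ψ (y + b)) (by fun_prop) (by fun_prop)).symm
  rw [h1, Real.map_volume_mul_left ha, lintegral_smul_measure, lintegral_add_right_eq_self,
    smul_eq_mul]

/-- The Cauchy–Schwarz inequality for the measure with density `ψ`. -/
lemma lintegral_mul_sq_le {α : Type*} [MeasurableSpace α] {μ : Measure α} {φ ψ : α → ℝ≥0∞}
    (hφ : Measurable φ) (hψ : Measurable ψ) :
    (∫⁻ a, φ a * ψ a ∂μ) ^ 2 ≤ (∫⁻ a, φ a ^ 2 * ψ a ∂μ) * ∫⁻ a, ψ a ∂μ := by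
  have h2 : ∀ y : ℝ≥0∞, (y ^ (1 / 2 : ℝ)) ^ (2 : ℝ) = y := fun y => by
    rw [← ENNReal.rpow_mul]; norm_num
  have h1 := ENNReal.lintegral_mul_le_Lp_mul_Lq μ Real.HolderConjugate.two_two
    (f := fun a => φ a * ψ a ^ (1 / 2 : ℝ)) (g := fun a => ψ a ^ (1 / 2 : ℝ))
    (by fun_prop) (by fun_prop)
  have h3 : ∀ a, φ a * ψ a ^ (1 / 2 : ℝ) * ψ a ^ (1 / 2 : ℝ) = φ a * ψ a := fun a => by
    rw [mul_assoc, ← ENNReal.rpow_add_of_nonneg _ _ (by norm_num) (by norm_num)]; norm_num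
  simp only [Pi.mul_apply, h3, h2, ENNReal.mul_rpow_of_nonneg _ _ zero_le_two] at h1
  calc (∫⁻ a, φ a * ψ a ∂μ) ^ 2 ≤ ((∫⁻ a, φ a ^ (2 : ℝ) * ψ a ∂μ) ^ (1 / 2 : ℝ) *
        (∫⁻ a, ψ a ∂μ) ^ (1 / 2 : ℝ)) ^ 2 := by gcongr
    _ = _ := by
      rw [← ENNReal.rpow_two, ENNReal.mul_rpow_of_nonneg _ _ zero_le_two, h2, h2]
      simp only [ENNReal.rpow_two]

lemma measurableSet_rect (x : Fin 2 → ℝ) : MeasurableSet (rect x) :=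
  MeasurableSet.univ_pi fun _ => measurableSet_Ioc

lemma volume_rect_lt_top (x : Fin 2 → ℝ) : volume (rect x) < ∞ := by
  rw [rect, volume_pi_pi]
  simp only [Real.volume_Ioc]
  exact ENNReal.prod_lt_top fun _ _ => ENNReal.ofReal_lt_top

/-- If `F` is dominated by a product `φ ⊗ ψ` with `φ ∈ L²` and `ψ ∈ L¹`, then averaging the translates
of `F` over the points `A τ`, `τ ∈ (0, x]`, gives an `L²` function, with a bound that depends on `A`
only through a lower bound for one entry in the row of the `L¹` coordinate. -/
lemma lintegral_sq_average_le {i j k k' : Fin 2} (hij : i ≠ j) (hk : k ≠ k') {φ ψ : ℝ → ℝ≥0∞}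
    (hφ : Measurable φ) (hψ : Measurable ψ) {F : (Fin 2 → ℝ) → ℝ≥0∞}
    (hF : ∀ w, F w ≤ φ (w i) * ψ (w j)) {A : Matrix (Fin 2) (Fin 2) ℝ} {c : ℝ} (hc : 0 < c)
    (hA : c ≤ |A j k|) (x : Fin 2 → ℝ) :
    ∫⁻ u, (∫⁻ τ in rect x, F (A *ᵥ τ - u)) ^ 2 ≤
      (volume (rect x) * ((∫⁻ s, φ s ^ 2) * ∫⁻ s, ψ s)) *
        (ENNReal.ofReal (x k') * (ENNReal.ofReal c⁻¹ * ∫⁻ s, ψ s)) := by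
  have hA0 : A j k ≠ 0 := fun h => by rw [h, abs_zero] at hA; linarith
  have hmul : Measurable fun p : (Fin 2 → ℝ) × (Fin 2 → ℝ) => A *ᵥ p.1 - p.2 :=
    ((continuous_const.matrix_mulVec continuous_fst).sub continuous_snd).measurable
  have hrow : ∀ τ : Fin 2 → ℝ, (A *ᵥ τ) j = A j k * τ k + A j k' * τ k' := by
    intro τ
    rw [Matrix.mulVec, dotProduct, Fin.sum_univ_two]
    fin_cases k <;> fin_cases k'
    · exact absurd rfl hk
    · rfl
    · exact add_comm _ _
    · exact absurd rfl hk
  have hψ1 : ∀ u : Fin 2 → ℝ, ∫⁻ τ in rect x, ψ ((A *ᵥ τ - u) j) ≤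
      ENNReal.ofReal (x k') * (ENNReal.ofReal c⁻¹ * ∫⁻ s, ψ s) := by
    intro u
    let G : ℝ → ℝ → ℝ≥0∞ := fun y s =>
      (Set.Ioc 0 (x k')).indicator 1 y * ψ (A j k * s + (A j k' * y - u j))
    have hG : Measurable (Function.uncurry G) := by
      refine Measurable.mul ?_ (by fun_prop)
      exact (measurable_one.indicator measurableSet_Ioc).comp measurable_fst
    calc ∫⁻ τ in rect x, ψ ((A *ᵥ τ - u) j) ≤ ∫⁻ τ : Fin 2 → ℝ, G (τ k') (τ k) := by
          rw [← lintegral_indicator (measurableSet_rect x)]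
          refine lintegral_mono fun τ => ?_
          by_cases hτ : τ ∈ rect x
          swap
          · rw [Set.indicator_of_notMem hτ]
            exact zero_le
          rw [Set.indicator_of_mem hτ]
          have : τ k' ∈ Set.Ioc 0 (x k') := hτ k' (Set.mem_univ _)
          simp only [G, Set.indicator_of_mem this, Pi.one_apply, one_mul, Pi.sub_apply, hrow]
          rw [add_sub_assoc]
      _ = ∫⁻ y, (Set.Ioc 0 (x k')).indicator 1 y * (ENNReal.ofReal |(A j k)⁻¹| * ∫⁻ s, ψ s) := by
          rw [lintegral_fin_two hk.symm hG]
          refine lintegral_congr fun y => ?_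
          rw [lintegral_const_mul _ (by fun_prop), lintegral_comp_affine hA0 _ hψ]
      _ = ENNReal.ofReal (x k') * (ENNReal.ofReal |(A j k)⁻¹| * ∫⁻ s, ψ s) := by
          rw [lintegral_mul_const _ (measurable_one.indicator measurableSet_Ioc),
            lintegral_indicator_one measurableSet_Ioc, Real.volume_Ioc, sub_zero]
      _ ≤ _ := by
          gcongr
          rw [abs_inv]
          gcongr
  have hφψ : Measurable fun p : (Fin 2 → ℝ) × (Fin 2 → ℝ) =>
      φ ((A *ᵥ p.2 - p.1) i) ^ 2 * ψ ((A *ᵥ p.2 - p.1) j) := by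
    have h1 := hmul.comp measurable_swap
    exact ((hφ.comp ((measurable_pi_apply i).comp h1)).pow_const 2).mul
      (hψ.comp ((measurable_pi_apply j).comp h1))
  calc ∫⁻ u, (∫⁻ τ in rect x, F (A *ᵥ τ - u)) ^ 2
      ≤ ∫⁻ u, (∫⁻ τ in rect x, φ ((A *ᵥ τ - u) i) ^ 2 * ψ ((A *ᵥ τ - u) j)) *
          (ENNReal.ofReal (x k') * (ENNReal.ofReal c⁻¹ * ∫⁻ s, ψ s)) := by
        refine lintegral_mono fun u => ?_
        have h1 : Measurable fun τ : Fin 2 → ℝ => A *ᵥ τ - u :=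
          hmul.comp (measurable_id.prodMk measurable_const)
        calc (∫⁻ τ in rect x, F (A *ᵥ τ - u)) ^ 2
            ≤ (∫⁻ τ in rect x, φ ((A *ᵥ τ - u) i) * ψ ((A *ᵥ τ - u) j)) ^ 2 := by
              gcongr with τ; exact hF _
          _ ≤ _ := lintegral_mul_sq_le (hφ.comp ((measurable_pi_apply i).comp h1))
              (hψ.comp ((measurable_pi_apply j).comp h1))
          _ ≤ _ := by gcongr; exact hψ1 u
    _ = (∫⁻ u, ∫⁻ τ in rect x, φ ((A *ᵥ τ - u) i) ^ 2 * ψ ((A *ᵥ τ - u) j)) *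
          (ENNReal.ofReal (x k') * (ENNReal.ofReal c⁻¹ * ∫⁻ s, ψ s)) :=
        lintegral_mul_const _ hφψ.lintegral_prod_right'
    _ = _ := by
        congr 1
        rw [lintegral_lintegral_swap hφψ.aemeasurable]
        have h2 : ∀ τ : Fin 2 → ℝ, ∫⁻ u, φ ((A *ᵥ τ - u) i) ^ 2 * ψ ((A *ᵥ τ - u) j)
            = (∫⁻ s, φ s ^ 2) * ∫⁻ s, ψ s := by
          intro τ
          rw [lintegral_sub_left_eq_self (fun w : Fin 2 → ℝ => φ (w i) ^ 2 * ψ (w j)) (A *ᵥ τ),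
            lintegral_fin_two hij (G := fun s t => φ s ^ 2 * ψ t) (by fun_prop)]
          simp_rw [lintegral_const_mul _ hψ]
          rw [lintegral_mul_const _ (by fun_prop)]
        simp_rw [h2]
        rw [setLIntegral_const, mul_comm]

/-! ### The anisotropic gauge -/

/-- `1 / ρ(w)`, equal to `∞` at `w = 0`. -/
def rhoInv (q₁ q₂ : ℝ) (w : Fin 2 → ℝ) : ℝ≥0∞ := (ENNReal.ofReal (rho q₁ q₂ w))⁻¹

lemma rho_nonneg (q₁ q₂ : ℝ) (w : Fin 2 → ℝ) : 0 ≤ rho q₁ q₂ w := by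
  unfold rho; positivity

lemma rho_pos (q₁ q₂ : ℝ) {w : Fin 2 → ℝ} (hw : w ≠ 0) : 0 < rho q₁ q₂ w := by
  have h : w 0 ≠ 0 ∨ w 1 ≠ 0 := by
    by_contra! h
    exact hw (funext fun i => by fin_cases i <;> simp [h])
  unfold rho
  rcases h with h | h <;> positivity

lemma continuous_rho {q₁ q₂ : ℝ} (h₁ : 0 < q₁) (h₂ : 0 < q₂) : Continuous (rho q₁ q₂) := by
  unfold rho
  exact ((continuous_abs.comp (continuous_apply 0)).rpow_const fun _ => Or.inr h₁.le).add
    ((continuous_abs.comp (continuous_apply 1)).rpow_const fun _ => Or.inr h₂.le)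

lemma measurable_rho (q₁ q₂ : ℝ) : Measurable (rho q₁ q₂) := by
  unfold rho; fun_prop

lemma measurable_rhoInv (q₁ q₂ : ℝ) : Measurable (rhoInv q₁ q₂) :=
  (measurable_rho q₁ q₂).ennreal_ofReal.inv

lemma rho_eq (q₁ q₂ : ℝ) {i j : Fin 2} (hij : i ≠ j) (w : Fin 2 → ℝ) :
    rho q₁ q₂ w = |w i| ^ (![q₁, q₂] i) + |w j| ^ (![q₁, q₂] j) := by
  fin_cases i <;> fin_cases j
  · exact absurd rfl hij
  · rfl
  · exact add_comm _ _
  · exact absurd rfl hij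

lemma abs_add_rpow_le {q : ℝ} (hq : 0 < q) (a b : ℝ) :
    |a + b| ^ q ≤ 2 ^ q * (|a| ^ q + |b| ^ q) := by
  have h1 : |a + b| ≤ 2 * max |a| |b| := by
    have := abs_add_le a b
    have := le_max_left |a| |b|
    have := le_max_right |a| |b|
    linarith
  calc |a + b| ^ q ≤ (2 * max |a| |b|) ^ q := by gcongr
    _ = 2 ^ q * max |a| |b| ^ q := Real.mul_rpow (by norm_num) (by positivity)
    _ ≤ 2 ^ q * (|a| ^ q + |b| ^ q) := by
      gcongr
      rcases max_choice |a| |b| with h | h <;> rw [h]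
      · linarith [Real.rpow_nonneg (abs_nonneg b) q]
      · linarith [Real.rpow_nonneg (abs_nonneg a) q]

/-- `ρ` satisfies the triangle inequality up to a constant factor. -/
lemma exists_rho_add_le {q₁ q₂ : ℝ} (h₁ : 0 < q₁) (h₂ : 0 < q₂) :
    ∃ C : ℝ, 1 ≤ C ∧ ∀ v w, rho q₁ q₂ (v + w) ≤ C * (rho q₁ q₂ v + rho q₁ q₂ w) := by
  have e1 : (1 : ℝ) ≤ 2 ^ q₁ := Real.one_le_rpow (by norm_num) h₁.le
  have e2 : (1 : ℝ) ≤ 2 ^ q₂ := Real.one_le_rpow (by norm_num) h₂.le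
  refine ⟨2 ^ q₁ * 2 ^ q₂, by nlinarith, fun v w => ?_⟩
  have a1 := abs_add_rpow_le h₁ (v 0) (w 0)
  have a2 := abs_add_rpow_le h₂ (v 1) (w 1)
  have b1 : 0 ≤ |v 0| ^ q₁ + |w 0| ^ q₁ := by positivity
  have b2 : 0 ≤ |v 1| ^ q₂ + |w 1| ^ q₂ := by positivity
  simp only [rho, Pi.add_apply]
  nlinarith [mul_nonneg (mul_nonneg (by positivity : (0 : ℝ) ≤ 2 ^ q₁) b1) (sub_nonneg.2 e2),
    mul_nonneg (mul_nonneg (by positivity : (0 : ℝ) ≤ 2 ^ q₂) b2) (sub_nonneg.2 e1)]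

lemma rpow_mul_rpow_le_add {a b θ : ℝ} (ha : 0 ≤ a) (hb : 0 ≤ b) (hθ : 0 ≤ θ) (hθ1 : θ ≤ 1) :
    a ^ θ * b ^ (1 - θ) ≤ a + b := by
  have := Real.geom_mean_le_arith_mean2_weighted hθ (sub_nonneg.2 hθ1) ha hb (by ring)
  nlinarith

/-- The weighted inequality of arithmetic and geometric means separates the variables in `1 / ρ`. -/
lemma rhoInv_le_mul {q₁ q₂ : ℝ} (hq : ∀ i, 0 < ![q₁, q₂] i) {i j : Fin 2} (hij : i ≠ j) {θ : ℝ}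
    (hθ : 0 ≤ θ) (hθ1 : θ ≤ 1) (w : Fin 2 → ℝ) :
    rhoInv q₁ q₂ w ≤ (ENNReal.ofReal |w i| ^ (![q₁, q₂] i * θ))⁻¹ *
      (ENNReal.ofReal |w j| ^ (![q₁, q₂] j * (1 - θ)))⁻¹ := by
  have e1 : 0 ≤ ![q₁, q₂] i * θ := mul_nonneg (hq i).le hθ
  have e2 : 0 ≤ ![q₁, q₂] j * (1 - θ) := mul_nonneg (hq j).le (sub_nonneg.2 hθ1)
  rw [ENNReal.ofReal_rpow_of_nonneg (abs_nonneg _) e1, ENNReal.ofReal_rpow_of_nonneg (abs_nonneg _) e2,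
    ← ENNReal.mul_inv (Or.inr ENNReal.ofReal_ne_top) (Or.inl ENNReal.ofReal_ne_top),
    ← ENNReal.ofReal_mul (by positivity), rhoInv]
  refine ENNReal.inv_le_inv.2 (ENNReal.ofReal_le_ofReal ?_)
  rw [Real.rpow_mul (abs_nonneg _), Real.rpow_mul (abs_nonneg _), rho_eq q₁ q₂ hij]
  exact rpow_mul_rpow_le_add (by positivity) (by positivity) hθ hθ1

lemma lintegral_abs_rpow_inv_lt_top {β : ℝ} (hβ1 : β < 1) :
    ∫⁻ y in Set.Icc (-1 : ℝ) 1, (ENNReal.ofReal |y| ^ β)⁻¹ < ∞ := by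
  have h1 : IntegrableOn (fun y : ℝ => |y| ^ (-β)) (Set.Icc (-1) 1) := by
    have h2 : IntervalIntegrable (fun y : ℝ => |y| ^ (-β)) volume 0 1 := by
      refine (intervalIntegral.intervalIntegrable_rpow' (r := -β) (by linarith)).congr fun y hy => ?_
      rw [Set.uIoc_of_le zero_le_one] at hy
      simp only [abs_of_pos hy.1]
    have h3 : IntervalIntegrable (fun y : ℝ => |y| ^ (-β)) volume (-1) 0 := by
      have := (IntervalIntegrable.iff_comp_neg (f := fun y : ℝ => |y| ^ (-β))).1 h2
      simpa using this.symm
    exact (integrableOn_Icc_iff_integrableOn_Ioc).2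
      ((intervalIntegrable_iff_integrableOn_Ioc_of_le (by norm_num)).1 (h3.trans h2))
  refine lt_of_eq_of_lt ?_ h1.2
  refine lintegral_congr_ae (ae_restrict_of_ae ?_)
  have h0 : ∀ᵐ y : ℝ, y ≠ 0 := by simp [ae_iff]
  filter_upwards [h0] with y hy
  have hy' : 0 < |y| := abs_pos.2 hy
  rw [ENNReal.ofReal_rpow_of_pos hy', ← ENNReal.ofReal_inv_of_pos (by positivity),
    ← Real.rpow_neg hy'.le, Real.enorm_of_nonneg (by positivity)]

/-- `1 / ρ` near the singularity, `0` away from it. -/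
def rhoInvTrunc (q₁ q₂ δ : ℝ) : (Fin 2 → ℝ) → ℝ≥0∞ :=
  {w | rho q₁ q₂ w ≤ δ}.indicator (rhoInv q₁ q₂)

lemma measurable_rhoInvTrunc (q₁ q₂ δ : ℝ) : Measurable (rhoInvTrunc q₁ q₂ δ) :=
  (measurable_rhoInv q₁ q₂).indicator (measurableSet_le (measurable_rho q₁ q₂) measurable_const)

lemma rhoInvTrunc_of_le {q₁ q₂ δ : ℝ} {w : Fin 2 → ℝ} (hw : rho q₁ q₂ w ≤ δ) :
    rhoInvTrunc q₁ q₂ δ w = rhoInv q₁ q₂ w :=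
  Set.indicator_of_mem (s := {w | rho q₁ q₂ w ≤ δ}) hw _

lemma rhoInvTrunc_of_lt {q₁ q₂ δ : ℝ} {w : Fin 2 → ℝ} (hw : δ < rho q₁ q₂ w) :
    rhoInvTrunc q₁ q₂ δ w = 0 :=
  Set.indicator_of_notMem (s := {w | rho q₁ q₂ w ≤ δ}) (not_le.2 hw) _

/-- The singularity of `1 / ρ` contributes little to the averages over `A τ`, `τ ∈ (0, x]`,
uniformly in `A`. -/
lemma exists_lintegral_trunc_le {q₁ q₂ : ℝ} (hq : ∀ i, 0 < ![q₁, q₂] i)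
    (hQ : ∀ i j, i ≠ j → 1 < 1 / (2 * ![q₁, q₂] i) + 1 / ![q₁, q₂] j) (j k : Fin 2) {c : ℝ}
    (hc : 0 < c) (x : Fin 2 → ℝ) {ε : ℝ≥0∞} (hε : 0 < ε) :
    ∃ δ > 0, ∀ A : Matrix (Fin 2) (Fin 2) ℝ, c ≤ |A j k| →
      ∫⁻ u, (∫⁻ τ in rect x, rhoInvTrunc q₁ q₂ δ (A *ᵥ τ - u)) ^ 2 ≤ ε := by
  obtain ⟨i, hij⟩ : ∃ i : Fin 2, i ≠ j := exists_ne j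
  obtain ⟨k', hk⟩ : ∃ k' : Fin 2, k' ≠ k := exists_ne k
  set p := ![q₁, q₂] i with hp
  set q := ![q₁, q₂] j with hqj
  have hp0 : 0 < p := hq i
  have hq0 : 0 < q := hq j
  -- the exponent `p θ` is in the range of square integrability, `q (1 - θ)` in that of integrability
  obtain ⟨θ, hθ, hθ'⟩ : ∃ θ, max 0 (1 - 1 / q) < θ ∧ θ < min 1 (1 / (2 * p)) := by
    refine exists_between (max_lt (lt_min one_pos (by positivity)) (lt_min ?_ ?_))
    · have : 0 < 1 / q := by positivity
      linarith
    · linarith [hQ i j hij]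
  have hθ0 : 0 < θ := (le_max_left _ _).trans_lt hθ
  have hθ1 : θ < 1 := hθ'.trans_le (min_le_left _ _)
  have hα : p * θ * 2 < 1 := by
    have := hθ'.trans_le (min_le_right _ _)
    rw [lt_div_iff₀ (by positivity)] at this
    linarith
  have hβ : q * (1 - θ) < 1 := by
    have : 1 - θ < 1 / q := by linarith [(le_max_right _ _).trans_lt hθ]
    rw [lt_div_iff₀ hq0] at this
    linarith
  let φ : ℝ → ℝ≥0∞ := (Set.Icc (-1 : ℝ) 1).indicator fun y => (ENNReal.ofReal |y| ^ (p * θ))⁻¹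
  let ψ : ℝ → ℝ → ℝ≥0∞ := fun η =>
    (Set.Icc (-η) η).indicator fun y => (ENNReal.ofReal |y| ^ (q * (1 - θ)))⁻¹
  have hφm : Measurable φ := Measurable.indicator (by fun_prop) measurableSet_Icc
  have hψm : ∀ η, Measurable (ψ η) := fun η => Measurable.indicator (by fun_prop) measurableSet_Icc
  have hφ2 : ∫⁻ y, φ y ^ 2 < ∞ := by
    have h1 : (fun y => φ y ^ 2) = (Set.Icc (-1 : ℝ) 1).indicator
        fun y => (ENNReal.ofReal |y| ^ (p * θ * 2))⁻¹ := by
      ext y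
      by_cases hy : y ∈ Set.Icc (-1 : ℝ) 1
      · simp only [φ, Set.indicator_of_mem hy]
        rw [ENNReal.rpow_mul _ (p * θ) 2, ENNReal.rpow_two, ENNReal.inv_pow]
      · simp [φ, Set.indicator_of_notMem hy]
    rw [h1, lintegral_indicator measurableSet_Icc]
    exact lintegral_abs_rpow_inv_lt_top hα
  have hψ1 : ∫⁻ y in Set.Icc (-1 : ℝ) 1, (ENNReal.ofReal |y| ^ (q * (1 - θ)))⁻¹ < ∞ :=
    lintegral_abs_rpow_inv_lt_top hβ
  have hlim : Tendsto (fun η => ∫⁻ y, ψ η y) (𝓝[>] 0) (𝓝 0) := by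
    have h2 : Tendsto (fun η : ℝ => (volume.restrict (Set.Icc (-1 : ℝ) 1)) (Set.Icc (-η) η))
        (𝓝[>] 0) (𝓝 0) := by
      have h3 : Tendsto (fun η : ℝ => volume (Set.Icc (-η) η)) (𝓝[>] 0) (𝓝 0) := by
        simp only [Real.volume_Icc]
        have : Continuous fun η : ℝ => ENNReal.ofReal (η - -η) :=
          ENNReal.continuous_ofReal.comp (by fun_prop)
        simpa using (this.tendsto 0).mono_left nhdsWithin_le_nhds
      exact tendsto_of_tendsto_of_tendsto_of_le_of_le tendsto_const_nhds h3 (fun _ => zero_le)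
        fun η => Measure.restrict_apply_le _ _
    have h4 := tendsto_setLIntegral_zero hψ1.ne h2
    refine h4.congr' ?_
    filter_upwards [Ioc_mem_nhdsGT (zero_lt_one' ℝ)] with η hη
    rw [Measure.restrict_restrict measurableSet_Icc,
      Set.inter_eq_left.2 (Set.Icc_subset_Icc (by linarith [hη.2]) hη.2),
      ← lintegral_indicator measurableSet_Icc]
  have hlim2 : Tendsto (fun η => (volume (rect x) * ((∫⁻ s, φ s ^ 2) * ∫⁻ s, ψ η s)) *
        (ENNReal.ofReal (x k') * (ENNReal.ofReal c⁻¹ * ∫⁻ s, ψ η s))) (𝓝[>] 0) (𝓝 0) := by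
    have a1 := ENNReal.Tendsto.const_mul (a := volume (rect x)) (ENNReal.Tendsto.const_mul
      (a := ∫⁻ s, φ s ^ 2) hlim (Or.inr hφ2.ne)) (Or.inr (volume_rect_lt_top x).ne)
    have a2 := ENNReal.Tendsto.const_mul (a := ENNReal.ofReal (x k')) (ENNReal.Tendsto.const_mul
      (a := ENNReal.ofReal c⁻¹) hlim (Or.inr ENNReal.ofReal_ne_top)) (Or.inr ENNReal.ofReal_ne_top)
    simpa using ENNReal.Tendsto.mul a1 (by simp) a2 (by simp)
  obtain ⟨η, hη, hη01⟩ := ((hlim2.eventually (Iic_mem_nhds hε)).and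
    (Ioc_mem_nhdsGT (zero_lt_one' ℝ))).exists
  refine ⟨η ^ q, Real.rpow_pos_of_pos hη01.1 q, fun A hA => ?_⟩
  refine (lintegral_sq_average_le hij hk.symm hφm (hψm η) (fun w => ?_) hc hA x).trans hη
  rcases lt_or_ge (η ^ q) (rho q₁ q₂ w) with hw | hw
  · rw [rhoInvTrunc_of_lt hw]
    exact zero_le
  rw [rhoInvTrunc_of_le hw]
  have hw' : |w i| ^ p + |w j| ^ q ≤ η ^ q := by rwa [← rho_eq q₁ q₂ hij]
  have hwj : |w j| ≤ η := by
    have : |w j| ^ q ≤ η ^ q := by linarith [Real.rpow_nonneg (abs_nonneg (w i)) p]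
    exact (Real.rpow_le_rpow_iff (abs_nonneg _) hη01.1.le hq0).1 this
  have hwi : |w i| ≤ 1 := by
    have h1 : |w i| ^ p ≤ 1 ^ p := by
      rw [Real.one_rpow]
      linarith [Real.rpow_nonneg (abs_nonneg (w j)) q, Real.rpow_le_one hη01.1.le hη01.2 hq0.le]
    exact (Real.rpow_le_rpow_iff (abs_nonneg _) zero_le_one hp0).1 h1
  simp only [φ, ψ]
  rw [Set.indicator_of_mem (Set.mem_Icc.2 (abs_le.1 hwi)),
    Set.indicator_of_mem (Set.mem_Icc.2 (abs_le.1 hwj))]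
  exact rhoInv_le_mul hq hij hθ0.le hθ1.le w

/-! ### Convergence of averaged kernels -/

/-- `1 / (1 + ρ(u))`. -/
def oneAddRhoInv (q₁ q₂ : ℝ) (u : Fin 2 → ℝ) : ℝ≥0∞ := (ENNReal.ofReal (1 + rho q₁ q₂ u))⁻¹

lemma measurable_oneAddRhoInv (q₁ q₂ : ℝ) : Measurable (oneAddRhoInv q₁ q₂) :=
  ((measurable_rho q₁ q₂).const_add 1).ennreal_ofReal.inv

lemma lintegral_one_add_abs_rpow_lt_top {q s : ℝ} (hq : 0 < q) (hs : 0 < s) (hqs : 1 < q * s) :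
    ∫⁻ y : ℝ, ENNReal.ofReal ((1 + |y| ^ q) ^ (-s)) < ∞ := by
  have h1 : ∫⁻ y : ℝ, ENNReal.ofReal ((1 + ‖y‖) ^ (-(q * s))) < ∞ :=
    finite_integral_one_add_norm (by simpa using hqs)
  have h2 : ∀ y : ℝ, ENNReal.ofReal ((1 + |y| ^ q) ^ (-s)) ≤
      ENNReal.ofReal ((2 ^ q) ^ s) * ENNReal.ofReal ((1 + ‖y‖) ^ (-(q * s))) := by
    intro y
    rw [← ENNReal.ofReal_mul (by positivity)]
    refine ENNReal.ofReal_le_ofReal ?_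
    have h3 : (1 + |y|) ^ q ≤ 2 ^ q * (1 + |y| ^ q) := by
      have := abs_add_rpow_le hq 1 |y|
      rwa [abs_of_pos (by positivity : 0 < 1 + |y|), abs_one, Real.one_rpow, abs_abs] at this
    have h4 : ((1 + |y|) ^ q) ^ s ≤ (2 ^ q) ^ s * (1 + |y| ^ q) ^ s := by
      rw [← Real.mul_rpow (by positivity) (by positivity)]
      gcongr
    rw [Real.norm_eq_abs, Real.rpow_neg (by positivity), Real.rpow_neg (by positivity),
      Real.rpow_mul (by positivity), ← div_eq_mul_inv, inv_eq_one_div,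
      div_le_div_iff₀ (by positivity) (by positivity), one_mul]
    exact h4
  refine (lintegral_mono h2).trans_lt ?_
  rw [lintegral_const_mul _ (by fun_prop)]
  exact ENNReal.mul_lt_top ENNReal.ofReal_lt_top h1

lemma lintegral_oneAddRhoInv_sq_lt_top {q₁ q₂ : ℝ} (h₁ : 0 < q₁) (h₂ : 0 < q₂)
    (hQ : bigQ q₁ q₂ < 2) : ∫⁻ u, oneAddRhoInv q₁ q₂ u ^ 2 < ∞ := by
  -- the slack `2 - Q` is split evenly between the two coordinates
  set η := (2 - bigQ q₁ q₂) / 4 with hη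
  have hη0 : 0 < η := by linarith
  set θ := 1 / (2 * q₁) + η with hθ
  have hθ' : 1 - θ = 1 / (2 * q₂) + η := by
    rw [hθ, hη, bigQ]
    field_simp
    ring
  have a1 : 0 < 1 / (2 * q₁) := by positivity
  have a2 : 0 < 1 / (2 * q₂) := by positivity
  have b1 : 1 < q₁ * (2 * θ) := by
    rw [hθ]
    have : q₁ * (2 * (1 / (2 * q₁) + η)) = 1 + 2 * q₁ * η := by field_simp
    rw [this]
    nlinarith [mul_pos h₁ hη0]
  have b2 : 1 < q₂ * (2 * (1 - θ)) := by
    rw [hθ']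
    have : q₂ * (2 * (1 / (2 * q₂) + η)) = 1 + 2 * q₂ * η := by field_simp
    rw [this]
    nlinarith [mul_pos h₂ hη0]
  have hle : ∀ u : Fin 2 → ℝ, oneAddRhoInv q₁ q₂ u ^ 2 ≤
      ENNReal.ofReal ((1 + |u 0| ^ q₁) ^ (-(2 * θ))) *
        ENNReal.ofReal ((1 + |u 1| ^ q₂) ^ (-(2 * (1 - θ)))) := by
    intro u
    have c1 : 1 ≤ 1 + |u 0| ^ q₁ := by linarith [Real.rpow_nonneg (abs_nonneg (u 0)) q₁]
    have c2 : 1 ≤ 1 + |u 1| ^ q₂ := by linarith [Real.rpow_nonneg (abs_nonneg (u 1)) q₂]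
    have c3 : 0 < 1 + rho q₁ q₂ u := by linarith [rho_nonneg q₁ q₂ u]
    have h3 : (1 + |u 0| ^ q₁) ^ θ * (1 + |u 1| ^ q₂) ^ (1 - θ) ≤ 1 + rho q₁ q₂ u := by
      have e1 : (1 + |u 0| ^ q₁) ≤ 1 + rho q₁ q₂ u := by
        unfold rho; linarith
      have e2 : (1 + |u 1| ^ q₂) ≤ 1 + rho q₁ q₂ u := by
        unfold rho; linarith
      have e3 : 0 ≤ 1 - θ := by rw [hθ']; positivity
      calc (1 + |u 0| ^ q₁) ^ θ * (1 + |u 1| ^ q₂) ^ (1 - θ)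
          ≤ (1 + rho q₁ q₂ u) ^ θ * (1 + rho q₁ q₂ u) ^ (1 - θ) := by gcongr
        _ = 1 + rho q₁ q₂ u := by
            rw [← Real.rpow_add c3]; simp
    rw [oneAddRhoInv, ← ENNReal.ofReal_inv_of_pos c3, ← ENNReal.ofReal_pow (by positivity),
      ← ENNReal.ofReal_mul (by positivity)]
    refine ENNReal.ofReal_le_ofReal ?_
    rw [Real.rpow_neg (by positivity), Real.rpow_neg (by positivity), ← mul_inv, inv_pow]
    refine inv_anti₀ (by positivity) ?_
    have h4 := pow_le_pow_left₀ (by positivity) h3 2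
    rw [mul_pow, ← Real.rpow_natCast, ← Real.rpow_mul (by positivity), ← Real.rpow_natCast,
      ← Real.rpow_mul (by positivity)] at h4
    refine le_trans (le_of_eq ?_) h4
    push_cast
    rw [mul_comm θ 2, mul_comm (1 - θ) 2]
  refine (lintegral_mono hle).trans_lt ?_
  rw [lintegral_fin_two (i := 0) (j := 1) (by decide) (G := fun s t =>
    ENNReal.ofReal ((1 + |s| ^ q₁) ^ (-(2 * θ))) *
        ENNReal.ofReal ((1 + |t| ^ q₂) ^ (-(2 * (1 - θ))))) (by fun_prop)]
  simp_rw [lintegral_const_mul _ (by fun_prop : Measurable fun t : ℝ =>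
    ENNReal.ofReal ((1 + |t| ^ q₂) ^ (-(2 * (1 - θ)))))]
  rw [lintegral_mul_const _ (by fun_prop)]
  exact ENNReal.mul_lt_top
    (lintegral_one_add_abs_rpow_lt_top h₁ (by positivity) b1)
    (lintegral_one_add_abs_rpow_lt_top h₂ (by rw [hθ']; positivity) b2)

lemma rho_neg (q₁ q₂ : ℝ) (w : Fin 2 → ℝ) : rho q₁ q₂ (-w) = rho q₁ q₂ w := by
  simp [rho]

/-- Away from its singularity `1 / ρ(a - u)` decays like `1 / (1 + ρ(u))`, uniformly over bounded
`a`. -/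
lemma exists_rhoInv_le {q₁ q₂ : ℝ} (h₁ : 0 < q₁) (h₂ : 0 < q₂) {δ M : ℝ} (hδ : 0 < δ)
    (hM : 0 ≤ M) : ∃ K : ℝ≥0∞, K ≠ ∞ ∧ ∀ a u : Fin 2 → ℝ, rho q₁ q₂ a ≤ M →
      δ < rho q₁ q₂ (a - u) → rhoInv q₁ q₂ (a - u) ≤ K * oneAddRhoInv q₁ q₂ u := by
  obtain ⟨C, hC, hadd⟩ := exists_rho_add_le h₁ h₂
  refine ⟨ENNReal.ofReal ((1 + C * M) / δ + C), ENNReal.ofReal_ne_top, fun a u ha hau => ?_⟩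
  have hpos : 0 < rho q₁ q₂ (a - u) := hδ.trans hau
  have hpos' : 0 < 1 + rho q₁ q₂ u := by linarith [rho_nonneg q₁ q₂ u]
  have h3 : 1 + rho q₁ q₂ u ≤ ((1 + C * M) / δ + C) * rho q₁ q₂ (a - u) := by
    have h4 := hadd a (-(a - u))
    rw [rho_neg, show a + -(a - u) = u by abel] at h4
    have h5 : 1 + C * M ≤ (1 + C * M) / δ * rho q₁ q₂ (a - u) := by
      rw [div_mul_eq_mul_div, le_div_iff₀ hδ]
      have : 0 ≤ 1 + C * M := by positivity
      nlinarith
    nlinarith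
  rw [rhoInv, oneAddRhoInv, ← ENNReal.ofReal_inv_of_pos hpos, ← ENNReal.ofReal_inv_of_pos hpos',
    ← ENNReal.ofReal_mul (by positivity)]
  refine ENNReal.ofReal_le_ofReal ?_
  rw [← div_eq_mul_inv, inv_eq_one_div, div_le_div_iff₀ hpos hpos', one_mul]
  exact h3

lemma abs_entry_le_sum (D : Matrix (Fin 2) (Fin 2) ℝ) (i j : Fin 2) :
    |D i j| ≤ ∑ i, ∑ j, |D i j| :=
  (Finset.single_le_sum (f := fun j => |D i j|) (fun _ _ => abs_nonneg _)
    (Finset.mem_univ j)).trans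
    (Finset.single_le_sum (f := fun i => ∑ j, |D i j|)
      (fun _ _ => Finset.sum_nonneg fun _ _ => abs_nonneg _) (Finset.mem_univ i))

lemma exists_rho_mulVec_le {q₁ q₂ : ℝ} (h₁ : 0 < q₁) (h₂ : 0 < q₂) (x : Fin 2 → ℝ) {b : ℝ} :
    ∃ M, 0 ≤ M ∧ ∀ A : Matrix (Fin 2) (Fin 2) ℝ, (∀ i j, |A i j| ≤ b) → ∀ τ ∈ rect x,
      rho q₁ q₂ (A *ᵥ τ) ≤ M := by
  refine ⟨(|b| * (|x 0| + |x 1|)) ^ q₁ + (|b| * (|x 0| + |x 1|)) ^ q₂, by positivity,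
    fun A hA τ hτ => ?_⟩
  have hτ' : ∀ i, |τ i| ≤ |x i| := fun i => by
    have := hτ i (Set.mem_univ i)
    rw [abs_of_pos this.1]
    exact this.2.trans (le_abs_self _)
  have h3 : ∀ i, |(A *ᵥ τ) i| ≤ |b| * (|x 0| + |x 1|) := by
    intro i
    rw [Matrix.mulVec, dotProduct, Fin.sum_univ_two]
    refine (abs_add_le _ _).trans ?_
    rw [abs_mul, abs_mul, mul_add]
    have h4 := fun j => (hA i j).trans (le_abs_self b)
    exact add_le_add (mul_le_mul (h4 0) (hτ' 0) (abs_nonneg _) (abs_nonneg _))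
      (mul_le_mul (h4 1) (hτ' 1) (abs_nonneg _) (abs_nonneg _))
  unfold rho
  gcongr
  exacts [h3 0, h3 1]

lemma ennreal_add_sq_le (a b : ℝ≥0∞) : (a + b) ^ 2 ≤ 2 * (a ^ 2 + b ^ 2) := by
  have := ENNReal.rpow_add_le_mul_rpow_add_rpow a b (p := 2) (by norm_num)
  norm_num at this
  exact this

lemma measurable_mulVec_sub (A : Matrix (Fin 2) (Fin 2) ℝ) :
    Measurable fun p : (Fin 2 → ℝ) × (Fin 2 → ℝ) => A *ᵥ p.2 - p.1 :=
  ((continuous_const.matrix_mulVec continuous_snd).sub continuous_fst).measurable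

/-- Conditions on `q₁, q₂` under which `1 / ρ` is square integrable at infinity and its averages along
either coordinate direction are locally square integrable. -/
structure IsAdmissible (q₁ q₂ : ℝ) : Prop where
  pos : ∀ i, 0 < ![q₁, q₂] i
  lt_two : bigQ q₁ q₂ < 2
  one_lt : ∀ i j, i ≠ j → 1 < 1 / (2 * ![q₁, q₂] i) + 1 / ![q₁, q₂] j

lemma IsAdmissible.pos₁ {q₁ q₂ : ℝ} (h : IsAdmissible q₁ q₂) : 0 < q₁ := h.pos 0

lemma IsAdmissible.pos₂ {q₁ q₂ : ℝ} (h : IsAdmissible q₁ q₂) : 0 < q₂ := h.pos 1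

lemma oneAddRhoInv_ne_top (q₁ q₂ : ℝ) (u : Fin 2 → ℝ) : oneAddRhoInv q₁ q₂ u ≠ ∞ := by
  rw [oneAddRhoInv, ENNReal.inv_ne_top]
  exact (ENNReal.ofReal_pos.2 (by linarith [rho_nonneg q₁ q₂ u])).ne'

lemma measurable_rhoInvTrunc_sub (q₁ q₂ δ : ℝ) (A : Matrix (Fin 2) (Fin 2) ℝ) (u : Fin 2 → ℝ) :
    Measurable fun τ : Fin 2 → ℝ => rhoInvTrunc q₁ q₂ δ (A *ᵥ τ - u) :=
  (measurable_rhoInvTrunc q₁ q₂ δ).comp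
    ((measurable_mulVec_sub A).comp (measurable_const.prodMk measurable_id))

lemma measurable_lintegral_rhoInvTrunc (q₁ q₂ δ : ℝ) (A : Matrix (Fin 2) (Fin 2) ℝ)
    (x : Fin 2 → ℝ) :
    Measurable fun u => ∫⁻ τ in rect x, rhoInvTrunc q₁ q₂ δ (A *ᵥ τ - u) :=
  ((measurable_rhoInvTrunc q₁ q₂ δ).comp (measurable_mulVec_sub A)).lintegral_prod_right'

/-- If at least one of `a`, `b` is close to the singularity, then bounds by `1 / ρ` at `a` and `b`
can be replaced by bounds by the truncated function, because the larger of `1 / ρ(a)` and `1 / ρ(b)`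
is not truncated. -/
lemma enorm_sub_le_rhoInvTrunc {q₁ q₂ δ : ℝ} {C : ℝ≥0∞} {a b : Fin 2 → ℝ} {y z : ℝ}
    (hy : ‖y‖ₑ ≤ C * rhoInv q₁ q₂ a) (hz : ‖z‖ₑ ≤ C * rhoInv q₁ q₂ b)
    (hab : ¬ (δ < rho q₁ q₂ a ∧ δ < rho q₁ q₂ b)) :
    ‖y - z‖ₑ ≤ 2 * C * (rhoInvTrunc q₁ q₂ δ a + rhoInvTrunc q₁ q₂ δ b) := by
  have hanti : ∀ {v w : Fin 2 → ℝ}, rho q₁ q₂ v ≤ rho q₁ q₂ w →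
      rhoInv q₁ q₂ w ≤ rhoInv q₁ q₂ v := fun h =>
    ENNReal.inv_le_inv.2 (ENNReal.ofReal_le_ofReal h)
  calc ‖y - z‖ₑ ≤ ‖y‖ₑ + ‖z‖ₑ := enorm_sub_le
    _ ≤ C * rhoInv q₁ q₂ a + C * rhoInv q₁ q₂ b := add_le_add hy hz
    _ = C * (rhoInv q₁ q₂ a + rhoInv q₁ q₂ b) := by ring
    _ ≤ C * (2 * (rhoInvTrunc q₁ q₂ δ a + rhoInvTrunc q₁ q₂ δ b)) := by
      gcongr
      rcases lt_or_ge δ (rho q₁ q₂ a) with c1 | c1 <;>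
        rcases lt_or_ge δ (rho q₁ q₂ b) with c2 | c2
      · exact absurd ⟨c1, c2⟩ hab
      · rw [rhoInvTrunc_of_lt c1, rhoInvTrunc_of_le c2, zero_add, two_mul]
        gcongr
        exact hanti (c2.trans c1.le)
      · rw [rhoInvTrunc_of_le c1, rhoInvTrunc_of_lt c2, add_zero, two_mul]
        gcongr
        exact hanti (c1.trans c2.le)
      · rw [rhoInvTrunc_of_le c1, rhoInvTrunc_of_le c2, two_mul]
        exact le_self_add
    _ = _ := by ring

lemma lintegral_sq_add_le {α : Type*} [MeasurableSpace α] {μ : Measure α} {F G H : α → ℝ≥0∞}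
    (hF : Measurable F) (hG : Measurable G) (hH : Measurable H) (C : ℝ≥0∞) :
    ∫⁻ a, (2 * C * (F a + G a) + H a) ^ 2 ∂μ ≤
      16 * C ^ 2 * ((∫⁻ a, F a ^ 2 ∂μ) + ∫⁻ a, G a ^ 2 ∂μ) + 2 * ∫⁻ a, H a ^ 2 ∂μ := by
  calc ∫⁻ a, (2 * C * (F a + G a) + H a) ^ 2 ∂μ
      ≤ ∫⁻ a, (16 * C ^ 2 * (F a ^ 2 + G a ^ 2) + 2 * H a ^ 2) ∂μ := by
        refine lintegral_mono fun a => ?_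
        calc (2 * C * (F a + G a) + H a) ^ 2
            ≤ 2 * ((2 * C * (F a + G a)) ^ 2 + H a ^ 2) := ennreal_add_sq_le _ _
          _ = 8 * C ^ 2 * (F a + G a) ^ 2 + 2 * H a ^ 2 := by ring
          _ ≤ 8 * C ^ 2 * (2 * (F a ^ 2 + G a ^ 2)) + 2 * H a ^ 2 := by
              gcongr; exact ennreal_add_sq_le _ _
          _ = _ := by ring
    _ = _ := by
        rw [lintegral_add_right _ ((hH.pow_const 2).const_mul 2),
          lintegral_const_mul _ (by fun_prop : Measurable fun a => F a ^ 2 + G a ^ 2),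
          lintegral_add_left (hF.pow_const 2), lintegral_const_mul _ (hH.pow_const 2)]

/-- Dominated convergence for the integrals over `τ` and over `u`, with a dominating function that does
not depend on `τ`. -/
lemma tendsto_lintegral_sq_of_dominated {q₁ q₂ : ℝ} (hq : IsAdmissible q₁ q₂) {ι : Type*}
    {l : Filter ι} [l.IsCountablyGenerated] (x : Fin 2 → ℝ)
    {F : ι → (Fin 2 → ℝ) → (Fin 2 → ℝ) → ℝ≥0∞} (hF : ∀ r, Measurable (Function.uncurry (F r)))
    {K : ℝ≥0∞} (hK : K ≠ ∞)
    (hb : ∀ᶠ r in l, ∀ u, ∀ τ ∈ rect x, F r u τ ≤ K * oneAddRhoInv q₁ q₂ u)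
    (hlim : ∀ᵐ u, ∀ᵐ τ ∂(volume.restrict (rect x)), Tendsto (fun r => F r u τ) l (𝓝 0)) :
    Tendsto (fun r => ∫⁻ u, (∫⁻ τ in rect x, F r u τ) ^ 2) l (𝓝 0) := by
  have hv := (volume_rect_lt_top x).ne
  have hF' : ∀ r, Measurable fun u => ∫⁻ τ in rect x, F r u τ := fun r =>
    (hF r).lintegral_prod_right'
  rw [← lintegral_zero (α := Fin 2 → ℝ) (μ := volume)]
  refine tendsto_lintegral_filter_of_dominated_convergence
    (fun u => (K * oneAddRhoInv q₁ q₂ u * volume (rect x)) ^ 2)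
    (Eventually.of_forall fun r => (hF' r).pow_const 2) ?_ ?_ ?_
  · filter_upwards [hb] with r hr
    refine Eventually.of_forall fun u => ?_
    gcongr
    exact (setLIntegral_mono' (measurableSet_rect x) (hr u)).trans_eq (setLIntegral_const _ _)
  · have h3 : ∀ u, (K * oneAddRhoInv q₁ q₂ u * volume (rect x)) ^ 2
        = (K * volume (rect x)) ^ 2 * oneAddRhoInv q₁ q₂ u ^ 2 := fun u => by ring
    simp_rw [h3]
    rw [lintegral_const_mul _ ((measurable_oneAddRhoInv q₁ q₂).pow_const 2)]
    exact ENNReal.mul_ne_top (ENNReal.pow_ne_top (ENNReal.mul_ne_top hK hv))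
      (lintegral_oneAddRhoInv_sq_lt_top hq.pos₁ hq.pos₂ hq.lt_two).ne
  · filter_upwards [hlim] with u hu
    suffices h3 : Tendsto (fun r => ∫⁻ τ in rect x, F r u τ) l (𝓝 0) by
      simpa using ENNReal.Tendsto.pow (n := 2) h3
    rw [← lintegral_zero (α := Fin 2 → ℝ) (μ := volume.restrict (rect x))]
    refine tendsto_lintegral_filter_of_dominated_convergence
      (fun _ => K * oneAddRhoInv q₁ q₂ u)
      (Eventually.of_forall fun r => (hF r).comp (measurable_const.prodMk measurable_id)) ?_ ?_ hu
    · filter_upwards [hb] with r hr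
      exact ae_restrict_of_forall_mem (measurableSet_rect x) (hr u)
    · rw [setLIntegral_const]
      exact ENNReal.mul_ne_top (ENNReal.mul_ne_top hK (oneAddRhoInv_ne_top q₁ q₂ u)) hv

/-- If kernels `f r` with singularities at `u = A r τ`, no worse than that of `1 / ρ`, converge almost
everywhere, then their integrals over `τ ∈ (0, x]` converge in `L²`. -/
lemma tendsto_lintegral_sq_average {q₁ q₂ : ℝ} (hq : IsAdmissible q₁ q₂) {ι : Type*} {l : Filter ι}
    [l.IsCountablyGenerated] {A : ι → Matrix (Fin 2) (Fin 2) ℝ} {D : Matrix (Fin 2) (Fin 2) ℝ}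
    (hA : Tendsto A l (𝓝 D)) {j k : Fin 2} (hD : D j k ≠ 0) (x : Fin 2 → ℝ)
    {f : ι → (Fin 2 → ℝ) → (Fin 2 → ℝ) → ℝ} {g : (Fin 2 → ℝ) → (Fin 2 → ℝ) → ℝ}
    (hf : ∀ r, Measurable (Function.uncurry (f r))) (hg : Measurable (Function.uncurry g))
    {C : ℝ≥0∞} (hC : C ≠ ∞)
    (hfb : ∀ᶠ r in l, ∀ u, ∀ τ ∈ rect x, ‖f r u τ‖ₑ ≤ C * rhoInv q₁ q₂ (A r *ᵥ τ - u))
    (hgb : ∀ u, ∀ τ ∈ rect x, ‖g u τ‖ₑ ≤ C * rhoInv q₁ q₂ (D *ᵥ τ - u))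
    (hlim : ∀ᵐ u, ∀ᵐ τ ∂(volume.restrict (rect x)), Tendsto (fun r => f r u τ) l (𝓝 (g u τ))) :
    Tendsto (fun r => ∫⁻ u, (∫⁻ τ in rect x, ‖f r u τ - g u τ‖ₑ) ^ 2) l (𝓝 0) := by
  have hentry : ∀ i j, Tendsto (fun r => A r i j) l (𝓝 (D i j)) := fun i j =>
    tendsto_pi_nhds.1 (tendsto_pi_nhds.1 hA i) j
  obtain ⟨b, hb⟩ : ∃ b, ∀ i j, |D i j| < b :=
    ⟨∑ i, ∑ j, |D i j| + 1, fun i j => (abs_entry_le_sum D i j).trans_lt (lt_add_one _)⟩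
  have hAb : ∀ᶠ r in l, ∀ i j, |A r i j| ≤ b := by
    refine eventually_all.2 fun i => eventually_all.2 fun j => ?_
    exact ((hentry i j).abs.eventually (gt_mem_nhds (hb i j))).mono fun _ h => h.le
  have hc : 0 < |D j k| / 2 := by positivity
  have hAc : ∀ᶠ r in l, |D j k| / 2 ≤ |A r j k| :=
    ((hentry j k).abs.eventually (lt_mem_nhds (half_lt_self (abs_pos.2 hD)))).mono fun _ h => h.le
  obtain ⟨M, hM0, hM⟩ := exists_rho_mulVec_le hq.pos₁ hq.pos₂ x (b := b)
  rw [ENNReal.tendsto_nhds_zero]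
  intro ε hε
  -- `ε` is distributed over the parts near and away from the singularities
  have hε2 : ε / 2 ≠ 0 := (ENNReal.half_pos hε.ne').ne'
  obtain ⟨s₁, hs₁, hs₁'⟩ := ENNReal.exists_nnreal_pos_mul_lt
    (ENNReal.mul_ne_top (by simp : (32 : ℝ≥0∞) ≠ ∞) (ENNReal.pow_ne_top (n := 2) hC)) hε2
  obtain ⟨s₂, hs₂, hs₂'⟩ := ENNReal.exists_nnreal_pos_mul_lt (by simp : (2 : ℝ≥0∞) ≠ ∞) hε2
  obtain ⟨δ, hδ, hsmall⟩ := exists_lintegral_trunc_le hq.pos hq.one_lt j k hc x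
    (ENNReal.coe_pos.2 hs₁)
  obtain ⟨K, hK, hKle⟩ := exists_rhoInv_le hq.pos₁ hq.pos₂ hδ hM0
  -- the part away from the singularities
  let T : ι → Set ((Fin 2 → ℝ) × (Fin 2 → ℝ)) := fun r =>
    {p | δ < rho q₁ q₂ (A r *ᵥ p.2 - p.1) ∧ δ < rho q₁ q₂ (D *ᵥ p.2 - p.1)}
  have hT : ∀ r, MeasurableSet (T r) := fun r =>
    (measurableSet_lt measurable_const ((measurable_rho q₁ q₂).comp (measurable_mulVec_sub _))).inter
      (measurableSet_lt measurable_const ((measurable_rho q₁ q₂).comp (measurable_mulVec_sub _)))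
  let far : ι → (Fin 2 → ℝ) → (Fin 2 → ℝ) → ℝ≥0∞ := fun r u τ =>
    (T r).indicator (fun p => ‖f r p.1 p.2 - g p.1 p.2‖ₑ) (u, τ)
  have hfar : ∀ r, Measurable (Function.uncurry (far r)) := fun r =>
    (((hf r).sub hg).enorm).indicator (hT r)
  have hfar' : ∀ r, Measurable fun u => ∫⁻ τ in rect x, far r u τ := fun r =>
    (hfar r).lintegral_prod_right'
  have hfarb : ∀ᶠ r in l, ∀ u, ∀ τ ∈ rect x,
      far r u τ ≤ 2 * C * K * oneAddRhoInv q₁ q₂ u := by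
    filter_upwards [hfb, hAb] with r h1 h2 u τ hτ
    by_cases hp : (u, τ) ∈ T r
    · simp only [far, Set.indicator_of_mem hp]
      calc ‖f r u τ - g u τ‖ₑ ≤ ‖f r u τ‖ₑ + ‖g u τ‖ₑ := enorm_sub_le
        _ ≤ C * (K * oneAddRhoInv q₁ q₂ u) + C * (K * oneAddRhoInv q₁ q₂ u) := by
          refine add_le_add ((h1 u τ hτ).trans ?_) ((hgb u τ hτ).trans ?_)
          · gcongr
            exact hKle _ _ (hM _ h2 τ hτ) hp.1
          · gcongr
            exact hKle _ _ (hM _ (fun i j => (hb i j).le) τ hτ) hp.2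
        _ = _ := by ring
    · simp only [far, Set.indicator_of_notMem hp]
      exact zero_le
  have hfarlim : Tendsto (fun r => ∫⁻ u, (∫⁻ τ in rect x, far r u τ) ^ 2) l (𝓝 0) := by
    refine tendsto_lintegral_sq_of_dominated hq x hfar
      (ENNReal.mul_ne_top (ENNReal.mul_ne_top ENNReal.ofNat_ne_top hC) hK) hfarb ?_
    filter_upwards [hlim] with u hu
    filter_upwards [hu] with τ hτ
    have h4 : Tendsto (fun r => ‖f r u τ - g u τ‖ₑ) l (𝓝 0) := by
      simpa using (hτ.sub_const (g u τ)).enorm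
    exact tendsto_of_tendsto_of_tendsto_of_le_of_le tendsto_const_nhds h4 (fun _ => zero_le)
      fun r => Set.indicator_le_self _ (fun p => ‖f r p.1 p.2 - g p.1 p.2‖ₑ) (u, τ)
  filter_upwards [hfb, hAc, ENNReal.tendsto_nhds_zero.1 hfarlim s₂ (by exact_mod_cast hs₂)]
    with r h1 h2 h3
  have hpt : ∀ u, ∫⁻ τ in rect x, ‖f r u τ - g u τ‖ₑ ≤
      2 * C * ((∫⁻ τ in rect x, rhoInvTrunc q₁ q₂ δ (A r *ᵥ τ - u)) +
        ∫⁻ τ in rect x, rhoInvTrunc q₁ q₂ δ (D *ᵥ τ - u)) + ∫⁻ τ in rect x, far r u τ := by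
    intro u
    have hm := fun A => measurable_rhoInvTrunc_sub q₁ q₂ δ A u
    have hm2 : Measurable fun τ => rhoInvTrunc q₁ q₂ δ (A r *ᵥ τ - u) +
      rhoInvTrunc q₁ q₂ δ (D *ᵥ τ - u) := (hm (A r)).add (hm D)
    rw [← lintegral_add_left (hm (A r)), ← lintegral_const_mul _ hm2,
      ← lintegral_add_left (hm2.const_mul _)]
    refine setLIntegral_mono' (measurableSet_rect x) fun τ hτ => ?_
    by_cases hp : (u, τ) ∈ T r
    · refine le_trans (le_of_eq ?_) le_add_self
      simp only [far, Set.indicator_of_mem hp]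
    · exact (enorm_sub_le_rhoInvTrunc (h1 u τ hτ) (hgb u τ hτ) hp).trans le_self_add
  calc ∫⁻ u, (∫⁻ τ in rect x, ‖f r u τ - g u τ‖ₑ) ^ 2
      ≤ ∫⁻ u, (2 * C * ((∫⁻ τ in rect x, rhoInvTrunc q₁ q₂ δ (A r *ᵥ τ - u)) +
        ∫⁻ τ in rect x, rhoInvTrunc q₁ q₂ δ (D *ᵥ τ - u)) + ∫⁻ τ in rect x, far r u τ) ^ 2 :=
        lintegral_mono fun u => pow_le_pow_left' (hpt u) 2
    _ ≤ _ := lintegral_sq_add_le (measurable_lintegral_rhoInvTrunc q₁ q₂ δ (A r) x)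
        (measurable_lintegral_rhoInvTrunc q₁ q₂ δ D x) (hfar' r) C
    _ ≤ 16 * C ^ 2 * (s₁ + s₁) + 2 * s₂ :=
        add_le_add (mul_le_mul_right (add_le_add (hsmall _ h2)
          (hsmall D (half_le_self (abs_nonneg _)))) _) (mul_le_mul_right h3 _)
    _ = s₁ * (32 * C ^ 2) + s₂ * 2 := by ring
    _ ≤ ε / 2 + ε / 2 := add_le_add hs₁'.le hs₂'.le
    _ = ε := ENNReal.add_halves ε

/-- The averages of `1 / ρ` are in `L²`. -/
lemma lintegral_sq_average_rhoInv_lt_top {q₁ q₂ : ℝ} (hq : IsAdmissible q₁ q₂)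
    {D : Matrix (Fin 2) (Fin 2) ℝ} {j k : Fin 2} (hD : D j k ≠ 0) (x : Fin 2 → ℝ) :
    ∫⁻ u, (∫⁻ τ in rect x, rhoInv q₁ q₂ (D *ᵥ τ - u)) ^ 2 < ∞ := by
  obtain ⟨δ, hδ, hsmall⟩ := exists_lintegral_trunc_le hq.pos hq.one_lt j k (abs_pos.2 hD) x one_pos
  obtain ⟨M, hM0, hM⟩ := exists_rho_mulVec_le hq.pos₁ hq.pos₂ x (b := ∑ i, ∑ j, |D i j|)
  obtain ⟨K, hK, hKle⟩ := exists_rhoInv_le hq.pos₁ hq.pos₂ hδ hM0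
  have hDb := abs_entry_le_sum D
  calc ∫⁻ u, (∫⁻ τ in rect x, rhoInv q₁ q₂ (D *ᵥ τ - u)) ^ 2
      ≤ ∫⁻ u, (2 * ((∫⁻ τ in rect x, rhoInvTrunc q₁ q₂ δ (D *ᵥ τ - u)) ^ 2 +
          (K * oneAddRhoInv q₁ q₂ u * volume (rect x)) ^ 2)) := by
        refine lintegral_mono fun u => le_trans ?_ (ennreal_add_sq_le _ _)
        gcongr
        rw [← setLIntegral_const, ← lintegral_add_left (measurable_rhoInvTrunc_sub q₁ q₂ δ D u)]
        refine setLIntegral_mono' (measurableSet_rect x) fun τ hτ => ?_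
        rcases lt_or_ge δ (rho q₁ q₂ (D *ᵥ τ - u)) with c1 | c1
        · exact (hKle _ _ (hM D hDb τ hτ) c1).trans le_add_self
        · rw [rhoInvTrunc_of_le c1]
          exact le_self_add
    _ = 2 * ((∫⁻ u, (∫⁻ τ in rect x, rhoInvTrunc q₁ q₂ δ (D *ᵥ τ - u)) ^ 2) +
          (K * volume (rect x)) ^ 2 * ∫⁻ u, oneAddRhoInv q₁ q₂ u ^ 2) := by
        have hm' : Measurable fun u => (∫⁻ τ in rect x, rhoInvTrunc q₁ q₂ δ (D *ᵥ τ - u)) ^ 2 :=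
          (measurable_lintegral_rhoInvTrunc q₁ q₂ δ D x).pow_const 2
        rw [← lintegral_const_mul _ ((measurable_oneAddRhoInv q₁ q₂).pow_const 2),
          ← lintegral_add_left hm', ← lintegral_const_mul' _ _ ENNReal.ofNat_ne_top]
        refine lintegral_congr fun u => ?_
        ring
    _ < ∞ := by
        have h3 := ((hsmall D le_rfl).trans_lt ENNReal.one_lt_top).ne
        have h4 := (volume_rect_lt_top x).ne
        have h5 := (lintegral_oneAddRhoInv_sq_lt_top hq.pos₁ hq.pos₂ hq.lt_two).ne
        finiteness

/-! ### The limiting coefficients -/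

lemma angular_arg_mem {q₁ q₂ : ℝ} (h₁ : 0 < q₁) (u : Fin 2 → ℝ) :
    u 0 / rho q₁ q₂ u ^ (1 / q₁) ∈ Set.Icc (-1 : ℝ) 1 := by
  rw [Set.mem_Icc, ← abs_le, abs_div, abs_of_nonneg (Real.rpow_nonneg (rho_nonneg q₁ q₂ u) _)]
  refine div_le_one_of_le₀ ?_ (Real.rpow_nonneg (rho_nonneg q₁ q₂ u) _)
  have h : |u 0| ^ q₁ ≤ rho q₁ q₂ u := by
    unfold rho
    linarith [Real.rpow_nonneg (abs_nonneg (u 1)) q₂]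
  calc |u 0| = (|u 0| ^ q₁) ^ (1 / q₁) := by
        rw [← Real.rpow_mul (abs_nonneg _), mul_one_div_cancel h₁.ne', Real.rpow_one]
    _ ≤ _ := by gcongr

/-- The constant extension of a function on `[-1, 1]` to the real line. -/
def clampExtend (L : ℝ → ℝ) (z : ℝ) : ℝ := L (max (-1) (min 1 z))

lemma continuous_clampExtend {L : ℝ → ℝ} (hL : ContinuousOn L (Set.Icc (-1) 1)) :
    Continuous (clampExtend L) :=
  hL.comp_continuous (by fun_prop) fun z =>
    ⟨le_max_left _ _, max_le (by norm_num) (min_le_left _ _)⟩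

lemma clampExtend_of_mem (L : ℝ → ℝ) {z : ℝ} (hz : z ∈ Set.Icc (-1 : ℝ) 1) :
    clampExtend L z = L z := by
  rw [clampExtend, min_eq_right hz.2, max_eq_right hz.1]

section Coefficients

variable {q₁ q₂ : ℝ} {Lplus Lminus : ℝ → ℝ}

lemma angular_eq_clampExtend (h₁ : 0 < q₁) (u : Fin 2 → ℝ) :
    angular q₁ q₂ Lplus Lminus u =
      angular q₁ q₂ (clampExtend Lplus) (clampExtend Lminus) u := by
  simp only [angular, clampExtend_of_mem _ (angular_arg_mem h₁ u)]

lemma measurable_angular (h₁ : 0 < q₁) (hp : ContinuousOn Lplus (Set.Icc (-1) 1))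
    (hm : ContinuousOn Lminus (Set.Icc (-1) 1)) : Measurable (angular q₁ q₂ Lplus Lminus) := by
  rw [funext (angular_eq_clampExtend h₁)]
  have h2 : Measurable fun u : Fin 2 → ℝ => u 0 / rho q₁ q₂ u ^ (1 / q₁) :=
    (measurable_pi_apply 0).div ((measurable_rho q₁ q₂).pow_const _)
  exact Measurable.ite (measurableSet_le measurable_const (measurable_pi_apply 1))
    ((continuous_clampExtend hp).measurable.comp h2)
    ((continuous_clampExtend hm).measurable.comp h2)

lemma measurable_aInfty (h₁ : 0 < q₁) (hp : ContinuousOn Lplus (Set.Icc (-1) 1))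
    (hm : ContinuousOn Lminus (Set.Icc (-1) 1)) : Measurable (aInfty q₁ q₂ Lplus Lminus) :=
  (measurable_rho q₁ q₂).inv.mul (measurable_angular h₁ hp hm)

lemma exists_abs_angular_le (h₁ : 0 < q₁) (hp : ContinuousOn Lplus (Set.Icc (-1) 1))
    (hm : ContinuousOn Lminus (Set.Icc (-1) 1)) :
    ∃ C : ℝ, 0 ≤ C ∧ ∀ u, |angular q₁ q₂ Lplus Lminus u| ≤ C := by
  obtain ⟨C₁, hC₁⟩ := isCompact_Icc.exists_bound_of_continuousOn hp
  obtain ⟨C₂, hC₂⟩ := isCompact_Icc.exists_bound_of_continuousOn hm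
  refine ⟨max C₁ C₂, ?_, fun u => ?_⟩
  · exact (norm_nonneg _).trans ((hC₁ 0 (by simp)).trans (le_max_left _ _))
  · unfold angular
    split_ifs
    · exact (hC₁ _ (angular_arg_mem h₁ u)).trans (le_max_left _ _)
    · exact (hC₂ _ (angular_arg_mem h₁ u)).trans (le_max_right _ _)

lemma exists_enorm_aInfty_le (h₁ : 0 < q₁) (hp : ContinuousOn Lplus (Set.Icc (-1) 1))
    (hm : ContinuousOn Lminus (Set.Icc (-1) 1)) :
    ∃ C : ℝ≥0∞, C ≠ ∞ ∧ ∀ u, ‖aInfty q₁ q₂ Lplus Lminus u‖ₑ ≤ C * rhoInv q₁ q₂ u := by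
  obtain ⟨C, hC, hb⟩ := exists_abs_angular_le (q₂ := q₂) h₁ hp hm
  refine ⟨ENNReal.ofReal C, ENNReal.ofReal_ne_top, fun u => ?_⟩
  rw [aInfty, enorm_mul, mul_comm]
  refine mul_le_mul' ?_ ?_
  · rw [Real.enorm_eq_ofReal_abs]
    exact ENNReal.ofReal_le_ofReal (hb u)
  · rw [Real.enorm_of_nonneg (inv_nonneg.2 (rho_nonneg q₁ q₂ u)), rhoInv]
    exact ENNReal.ofReal_inv_le

/-- Continuity off the first coordinate axis is all that is needed, this axis being a null set. -/
lemma continuousAt_angular (h₁ : 0 < q₁) (h₂ : 0 < q₂) (hp : ContinuousOn Lplus (Set.Icc (-1) 1))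
    (hm : ContinuousOn Lminus (Set.Icc (-1) 1)) {w : Fin 2 → ℝ} (hw : w 1 ≠ 0) :
    ContinuousAt (angular q₁ q₂ Lplus Lminus) w := by
  rw [funext (angular_eq_clampExtend h₁)]
  have hρ : rho q₁ q₂ w ≠ 0 := (rho_pos q₁ q₂ fun h => hw (by simp [h])).ne'
  have h2 : ContinuousAt (fun u : Fin 2 → ℝ => u 0 / rho q₁ q₂ u ^ (1 / q₁)) w :=
    (continuous_apply 0).continuousAt.div
      ((continuous_rho h₁ h₂).continuousAt.rpow_const (Or.inl hρ))
      (Real.rpow_pos_of_pos ((rho_nonneg q₁ q₂ w).lt_of_ne' hρ) _).ne'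
  have h3 : ContinuousAt (fun u : Fin 2 → ℝ => u 1) w := (continuous_apply 1).continuousAt
  rcases hw.lt_or_gt with h | h
  · refine ((continuous_clampExtend hm).continuousAt.comp h2).congr ?_
    filter_upwards [h3.eventually (gt_mem_nhds h)] with u hu
    rw [angular, if_neg (not_le.2 hu)]
    rfl
  · refine ((continuous_clampExtend hp).continuousAt.comp h2).congr ?_
    filter_upwards [h3.eventually (lt_mem_nhds h)] with u hu
    rw [angular, if_pos hu.le]
    rfl

lemma continuousAt_aInfty (h₁ : 0 < q₁) (h₂ : 0 < q₂) (hp : ContinuousOn Lplus (Set.Icc (-1) 1))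
    (hm : ContinuousOn Lminus (Set.Icc (-1) 1)) {w : Fin 2 → ℝ} (hw : w 1 ≠ 0) :
    ContinuousAt (aInfty q₁ q₂ Lplus Lminus) w :=
  ((continuous_rho h₁ h₂).continuousAt.inv₀ (rho_pos q₁ q₂ fun h => hw (by simp [h])).ne').mul
    (continuousAt_angular h₁ h₂ hp hm hw)

/-- The matrix `diag(ν^{1/q₁}, ν^{1/q₂})`, with respect to which `ρ` is homogeneous. -/
def dilation (q₁ q₂ ν : ℝ) : Matrix (Fin 2) (Fin 2) ℝ :=
  Matrix.diagonal fun i => ν ^ (1 / ![q₁, q₂] i)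

lemma dilation_mulVec_apply (q₁ q₂ ν : ℝ) (w : Fin 2 → ℝ) (i : Fin 2) :
    (dilation q₁ q₂ ν *ᵥ w) i = ν ^ (1 / ![q₁, q₂] i) * w i := by
  rw [dilation, Matrix.mulVec_diagonal]

lemma det_dilation {ν : ℝ} (hν : 0 < ν) : (dilation q₁ q₂ ν).det = ν ^ bigQ q₁ q₂ := by
  rw [dilation, Matrix.det_diagonal, Fin.prod_univ_two, bigQ, Real.rpow_add hν]
  rfl

lemma rho_dilation (h₁ : 0 < q₁) (h₂ : 0 < q₂) {ν : ℝ} (hν : 0 < ν) (w : Fin 2 → ℝ) :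
    rho q₁ q₂ (dilation q₁ q₂ ν *ᵥ w) = ν * rho q₁ q₂ w := by
  have h : ∀ {q : ℝ} (_ : 0 < q) (y : ℝ), |ν ^ (1 / q) * y| ^ q = ν * |y| ^ q := by
    intro q hq y
    rw [abs_mul, abs_of_pos (Real.rpow_pos_of_pos hν _), Real.mul_rpow (by positivity) (by positivity),
      ← Real.rpow_mul hν.le, one_div_mul_cancel hq.ne', Real.rpow_one]
  rw [rho, dilation_mulVec_apply, dilation_mulVec_apply]
  change |ν ^ (1 / q₁) * w 0| ^ q₁ + |ν ^ (1 / q₂) * w 1| ^ q₂ = _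
  rw [h h₁, h h₂, rho]
  ring

lemma angular_dilation (h₁ : 0 < q₁) (h₂ : 0 < q₂) {ν : ℝ} (hν : 0 < ν) (w : Fin 2 → ℝ) :
    angular q₁ q₂ Lplus Lminus (dilation q₁ q₂ ν *ᵥ w) = angular q₁ q₂ Lplus Lminus w := by
  have h3 : (dilation q₁ q₂ ν *ᵥ w) 0 / rho q₁ q₂ (dilation q₁ q₂ ν *ᵥ w) ^ (1 / q₁)
      = w 0 / rho q₁ q₂ w ^ (1 / q₁) := by
    rw [rho_dilation h₁ h₂ hν, dilation_mulVec_apply, Real.mul_rpow hν.le (rho_nonneg _ _ _)]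
    exact mul_div_mul_left _ _ (Real.rpow_pos_of_pos hν _).ne'
  have h4 : (0 ≤ (dilation q₁ q₂ ν *ᵥ w) 1) ↔ 0 ≤ w 1 := by
    rw [dilation_mulVec_apply]
    exact mul_nonneg_iff_of_pos_left (Real.rpow_pos_of_pos hν _)
  simp only [angular, h3, h4]

lemma aInfty_dilation (h₁ : 0 < q₁) (h₂ : 0 < q₂) {ν : ℝ} (hν : 0 < ν) (w : Fin 2 → ℝ) :
    aInfty q₁ q₂ Lplus Lminus (dilation q₁ q₂ ν *ᵥ w) = ν⁻¹ * aInfty q₁ q₂ Lplus Lminus w := by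
  rw [aInfty, aInfty, rho_dilation h₁ h₂ hν, angular_dilation h₁ h₂ hν, mul_inv, mul_assoc]

/-- If `L₊` or `L₋` does not vanish on `[-1, 1]`, then `a_∞` does not vanish somewhere off the first
coordinate axis. -/
lemma exists_aInfty_ne_zero (h₁ : 0 < q₁) (h₂ : 0 < q₂) (hp : ContinuousOn Lplus (Set.Icc (-1) 1))
    (hm : ContinuousOn Lminus (Set.Icc (-1) 1))
    (h : ∃ z ∈ Set.Icc (-1 : ℝ) 1, Lplus z ≠ 0 ∨ Lminus z ≠ 0) :
    ∃ w : Fin 2 → ℝ, w 1 ≠ 0 ∧ aInfty q₁ q₂ Lplus Lminus w ≠ 0 := by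
  have key : ∀ {L : ℝ → ℝ}, ContinuousOn L (Set.Icc (-1) 1) → (∃ z ∈ Set.Icc (-1 : ℝ) 1, L z ≠ 0) →
      ∃ z ∈ Set.Ioo (-1 : ℝ) 1, L z ≠ 0 := by
    intro L hL ⟨z, hz, hLz⟩
    by_contra! h0
    refine hLz (Set.EqOn.of_subset_closure (s := Set.Ioo (-1 : ℝ) 1) (g := fun _ => 0) h0 hL
      continuousOn_const Set.Ioo_subset_Icc_self ?_ hz)
    rw [closure_Ioo (by norm_num)]
  have hz1 : ∀ {z : ℝ}, z ∈ Set.Ioo (-1 : ℝ) 1 → 0 < 1 - |z| ^ q₁ := fun {z} hz =>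
    sub_pos.2 (Real.rpow_lt_one (abs_nonneg z) (abs_lt.2 hz) h₁)
  have hρ : ∀ {z s : ℝ}, z ∈ Set.Ioo (-1 : ℝ) 1 → |s| = (1 - |z| ^ q₁) ^ (1 / q₂) →
      rho q₁ q₂ ![z, s] = 1 := by
    intro z s hz hs
    change |z| ^ q₁ + |s| ^ q₂ = 1
    rw [hs, ← Real.rpow_mul (hz1 hz).le, one_div_mul_cancel h₂.ne', Real.rpow_one]
    ring
  have h' : (∃ z ∈ Set.Icc (-1 : ℝ) 1, Lplus z ≠ 0) ∨ ∃ z ∈ Set.Icc (-1 : ℝ) 1, Lminus z ≠ 0 := by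
    obtain ⟨z, hz, h | h⟩ := h
    exacts [Or.inl ⟨z, hz, h⟩, Or.inr ⟨z, hz, h⟩]
  rcases h' with h' | h'
  · obtain ⟨z, hz, hL⟩ := key hp h'
    have hs : 0 < (1 - |z| ^ q₁) ^ (1 / q₂) := Real.rpow_pos_of_pos (hz1 hz) _
    refine ⟨![z, (1 - |z| ^ q₁) ^ (1 / q₂)], hs.ne', ?_⟩
    rw [aInfty, angular, if_pos (show (0 : ℝ) ≤ ![z, _] 1 from hs.le), hρ hz (abs_of_pos hs)]
    simpa using hL
  · obtain ⟨z, hz, hL⟩ := key hm h'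
    have hs : 0 < (1 - |z| ^ q₁) ^ (1 / q₂) := Real.rpow_pos_of_pos (hz1 hz) _
    have hs' : -(1 - |z| ^ q₁) ^ (1 / q₂) < 0 := neg_lt_zero.2 hs
    refine ⟨![z, -(1 - |z| ^ q₁) ^ (1 / q₂)], hs'.ne, ?_⟩
    rw [aInfty, angular, if_neg (show ¬ (0 : ℝ) ≤ ![z, _] 1 from not_le.2 hs'),
      hρ hz (by rw [abs_neg, abs_of_pos hs])]
    simpa using hL

/-! ### The kernels of the limit fields -/

lemma memLp_two_of_lintegral_sq_lt_top {α : Type*} [MeasurableSpace α] {μ : Measure α} {f : α → ℝ}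
    (hf : AEStronglyMeasurable f μ) (h : ∫⁻ a, ‖f a‖ₑ ^ 2 ∂μ < ∞) : MemLp f 2 μ := by
  refine ⟨hf, ?_⟩
  rw [eLpNorm_lt_top_iff_lintegral_rpow_enorm_lt_top (by norm_num) (by norm_num)]
  simpa using h

lemma measurable_aInfty_mulVec_sub (h₁ : 0 < q₁) (hp : ContinuousOn Lplus (Set.Icc (-1) 1))
    (hm : ContinuousOn Lminus (Set.Icc (-1) 1)) (D : Matrix (Fin 2) (Fin 2) ℝ) :
    Measurable (Function.uncurry fun u τ => aInfty q₁ q₂ Lplus Lminus (D *ᵥ τ - u)) :=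
  (measurable_aInfty h₁ hp hm).comp (measurable_mulVec_sub D)

lemma ae_lintegral_rhoInv_lt_top (hq : IsAdmissible q₁ q₂) {D : Matrix (Fin 2) (Fin 2) ℝ}
    {j k : Fin 2} (hD : D j k ≠ 0) (x : Fin 2 → ℝ) :
    ∀ᵐ u, ∫⁻ τ in rect x, rhoInv q₁ q₂ (D *ᵥ τ - u) < ∞ := by
  have hm : Measurable fun u => ∫⁻ τ in rect x, rhoInv q₁ q₂ (D *ᵥ τ - u) :=
    ((measurable_rhoInv q₁ q₂).comp (measurable_mulVec_sub D)).lintegral_prod_right'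
  filter_upwards [ae_lt_top (hm.pow_const 2) (lintegral_sq_average_rhoInv_lt_top hq hD x).ne]
    with u hu
  by_contra! h
  rw [top_le_iff.1 h] at hu
  simp at hu

lemma wellDefined_of_ne_zero (hq : IsAdmissible q₁ q₂) (hp : ContinuousOn Lplus (Set.Icc (-1) 1))
    (hm : ContinuousOn Lminus (Set.Icc (-1) 1)) (B : Matrix (Fin 2) (Fin 2) ℝ)
    {D : Matrix (Fin 2) (Fin 2) ℝ} {j k : Fin 2} (hD : D j k ≠ 0) :
    WellDefined q₁ q₂ Lplus Lminus B D := by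
  intro x _
  obtain ⟨C, hC, hb⟩ := exists_enorm_aInfty_le (q₂ := q₂) hq.pos₁ hp hm
  have hmeas := measurable_aInfty_mulVec_sub (q₂ := q₂) hq.pos₁ hp hm D
  have hle : ∀ u, ∫⁻ τ in rect x, ‖aInfty q₁ q₂ Lplus Lminus (D *ᵥ τ - u)‖ₑ ≤
      C * ∫⁻ τ in rect x, rhoInv q₁ q₂ (D *ᵥ τ - u) := fun u => by
    rw [← lintegral_const_mul' _ _ hC]
    exact lintegral_mono fun τ => hb _
  refine ⟨?_, ?_⟩
  · filter_upwards [ae_lintegral_rhoInv_lt_top hq hD x] with u hu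
    exact ⟨(hmeas.comp (measurable_const.prodMk measurable_id)).aestronglyMeasurable,
      (hle u).trans_lt (ENNReal.mul_lt_top hC.lt_top hu)⟩
  · refine MemLp.const_mul (memLp_two_of_lintegral_sq_lt_top ?_ ?_) _
    · exact hmeas.stronglyMeasurable.integral_prod_right'.aestronglyMeasurable
    · calc ∫⁻ u, ‖∫ τ in rect x, aInfty q₁ q₂ Lplus Lminus (D *ᵥ τ - u)‖ₑ ^ 2
          ≤ ∫⁻ u, C ^ 2 * (∫⁻ τ in rect x, rhoInv q₁ q₂ (D *ᵥ τ - u)) ^ 2 := by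
            refine lintegral_mono fun u => ?_
            rw [← mul_pow]
            gcongr
            exact (enorm_integral_le_lintegral_enorm _).trans (hle u)
        _ < ∞ := by
            rw [lintegral_const_mul' _ _ (ENNReal.pow_ne_top hC)]
            exact ENNReal.mul_lt_top (ENNReal.pow_lt_top hC.lt_top)
              (lintegral_sq_average_rhoInv_lt_top hq hD x)

end Coefficients

lemma toL2_of_memLp {f : (Fin 2 → ℝ) → ℝ} (hf : MemLp f 2 volume) : toL2 f = hf.toLp f := by
  rw [toL2, dif_pos hf]

lemma inner_toL2 {f g : (Fin 2 → ℝ) → ℝ} (hf : MemLp f 2 volume) (hg : MemLp g 2 volume) :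
    inner ℝ (toL2 f) (toL2 g) = ∫ u, f u * g u := by
  rw [toL2_of_memLp hf, toL2_of_memLp hg, L2.inner_def]
  refine integral_congr_ae ?_
  filter_upwards [hf.coeFn_toLp, hg.coeFn_toLp] with u h1 h2
  simp [h1, h2, mul_comm]

/-! ### Limit fields that are fractional Brownian sheets -/

section Sheet

variable {q₁ q₂ : ℝ} {Lplus Lminus : ℝ → ℝ}

lemma map_eval_restrict_rect {k k' : Fin 2} (hk : k ≠ k') (x : Fin 2 → ℝ) :
    (volume.restrict (rect x)).map (Function.eval k) =
      ENNReal.ofReal (x k') • volume.restrict (Set.Ioc 0 (x k)) := by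
  rw [rect, volume_pi, Measure.restrict_pi_pi, Measure.pi_map_eval]
  have : Finset.univ.erase k = {k'} := by
    fin_cases k <;> fin_cases k' <;> first | exact absurd rfl hk | rfl
  rw [this, Finset.prod_singleton]
  simp

lemma integral_rect_comp_eval {k k' : Fin 2} (hk : k ≠ k') {x : Fin 2 → ℝ} (hx : 0 ≤ x k')
    {f : ℝ → ℝ} (hf : Measurable f) :
    ∫ τ in rect x, f (τ k) = x k' * ∫ s in Set.Ioc 0 (x k), f s := by
  have h := integral_map (μ := volume.restrict (rect x)) (φ := Function.eval k)
    (measurable_pi_apply k).aemeasurable hf.aestronglyMeasurable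
  rw [map_eval_restrict_rect hk, integral_smul_measure, ENNReal.toReal_ofReal hx, smul_eq_mul] at h
  exact h.symm

lemma integrableOn_rect_comp_eval {k k' : Fin 2} (hk : k ≠ k') {x : Fin 2 → ℝ} (hx : 0 < x k')
    {f : ℝ → ℝ} (hf : Measurable f) :
    IntegrableOn (fun τ : Fin 2 → ℝ => f (τ k)) (rect x) ↔ IntegrableOn f (Set.Ioc 0 (x k)) := by
  have h := integrable_map_measure (μ := volume.restrict (rect x)) (f := Function.eval k)
    hf.aestronglyMeasurable (measurable_pi_apply k).aemeasurable
  rw [map_eval_restrict_rect hk, integrable_smul_measure (ENNReal.ofReal_pos.2 hx).ne'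
    ENNReal.ofReal_ne_top] at h
  exact h.symm

/-- `∫₀ᵗ a_∞(p s e_j - u) ds`, the kernel of the limit field for `D = p e_j e_kᵀ`, up to a factor
that is linear in the coordinate of `x` other than `x_k`. -/
def lineKernel (q₁ q₂ : ℝ) (Lplus Lminus : ℝ → ℝ) (j : Fin 2) (p t : ℝ) (u : Fin 2 → ℝ) : ℝ :=
  ∫ s in (0 : ℝ)..t, aInfty q₁ q₂ Lplus Lminus (Pi.single j (p * s) - u)

lemma single_mulVec (j k : Fin 2) (p : ℝ) (τ : Fin 2 → ℝ) :
    Matrix.single j k p *ᵥ τ = Pi.single j (p * τ k) := by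
  rw [Matrix.single_mulVec]
  rfl

lemma measurable_aInfty_line (h₁ : 0 < q₁) (hp : ContinuousOn Lplus (Set.Icc (-1) 1))
    (hm : ContinuousOn Lminus (Set.Icc (-1) 1)) (j : Fin 2) (p : ℝ) (u : Fin 2 → ℝ) :
    Measurable fun s : ℝ => aInfty q₁ q₂ Lplus Lminus (Pi.single j (p * s) - u) := by
  refine (measurable_aInfty h₁ hp hm).comp (Continuous.measurable ?_)
  exact ((continuous_single (A := fun _ : Fin 2 => ℝ) j).comp (continuous_const.mul continuous_id)).sub
    continuous_const

lemma kernel_single (h₁ : 0 < q₁) (hp : ContinuousOn Lplus (Set.Icc (-1) 1))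
    (hm : ContinuousOn Lminus (Set.Icc (-1) 1)) (B : Matrix (Fin 2) (Fin 2) ℝ) {j k k' : Fin 2}
    (hk : k ≠ k') (p : ℝ) {x : Fin 2 → ℝ} (hx : ∀ i, 0 < x i) (u : Fin 2 → ℝ) :
    kernel q₁ q₂ Lplus Lminus B (Matrix.single j k p) x u =
      |B.det| ^ (-(1 / 2) : ℝ) * (x k' * lineKernel q₁ q₂ Lplus Lminus j p (x k) u) := by
  have h : Measurable fun s : ℝ => aInfty q₁ q₂ Lplus Lminus (Pi.single j (p * s) - u) :=
    measurable_aInfty_line h₁ hp hm j p u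
  simp only [kernel, single_mulVec, lineKernel]
  rw [intervalIntegral.integral_of_le (hx k).le, integral_rect_comp_eval hk (hx k').le h]

lemma ae_intervalIntegrable_line (hq : IsAdmissible q₁ q₂)
    (hp : ContinuousOn Lplus (Set.Icc (-1) 1)) (hm : ContinuousOn Lminus (Set.Icc (-1) 1))
    (j : Fin 2) {p : ℝ} (hp0 : p ≠ 0) {t : ℝ} (ht : 0 ≤ t) :
    ∀ᵐ u : Fin 2 → ℝ, ∀ a ∈ Set.Icc 0 t, ∀ b ∈ Set.Icc 0 t, IntervalIntegrable (fun s : ℝ =>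
      aInfty q₁ q₂ Lplus Lminus (Pi.single j (p * s) - u)) volume a b := by
  have hW := wellDefined_of_ne_zero (Lplus := Lplus) (Lminus := Lminus) hq hp hm 1
    (D := Matrix.single j 0 p) (j := j) (k := 0) (by simpa using hp0)
  have hx : ∀ i, 0 < (![t + 1, 1] : Fin 2 → ℝ) i := by
    rw [Fin.forall_fin_two]
    exact ⟨add_pos_of_nonneg_of_pos ht one_pos, one_pos⟩
  filter_upwards [(hW ![t + 1, 1] hx).1] with u hu a ha b hb
  have h : Measurable fun s : ℝ => aInfty q₁ q₂ Lplus Lminus (Pi.single j (p * s) - u) :=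
    measurable_aInfty_line hq.pos₁ hp hm j p u
  simp only [single_mulVec] at hu
  have h4 := (integrableOn_rect_comp_eval (k := 0) (k' := 1) (by decide) (hx 1) h).1 hu
  have h5 := (intervalIntegrable_iff_integrableOn_Ioc_of_le (hx 0).le).2 h4
  refine h5.mono_set ?_
  rw [Set.uIcc_of_le (hx 0).le]
  have h6 : t ≤ (![t + 1, 1] : Fin 2 → ℝ) 0 := (lt_add_one t).le
  exact Set.uIcc_subset_Icc ⟨ha.1, ha.2.trans h6⟩ ⟨hb.1, hb.2.trans h6⟩

lemma memLp_lineKernel (hq : IsAdmissible q₁ q₂)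
    (hp : ContinuousOn Lplus (Set.Icc (-1) 1)) (hm : ContinuousOn Lminus (Set.Icc (-1) 1))
    (j : Fin 2) {p : ℝ} (hp0 : p ≠ 0) {t : ℝ} (ht : 0 < t) :
    MemLp (lineKernel q₁ q₂ Lplus Lminus j p t) 2 volume := by
  have hx : ∀ i, 0 < (![t, 1] : Fin 2 → ℝ) i := fun i => by fin_cases i <;> simp [ht]
  have hW := (wellDefined_of_ne_zero (Lplus := Lplus) (Lminus := Lminus) hq hp hm 1
    (D := Matrix.single j 0 p) (j := j) (k := 0) (by simpa using hp0) ![t, 1] hx).2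
  rw [funext (kernel_single hq.pos₁ hp hm 1 (k := 0) (k' := 1) (by decide) p hx)] at hW
  simpa using hW

/-- The variance of the integral of `lineKernel` with respect to white noise. -/
def lineVariance (q₁ q₂ : ℝ) (Lplus Lminus : ℝ → ℝ) (j : Fin 2) (p t : ℝ) : ℝ :=
  ∫ u, lineKernel q₁ q₂ Lplus Lminus j p t u ^ 2

lemma integral_comp_mulVec {T : Matrix (Fin 2) (Fin 2) ℝ} (hT : T.det ≠ 0)
    {f : (Fin 2 → ℝ) → ℝ} (hf : AEStronglyMeasurable f volume) :
    ∫ u, f (T *ᵥ u) = |T.det|⁻¹ * ∫ v, f v := by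
  have h1 := Real.map_matrix_volume_pi_eq_smul_volume_pi hT
  have h2 : AEStronglyMeasurable f (Measure.map (Matrix.toLin' T) volume) := by
    rw [h1]
    exact hf.smul_measure _
  have h3 := integral_map (μ := (volume : Measure (Fin 2 → ℝ))) (φ := Matrix.toLin' T)
    (LinearMap.continuous_of_finiteDimensional _).aemeasurable h2
  rw [h1, integral_smul_measure, ENNReal.toReal_ofReal (abs_nonneg _), abs_inv, smul_eq_mul] at h3
  rw [h3]
  rfl

lemma lineKernel_dilation (h₁ : 0 < q₁) (h₂ : 0 < q₂) (j : Fin 2) (p : ℝ) {μ : ℝ} (hμ : 0 < μ)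
    (u : Fin 2 → ℝ) :
    lineKernel q₁ q₂ Lplus Lminus j p (μ ^ (1 / ![q₁, q₂] j)) (dilation q₁ q₂ μ *ᵥ u) =
      μ ^ (1 / ![q₁, q₂] j) * (μ⁻¹ * lineKernel q₁ q₂ Lplus Lminus j p 1 u) := by
  set t := μ ^ (1 / ![q₁, q₂] j) with ht
  have ht0 : t ≠ 0 := (Real.rpow_pos_of_pos hμ _).ne'
  have h3 : ∀ s, aInfty q₁ q₂ Lplus Lminus (Pi.single j (p * (t * s)) - dilation q₁ q₂ μ *ᵥ u)
      = μ⁻¹ * aInfty q₁ q₂ Lplus Lminus (Pi.single j (p * s) - u) := by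
    intro s
    rw [← aInfty_dilation h₁ h₂ hμ, Matrix.mulVec_sub]
    congr 2
    ext i
    rw [dilation_mulVec_apply]
    rcases eq_or_ne i j with rfl | hij
    · simp only [Pi.single_eq_same, ← ht]
      ring
    · simp [Pi.single_eq_of_ne hij]
  have h4 := intervalIntegral.integral_comp_mul_left (a := 0) (b := 1) (c := t) (fun s =>
    aInfty q₁ q₂ Lplus Lminus (Pi.single j (p * s) - dilation q₁ q₂ μ *ᵥ u)) ht0
  simp only [h3, mul_zero, mul_one, intervalIntegral.integral_const_mul, smul_eq_mul] at h4
  rw [lineKernel, lineKernel, h4, mul_inv_cancel_left₀ ht0]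

/-- Self-similarity of the variance. -/
lemma lineVariance_eq (hq : IsAdmissible q₁ q₂)
    (hp : ContinuousOn Lplus (Set.Icc (-1) 1)) (hm : ContinuousOn Lminus (Set.Icc (-1) 1))
    (j : Fin 2) {p : ℝ} (hp0 : p ≠ 0) {t : ℝ} (ht : 0 < t) :
    lineVariance q₁ q₂ Lplus Lminus j p t =
      t ^ (2 * Htilde q₁ q₂ (![q₁, q₂] j)) * lineVariance q₁ q₂ Lplus Lminus j p 1 := by
  have hj := hq.pos j
  set q := ![q₁, q₂] j with hqj
  set μ := t ^ q with hμ
  have hμ0 : 0 < μ := Real.rpow_pos_of_pos ht q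
  have hμt : μ ^ (1 / q) = t := by
    rw [hμ, ← Real.rpow_mul ht.le, mul_one_div_cancel hj.ne', Real.rpow_one]
  have hdet : (dilation q₁ q₂ μ).det ≠ 0 := by
    rw [det_dilation hμ0]
    exact (Real.rpow_pos_of_pos hμ0 _).ne'
  have h1 := integral_comp_mulVec hdet (f := fun v => lineKernel q₁ q₂ Lplus Lminus j p t v ^ 2)
    ((memLp_lineKernel hq hp hm j hp0 ht).aestronglyMeasurable.pow 2)
  have h2 : ∀ u, lineKernel q₁ q₂ Lplus Lminus j p t (dilation q₁ q₂ μ *ᵥ u) ^ 2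
      = (t * μ⁻¹) ^ 2 * lineKernel q₁ q₂ Lplus Lminus j p 1 u ^ 2 := by
    intro u
    have := lineKernel_dilation (Lplus := Lplus) (Lminus := Lminus) hq.pos₁ hq.pos₂ j p hμ0 u
    rw [← hqj, hμt] at this
    rw [this]
    ring
  simp only [h2] at h1
  rw [integral_const_mul, det_dilation hμ0, abs_of_pos (Real.rpow_pos_of_pos hμ0 _)] at h1
  have h3 : lineVariance q₁ q₂ Lplus Lminus j p t = μ ^ bigQ q₁ q₂ * ((t * μ⁻¹) ^ 2 *
      lineVariance q₁ q₂ Lplus Lminus j p 1) := by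
    rw [lineVariance, lineVariance, h1, mul_inv_cancel_left₀ (Real.rpow_pos_of_pos hμ0 _).ne']
  rw [h3, ← mul_assoc]
  congr 1
  rw [hμ, ← Real.rpow_mul ht.le, ← Real.rpow_neg ht.le, mul_pow, ← Real.rpow_natCast,
    ← Real.rpow_natCast, ← Real.rpow_mul ht.le, ← Real.rpow_add ht, ← Real.rpow_add ht, Htilde]
  congr 1
  push_cast
  ring

/-- Stationarity of the increments. -/
lemma integral_lineKernel_sub_sq (hq : IsAdmissible q₁ q₂)
    (hp : ContinuousOn Lplus (Set.Icc (-1) 1)) (hm : ContinuousOn Lminus (Set.Icc (-1) 1))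
    (j : Fin 2) {p : ℝ} (hp0 : p ≠ 0) {s t : ℝ} (hs : 0 < s) (hst : s ≤ t) :
    ∫ u, (lineKernel q₁ q₂ Lplus Lminus j p t u - lineKernel q₁ q₂ Lplus Lminus j p s u) ^ 2 =
      lineVariance q₁ q₂ Lplus Lminus j p (t - s) := by
  rw [lineVariance, ← integral_sub_right_eq_self
    (fun u => lineKernel q₁ q₂ Lplus Lminus j p (t - s) u ^ 2) (Pi.single j (p * s))]
  refine integral_congr_ae ?_
  filter_upwards [ae_intervalIntegrable_line hq hp hm j hp0 (hs.le.trans hst)] with u hu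
  congr 1
  have h0 : (0 : ℝ) ∈ Set.Icc 0 t := ⟨le_rfl, hs.le.trans hst⟩
  rw [lineKernel, lineKernel, intervalIntegral.integral_interval_sub_left
    (hu 0 h0 t ⟨hs.le.trans hst, le_rfl⟩) (hu 0 h0 s ⟨hs.le, hst⟩), lineKernel]
  have h3 := intervalIntegral.integral_comp_add_right (a := 0) (b := t - s)
    (fun σ => aInfty q₁ q₂ Lplus Lminus (Pi.single j (p * σ) - u)) s
  rw [zero_add, sub_add_cancel] at h3
  rw [← h3]
  congr 1
  ext σ
  congr 1
  rw [mul_add, Pi.single_add]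
  abel

lemma lineKernel_zero (j : Fin 2) (p : ℝ) (u : Fin 2 → ℝ) :
    lineKernel q₁ q₂ Lplus Lminus j p 0 u = 0 :=
  intervalIntegral.integral_same

/-- Positivity comes from the condition on the averages along the coordinate `j`, the upper bound from
`Q < 2`. -/
lemma htilde_mem (hq : IsAdmissible q₁ q₂) (j : Fin 2) :
    0 < Htilde q₁ q₂ (![q₁, q₂] j) ∧ Htilde q₁ q₂ (![q₁, q₂] j) < 1 := by
  have hj := hq.pos j
  obtain ⟨i, hij⟩ : ∃ i : Fin 2, i ≠ j := exists_ne j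
  have h1 := hq.one_lt i j hij
  have hi := hq.pos i
  have hQ : bigQ q₁ q₂ = 1 / ![q₁, q₂] i + 1 / ![q₁, q₂] j := by
    fin_cases i <;> fin_cases j
    · exact absurd rfl hij
    · rfl
    · exact add_comm _ _
    · exact absurd rfl hij
  have hlt := hq.lt_two
  rw [hQ] at hlt
  rw [Htilde, hQ]
  set p := ![q₁, q₂] i
  set q := ![q₁, q₂] j
  have h2 : 1 / (2 * p) = 1 / p / 2 := by field_simp
  have h3 : q * (1 / q) = 1 := mul_one_div_cancel hj.ne'
  rw [h2] at h1
  refine ⟨?_, ?_⟩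
  · nlinarith [mul_pos hj (sub_pos.2 h1)]
  · nlinarith [mul_pos hj (sub_pos.2 hlt)]

/-- The covariance is that of a fractional Brownian motion, by self-similarity, stationarity of the
increments and polarisation. -/
lemma integral_lineKernel_mul (hq : IsAdmissible q₁ q₂)
    (hp : ContinuousOn Lplus (Set.Icc (-1) 1)) (hm : ContinuousOn Lminus (Set.Icc (-1) 1))
    (j : Fin 2) {p : ℝ} (hp0 : p ≠ 0) {s t : ℝ} (hs : 0 < s) (ht : 0 < t) :
    ∫ u, lineKernel q₁ q₂ Lplus Lminus j p s u * lineKernel q₁ q₂ Lplus Lminus j p t u =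
      lineVariance q₁ q₂ Lplus Lminus j p 1 * (1 / 2 * (s ^ (2 * Htilde q₁ q₂ (![q₁, q₂] j)) +
        t ^ (2 * Htilde q₁ q₂ (![q₁, q₂] j)) - |s - t| ^ (2 * Htilde q₁ q₂ (![q₁, q₂] j)))) := by
  wlog hst : s ≤ t generalizing s t
  · have := this ht hs (le_of_not_ge hst)
    rw [abs_sub_comm, add_comm (t ^ _)] at this
    rw [← this]
    simp only [mul_comm]
  have hMs := memLp_lineKernel hq hp hm j hp0 hs
  have hMt := memLp_lineKernel hq hp hm j hp0 ht
  have h1 := integral_lineKernel_sub_sq hq hp hm j hp0 hs hst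
  have h2 : ∀ u, (lineKernel q₁ q₂ Lplus Lminus j p t u - lineKernel q₁ q₂ Lplus Lminus j p s u) ^ 2
      = lineKernel q₁ q₂ Lplus Lminus j p t u ^ 2 + lineKernel q₁ q₂ Lplus Lminus j p s u ^ 2
        - 2 * (lineKernel q₁ q₂ Lplus Lminus j p s u * lineKernel q₁ q₂ Lplus Lminus j p t u) :=
    fun u => by ring
  simp only [h2] at h1
  have h3 : lineVariance q₁ q₂ Lplus Lminus j p (t - s) =
      |s - t| ^ (2 * Htilde q₁ q₂ (![q₁, q₂] j)) * lineVariance q₁ q₂ Lplus Lminus j p 1 := by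
    rcases hst.eq_or_lt with rfl | hlt
    · rw [sub_self, abs_zero, Real.zero_rpow (by linarith [(htilde_mem hq j).1]), zero_mul,
        lineVariance]
      simp [lineKernel_zero]
    · rw [abs_sub_comm, abs_of_pos (sub_pos.2 hlt)]
      exact lineVariance_eq hq hp hm j hp0 (sub_pos.2 hlt)
  have hi : Integrable fun u => lineKernel q₁ q₂ Lplus Lminus j p t u ^ 2 +
      lineKernel q₁ q₂ Lplus Lminus j p s u ^ 2 := hMt.integrable_sq.add hMs.integrable_sq
  have hi' : Integrable fun u => 2 * (lineKernel q₁ q₂ Lplus Lminus j p s u *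
      lineKernel q₁ q₂ Lplus Lminus j p t u) := (hMs.integrable_mul hMt).const_mul 2
  rw [integral_sub hi hi',
    integral_add hMt.integrable_sq hMs.integrable_sq, integral_const_mul, h3] at h1
  have h4 := lineVariance_eq hq hp hm j hp0 hs
  have h5 := lineVariance_eq hq hp hm j hp0 ht
  rw [lineVariance] at h4 h5
  rw [h4, h5] at h1
  linarith

/-- Near a point where `a_∞` is continuous and nonzero, short averages of `a_∞` do not vanish;
by self-similarity the averages over the unit interval do not vanish identically either. -/
lemma lineVariance_one_pos (hq : IsAdmissible q₁ q₂)
    (hp : ContinuousOn Lplus (Set.Icc (-1) 1)) (hm : ContinuousOn Lminus (Set.Icc (-1) 1))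
    (j : Fin 2) {p : ℝ} (hp0 : p ≠ 0)
    (h : ∃ z ∈ Set.Icc (-1 : ℝ) 1, Lplus z ≠ 0 ∨ Lminus z ≠ 0) :
    0 < lineVariance q₁ q₂ Lplus Lminus j p 1 := by
  have hnn : 0 ≤ lineVariance q₁ q₂ Lplus Lminus j p 1 := integral_nonneg fun u => sq_nonneg _
  refine hnn.lt_of_ne' fun h0 => ?_
  obtain ⟨w, hw, haw⟩ := exists_aInfty_ne_zero hq.pos₁ hq.pos₂ hp hm h
  set α := aInfty q₁ q₂ Lplus Lminus w with hα
  obtain ⟨r, hr, hball⟩ := Metric.continuousAt_iff.1 (continuousAt_aInfty hq.pos₁ hq.pos₂ hp hm hw)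
    (|α| / 2) (by positivity)
  -- for `u` near `-w` the segment of integration stays in the ball of radius `r` around `w`
  set t := r / (2 * |p|) with ht
  have ht0 : 0 < t := by positivity
  have h1 := lineVariance_eq hq hp hm j hp0 ht0
  rw [h0, mul_zero, lineVariance, integral_eq_zero_iff_of_nonneg (fun u => sq_nonneg _)
    (memLp_lineKernel hq hp hm j hp0 ht0).integrable_sq] at h1
  have hae := h1.and (ae_intervalIntegrable_line hq hp hm j hp0 ht0.le)
  have hpos : 0 < volume (Metric.ball (-w) (r / 2)) := Metric.measure_ball_pos _ _ (by positivity)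
  obtain ⟨u, hu, hu0, hui⟩ := ((frequently_ae_mem_iff.2 hpos.ne').and_eventually hae).exists
  have hu0' : lineKernel q₁ q₂ Lplus Lminus j p t u = 0 := by simpa using hu0
  have h3 : ‖∫ s in (0 : ℝ)..t, (aInfty q₁ q₂ Lplus Lminus (Pi.single j (p * s) - u) - α)‖
      ≤ |α| / 2 * |t - 0| := by
    refine intervalIntegral.norm_integral_le_of_norm_le_const fun s hs => ?_
    rw [Set.uIoc_of_le ht0.le] at hs
    rw [← dist_eq_norm]
    refine (hball ?_).le
    have h4 : dist (Pi.single j (p * s) - u) w ≤ ‖(Pi.single j (p * s) : Fin 2 → ℝ)‖ + ‖u - -w‖ := by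
      rw [dist_eq_norm]
      refine le_trans (le_of_eq ?_) (norm_sub_le _ _)
      congr 1
      abel
    have h5 : ‖(Pi.single j (p * s) : Fin 2 → ℝ)‖ ≤ r / 2 := by
      rw [Pi.norm_single, norm_mul, Real.norm_eq_abs, Real.norm_eq_abs, abs_of_pos hs.1]
      calc |p| * s ≤ |p| * t := by gcongr; exact hs.2
        _ = r / 2 := by rw [ht]; field_simp
    rw [Metric.mem_ball, dist_eq_norm] at hu
    linarith
  rw [intervalIntegral.integral_sub (hui 0 ⟨le_rfl, ht0.le⟩ t ⟨ht0.le, le_rfl⟩) (by simp),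
    ← lineKernel, hu0', intervalIntegral.integral_const, sub_zero, zero_sub, norm_neg, smul_eq_mul,
    norm_mul, Real.norm_eq_abs, Real.norm_eq_abs, abs_of_pos ht0] at h3
  have : 0 < |α| * t := mul_pos (abs_pos.2 haw) ht0
  nlinarith

variable {Ω' : Type*} [MeasurableSpace Ω'] {P' : Measure Ω'}
  {I : Lp ℝ 2 (volume : Measure (Fin 2 → ℝ)) →ₗ[ℝ] Lp ℝ 2 P'}

lemma integral_vtilde_single_mul (hI : IsWhiteNoiseIntegral P' I) (hq : IsAdmissible q₁ q₂)
    (hp : ContinuousOn Lplus (Set.Icc (-1) 1)) (hm : ContinuousOn Lminus (Set.Icc (-1) 1))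
    (B : Matrix (Fin 2) (Fin 2) ℝ) {j k k' : Fin 2} (hk : k ≠ k') {p : ℝ} (hp0 : p ≠ 0)
    {x y : Fin 2 → ℝ} (hx : ∀ i, 0 < x i) (hy : ∀ i, 0 < y i) :
    ∫ ω, Vtilde I q₁ q₂ Lplus Lminus B (Matrix.single j k p) x ω *
        Vtilde I q₁ q₂ Lplus Lminus B (Matrix.single j k p) y ω ∂P' =
      ((|B.det| ^ (-(1 / 2) : ℝ)) ^ 2 * lineVariance q₁ q₂ Lplus Lminus j p 1) *
        (x k' * y k' * (1 / 2 * (x k ^ (2 * Htilde q₁ q₂ (![q₁, q₂] j)) +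
        y k ^ (2 * Htilde q₁ q₂ (![q₁, q₂] j)) -
          |x k - y k| ^ (2 * Htilde q₁ q₂ (![q₁, q₂] j))))) := by
  have hW := wellDefined_of_ne_zero (Lplus := Lplus) (Lminus := Lminus) hq hp hm B
    (D := Matrix.single j k p) (j := j) (k := k) (by simpa using hp0)
  simp only [Vtilde]
  rw [hI.integral_mul, inner_toL2 (hW x hx).2 (hW y hy).2]
  simp only [kernel_single hq.pos₁ hp hm B hk p hx, kernel_single hq.pos₁ hp hm B hk p hy]
  have h1 : ∀ u, |B.det| ^ (-(1 / 2) : ℝ) * (x k' * lineKernel q₁ q₂ Lplus Lminus j p (x k) u) *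
      (|B.det| ^ (-(1 / 2) : ℝ) * (y k' * lineKernel q₁ q₂ Lplus Lminus j p (y k) u)) =
      (|B.det| ^ (-(1 / 2) : ℝ)) ^ 2 * (x k' * y k') * (lineKernel q₁ q₂ Lplus Lminus j p (x k) u *
        lineKernel q₁ q₂ Lplus Lminus j p (y k) u) := fun u => by ring
  simp only [h1]
  rw [integral_const_mul, integral_lineKernel_mul hq hp hm j hp0 (hx k) (hy k)]
  ring

lemma sigmaOf_sq (V : (Fin 2 → ℝ) → Ω' → ℝ) : sigmaOf P' V ^ 2 = ∫ ω, V 1 ω * V 1 ω ∂P' := by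
  rw [sigmaOf, Real.sq_sqrt (integral_nonneg fun _ => sq_nonneg _)]
  simp only [pow_two]

lemma sigmaOf_vtilde_single_sq (hI : IsWhiteNoiseIntegral P' I) (hq : IsAdmissible q₁ q₂)
    (hp : ContinuousOn Lplus (Set.Icc (-1) 1)) (hm : ContinuousOn Lminus (Set.Icc (-1) 1))
    (B : Matrix (Fin 2) (Fin 2) ℝ) (j k : Fin 2) {p : ℝ} (hp0 : p ≠ 0) :
    sigmaOf P' (Vtilde I q₁ q₂ Lplus Lminus B (Matrix.single j k p)) ^ 2 =
      (|B.det| ^ (-(1 / 2) : ℝ)) ^ 2 * lineVariance q₁ q₂ Lplus Lminus j p 1 := by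
  obtain ⟨k', hk⟩ : ∃ k' : Fin 2, k' ≠ k := exists_ne k
  rw [sigmaOf_sq, integral_vtilde_single_mul hI hq hp hm B hk.symm hp0 (by simp) (by simp)]
  simp [Real.zero_rpow (mul_ne_zero two_ne_zero (htilde_mem hq j).1.ne')]
  ring

lemma isScaledFBS_single_one (hI : IsWhiteNoiseIntegral P' I) (hq : IsAdmissible q₁ q₂)
    (hp : ContinuousOn Lplus (Set.Icc (-1) 1)) (hm : ContinuousOn Lminus (Set.Icc (-1) 1))
    (B : Matrix (Fin 2) (Fin 2) ℝ) (j : Fin 2) {p : ℝ} (hp0 : p ≠ 0) :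
    IsScaledFBS P' (sigmaOf P' (Vtilde I q₁ q₂ Lplus Lminus B (Matrix.single j 1 p)))
      1 (Htilde q₁ q₂ (![q₁, q₂] j)) (Vtilde I q₁ q₂ Lplus Lminus B (Matrix.single j 1 p)) where
  H₁_mem := by simp
  H₂_mem := ⟨(htilde_mem hq j).1, (htilde_mem hq j).2.le⟩
  gaussian := hI.isGaussianProcess _
  mean_zero x _ := hI.integral_eq_zero _
  covariance x y hx hy := by
    rw [integral_vtilde_single_mul hI hq hp hm B (k' := 0) (by decide) hp0 hx hy,
      sigmaOf_vtilde_single_sq hI hq hp hm B j 1 hp0]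
    have : x 0 ^ (2 * 1 : ℝ) + y 0 ^ (2 * 1 : ℝ) - |x 0 - y 0| ^ (2 * 1 : ℝ) = 2 * (x 0 * y 0) := by
      rw [mul_one, Real.rpow_two, Real.rpow_two, Real.rpow_two, sq_abs]
      ring
    rw [this]
    ring

lemma isScaledFBS_single_zero (hI : IsWhiteNoiseIntegral P' I) (hq : IsAdmissible q₁ q₂)
    (hp : ContinuousOn Lplus (Set.Icc (-1) 1)) (hm : ContinuousOn Lminus (Set.Icc (-1) 1))
    (B : Matrix (Fin 2) (Fin 2) ℝ) (j : Fin 2) {p : ℝ} (hp0 : p ≠ 0) :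
    IsScaledFBS P' (sigmaOf P' (Vtilde I q₁ q₂ Lplus Lminus B (Matrix.single j 0 p)))
      (Htilde q₁ q₂ (![q₁, q₂] j)) 1 (Vtilde I q₁ q₂ Lplus Lminus B (Matrix.single j 0 p)) where
  H₁_mem := ⟨(htilde_mem hq j).1, (htilde_mem hq j).2.le⟩
  H₂_mem := by simp
  gaussian := hI.isGaussianProcess _
  mean_zero x _ := hI.integral_eq_zero _
  covariance x y hx hy := by
    rw [integral_vtilde_single_mul hI hq hp hm B (k' := 1) (by decide) hp0 hx hy,
      sigmaOf_vtilde_single_sq hI hq hp hm B j 0 hp0]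
    have : x 1 ^ (2 * 1 : ℝ) + y 1 ^ (2 * 1 : ℝ) - |x 1 - y 1| ^ (2 * 1 : ℝ) = 2 * (x 1 * y 1) := by
      rw [mul_one, Real.rpow_two, Real.rpow_two, Real.rpow_two, sq_abs]
      ring
    rw [this]
    ring

lemma IsScaledFBS.integral_sq {σ H₁ H₂ : ℝ} {V : (Fin 2 → ℝ) → Ω' → ℝ}
    (h : IsScaledFBS P' σ H₁ H₂ V) {x : Fin 2 → ℝ} (hx : ∀ i, 0 < x i) :
    ∫ ω, V x ω ^ 2 ∂P' = σ ^ 2 * (x 0 ^ (2 * H₁) * x 1 ^ (2 * H₂)) := by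
  simp only [pow_two (V x _)]
  rw [h.covariance x x hx hx, sub_self, sub_self, abs_zero,
    Real.zero_rpow (mul_ne_zero two_ne_zero h.H₁_mem.1.ne'),
    Real.zero_rpow (mul_ne_zero two_ne_zero h.H₂_mem.1.ne')]
  ring

/-- The variances at `(1, 1)` and `(1, 2)` tell the two sheets apart. -/
lemma IsScaledFBS.not_fddEq {σ σ' H H' : ℝ} {U V : (Fin 2 → ℝ) → Ω' → ℝ}
    (hU : IsScaledFBS P' σ 1 H U) (hV : IsScaledFBS P' σ' H' 1 V) (hσ : σ ≠ 0) (hH : H < 1) (a : ℝ) :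
    ¬ FddEq P' U (fun x ω => a * V x ω) := by
  intro h
  have hmU : ∀ x : Fin 2 → ℝ, (∀ i, 0 < x i) → AEMeasurable (U x) P' := fun x hx =>
    (hU.gaussian.hasGaussianLaw_eval ⟨x, hx⟩).aemeasurable
  have hmV : ∀ x : Fin 2 → ℝ, (∀ i, 0 < x i) → AEMeasurable (V x) P' := fun x hx =>
    (hV.gaussian.hasGaussianLaw_eval ⟨x, hx⟩).aemeasurable
  have key : ∀ x : Fin 2 → ℝ, (∀ i, 0 < x i) →
      ∫ ω, U x ω ^ 2 ∂P' = a ^ 2 * ∫ ω, V x ω ^ 2 ∂P' := by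
    intro x hx
    have hsq : Measurable fun v : Fin 1 → ℝ => v 0 ^ 2 := by fun_prop
    have h1 := congrArg (fun m : Measure (Fin 1 → ℝ) => ∫ v, v 0 ^ 2 ∂m)
      (h 1 (fun _ => x) fun _ => hx)
    simp only at h1
    rw [integral_map (aemeasurable_pi_lambda _ fun _ => hmU x hx) hsq.aestronglyMeasurable,
      integral_map (aemeasurable_pi_lambda _ fun _ => (hmV x hx).const_mul a)
        hsq.aestronglyMeasurable] at h1
    rw [h1, ← integral_const_mul]
    simp only [mul_pow]
  have h1 := key ![1, 1] fun i => by fin_cases i <;> simp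
  have h2 := key ![1, 2] fun i => by fin_cases i <;> simp
  rw [hU.integral_sq fun i => by fin_cases i <;> simp,
    hV.integral_sq fun i => by fin_cases i <;> simp] at h1 h2
  simp only [Matrix.cons_val_zero, Matrix.cons_val_one, Real.one_rpow, one_mul, mul_one] at h1 h2
  rw [Real.rpow_two, ← mul_assoc, ← h1] at h2
  have h3 : (2 : ℝ) ^ (2 * H) < 2 ^ (2 : ℝ) :=
    Real.rpow_lt_rpow_of_exponent_lt (by norm_num) (by linarith)
  rw [Real.rpow_two] at h3
  exact h3.ne (mul_left_cancel₀ (pow_ne_zero 2 hσ) h2)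

lemma sigmaOf_vtilde_single_ne_zero (hI : IsWhiteNoiseIntegral P' I) (hq : IsAdmissible q₁ q₂)
    (hp : ContinuousOn Lplus (Set.Icc (-1) 1)) (hm : ContinuousOn Lminus (Set.Icc (-1) 1))
    {B : Matrix (Fin 2) (Fin 2) ℝ} (hB : B.det ≠ 0) (j k : Fin 2) {p : ℝ} (hp0 : p ≠ 0)
    (h : ∃ z ∈ Set.Icc (-1 : ℝ) 1, Lplus z ≠ 0 ∨ Lminus z ≠ 0) :
    sigmaOf P' (Vtilde I q₁ q₂ Lplus Lminus B (Matrix.single j k p)) ≠ 0 := by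
  have h1 := sigmaOf_vtilde_single_sq hI hq hp hm B j k hp0
  have h2 := lineVariance_one_pos hq hp hm j hp0 h
  intro h0
  rw [h0] at h1
  have h3 : 0 < |B.det| ^ (-(1 / 2) : ℝ) := Real.rpow_pos_of_pos (abs_pos.2 hB) _
  have := mul_pos (pow_pos h3 2) h2
  linarith

end Sheet

/-! ### Step functions on the lattice -/

/-- The lattice point `s` with `v ∈ ∏ᵢ (sᵢ - 1, sᵢ]`. -/
def ceilPt (v : Fin 2 → ℝ) : Fin 2 → ℤ := fun i => ⌈v i⌉

lemma measurable_ceilPt : Measurable ceilPt :=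
  measurable_pi_lambda _ fun i => Int.measurable_ceil.comp (measurable_pi_apply i)

lemma norm_ceilPt_sub_le (v : Fin 2 → ℝ) : ‖v - fun i => (ceilPt v i : ℝ)‖ ≤ 1 := by
  refine (pi_norm_le_iff_of_nonneg zero_le_one).2 fun i => ?_
  rw [Pi.sub_apply, Real.norm_eq_abs, abs_le]
  have h1 := Int.le_ceil (v i)
  have h2 := Int.ceil_lt_add_one (v i)
  simp only [ceilPt]
  constructor <;> linarith

lemma map_ceilPt_volume : (volume : Measure (Fin 2 → ℝ)).map ceilPt = Measure.count := by
  refine Measure.ext_of_singleton fun s => ?_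
  rw [Measure.map_apply measurable_ceilPt (measurableSet_singleton s), Measure.count_singleton]
  have : ceilPt ⁻¹' {s} = Set.univ.pi fun i => Set.Ioc ((s i : ℝ) - 1) (s i) := by
    ext v
    simp only [Set.mem_preimage, Set.mem_singleton_iff, funext_iff, ceilPt, Int.ceil_eq_iff,
      Set.mem_univ_pi, Set.mem_Ioc]
  rw [this, volume_pi_pi]
  simp

lemma lintegral_ceilPt (F : (Fin 2 → ℤ) → ℝ≥0∞) : ∫⁻ v, F (ceilPt v) = ∑' s, F s := by
  rw [← lintegral_map (measurable_of_countable F) measurable_ceilPt, map_ceilPt_volume,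
    lintegral_count]

lemma integral_ceilPt_ite (T : Finset (Fin 2 → ℤ)) (φ : (Fin 2 → ℤ) → ℝ) :
    ∫ v, (if ceilPt v ∈ T then φ (ceilPt v) else 0) = ∑ t ∈ T, φ t := by
  have h1 := integral_map (μ := (volume : Measure (Fin 2 → ℝ))) measurable_ceilPt.aemeasurable
    (f := fun t => if t ∈ T then φ t else 0) (measurable_of_countable _).aestronglyMeasurable
  rw [← h1, map_ceilPt_volume]
  have h2 : (fun t => if t ∈ T then φ t else 0) = (T : Set (Fin 2 → ℤ)).indicator φ := by
    ext t
    simp [Set.indicator_apply]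
  rw [h2, integral_indicator T.measurableSet, setIntegral_finset]
  · simp [Measure.real]
  · rw [← (T : Set (Fin 2 → ℤ)).biUnion_of_singleton]
    simp [integrableOn_finset_iUnion]

lemma lintegral_comp_mulVec {T : Matrix (Fin 2) (Fin 2) ℝ} (hT : T.det ≠ 0)
    {f : (Fin 2 → ℝ) → ℝ≥0∞} (hf : Measurable f) :
    ∫⁻ u, f (T *ᵥ u) = ENNReal.ofReal |T.det|⁻¹ * ∫⁻ v, f v := by
  have h1 := Real.map_matrix_volume_pi_eq_smul_volume_pi hT
  have h3 := lintegral_map (μ := (volume : Measure (Fin 2 → ℝ))) hf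
    (LinearMap.continuous_of_finiteDimensional (Matrix.toLin' T)).measurable
  rw [h1, lintegral_smul_measure, abs_inv, smul_eq_mul] at h3
  rw [h3]
  rfl

lemma lintegral_ceilPt_mulVec {T : Matrix (Fin 2) (Fin 2) ℝ} (hT : T.det ≠ 0)
    (F : (Fin 2 → ℤ) → ℝ≥0∞) :
    ∫⁻ u, F (ceilPt (T *ᵥ u)) = ENNReal.ofReal |T.det|⁻¹ * ∑' s, F s := by
  rw [lintegral_comp_mulVec hT (f := fun v => F (ceilPt v))
    ((measurable_of_countable F).comp measurable_ceilPt), lintegral_ceilPt]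

lemma measurable_ceilPt_mulVec (T : Matrix (Fin 2) (Fin 2) ℝ) :
    Measurable fun u => ceilPt (T *ᵥ u) :=
  measurable_ceilPt.comp (continuous_const.matrix_mulVec continuous_id).measurable

lemma eLpNorm_two_sq {α : Type*} [MeasurableSpace α] (μ : Measure α) (f : α → ℝ) :
    eLpNorm f 2 μ ^ 2 = ∫⁻ a, ‖f a‖ₑ ^ 2 ∂μ := by
  have := eLpNorm_nnreal_pow_eq_lintegral (μ := μ) (f := f) (p := 2) (by norm_num)
  simpa using this

lemma enorm_sq_toReal (y : ℝ) : (‖y‖ₑ ^ 2).toReal = y ^ 2 := by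
  simp

lemma summable_sq_of_tsum_ne_top {g : (Fin 2 → ℤ) → ℝ} (h : ∑' s, ‖g s‖ₑ ^ 2 ≠ ∞) :
    Summable fun s => g s ^ 2 := by
  simpa [enorm_sq_toReal] using ENNReal.summable_toReal h

lemma tsum_sq_eq_toReal (g : (Fin 2 → ℤ) → ℝ) :
    ∑' s, g s ^ 2 = (∑' s, ‖g s‖ₑ ^ 2).toReal := by
  rw [ENNReal.tsum_toReal_eq fun s => by finiteness]
  simp only [enorm_sq_toReal]

/-- The function on the plane that takes the value `|det T|^{1/2} g(s)` on the `T`-preimage of the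
cell of the lattice point `s`; the factor makes `g ↦ stepFun T g` an isometry `ℓ² → L²`. -/
def stepFun (T : Matrix (Fin 2) (Fin 2) ℝ) (g : (Fin 2 → ℤ) → ℝ) (u : Fin 2 → ℝ) : ℝ :=
  √|T.det| * g (ceilPt (T *ᵥ u))

lemma measurable_stepFun (T : Matrix (Fin 2) (Fin 2) ℝ) (g : (Fin 2 → ℤ) → ℝ) :
    Measurable (stepFun T g) :=
  ((measurable_of_countable g).comp (measurable_ceilPt_mulVec T)).const_mul _

lemma enorm_sqrt_sq (y : ℝ) : ‖√|y|‖ₑ ^ 2 = ENNReal.ofReal |y| := by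
  rw [Real.enorm_of_nonneg (Real.sqrt_nonneg _), ← ENNReal.ofReal_pow (Real.sqrt_nonneg _),
    Real.sq_sqrt (abs_nonneg _)]

lemma lintegral_stepFun_sq {T : Matrix (Fin 2) (Fin 2) ℝ} (hT : T.det ≠ 0)
    (g : (Fin 2 → ℤ) → ℝ) : ∫⁻ u, ‖stepFun T g u‖ₑ ^ 2 = ∑' s, ‖g s‖ₑ ^ 2 := by
  have hd : 0 < |T.det| := abs_pos.2 hT
  simp only [stepFun, enorm_mul, mul_pow, enorm_sqrt_sq]
  rw [lintegral_const_mul' _ _ ENNReal.ofReal_ne_top,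
    lintegral_ceilPt_mulVec hT fun s => ‖g s‖ₑ ^ 2, ← mul_assoc,
    ← ENNReal.ofReal_mul hd.le, mul_inv_cancel₀ hd.ne', ENNReal.ofReal_one, one_mul]

lemma volume_cell {T : Matrix (Fin 2) (Fin 2) ℝ} (hT : T.det ≠ 0) (s : Fin 2 → ℤ) :
    volume {u | ceilPt (T *ᵥ u) = s} = ENNReal.ofReal |T.det|⁻¹ := by
  have hm : MeasurableSet {u | ceilPt (T *ᵥ u) = s} :=
    measurable_ceilPt_mulVec T (measurableSet_singleton s)
  have h1 := lintegral_ceilPt_mulVec hT (({s} : Set (Fin 2 → ℤ)).indicator 1)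
  have h2 : (fun u => ({s} : Set (Fin 2 → ℤ)).indicator (1 : (Fin 2 → ℤ) → ℝ≥0∞) (ceilPt (T *ᵥ u)))
      = {u | ceilPt (T *ᵥ u) = s}.indicator 1 := by
    ext u
    simp [Set.indicator_apply]
  have h3 : ∑' t, ({s} : Set (Fin 2 → ℤ)).indicator (1 : (Fin 2 → ℤ) → ℝ≥0∞) t = 1 := by
    rw [tsum_eq_single s fun t ht => by simp [ht]]
    simp
  rw [h2, lintegral_indicator_one hm, h3, mul_one] at h1
  exact h1

/-- The square of a coefficient is the integral of the squared step function over one cell. -/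
lemma enorm_sq_le_of_stepFun {T : Matrix (Fin 2) (Fin 2) ℝ} (hT : T.det ≠ 0)
    (g : (Fin 2 → ℤ) → ℝ) {h : (Fin 2 → ℝ) → ℝ} (hh : AEMeasurable h) (s : Fin 2 → ℤ) :
    ‖g s‖ₑ ^ 2 ≤ 2 * ((∫⁻ u, ‖stepFun T g u - h u‖ₑ ^ 2) +
      ∫⁻ u in {u | ceilPt (T *ᵥ u) = s}, ‖h u‖ₑ ^ 2) := by
  have hd : 0 < |T.det| := abs_pos.2 hT
  have hm : MeasurableSet {u | ceilPt (T *ᵥ u) = s} :=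
    measurable_ceilPt_mulVec T (measurableSet_singleton s)
  have h1 : ‖g s‖ₑ ^ 2 = ∫⁻ u in {u | ceilPt (T *ᵥ u) = s}, ‖stepFun T g u‖ₑ ^ 2 := by
    have : ∀ u ∈ {u | ceilPt (T *ᵥ u) = s}, ‖stepFun T g u‖ₑ ^ 2
        = ENNReal.ofReal |T.det| * ‖g s‖ₑ ^ 2 := by
      intro u hu
      rw [stepFun, show ceilPt (T *ᵥ u) = s from hu, enorm_mul, mul_pow, enorm_sqrt_sq]
    rw [setLIntegral_congr_fun hm this, setLIntegral_const, volume_cell hT, mul_right_comm,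
      ← ENNReal.ofReal_mul hd.le, mul_inv_cancel₀ hd.ne', ENNReal.ofReal_one, one_mul]
  rw [h1]
  calc ∫⁻ u in {u | ceilPt (T *ᵥ u) = s}, ‖stepFun T g u‖ₑ ^ 2
      ≤ ∫⁻ u in {u | ceilPt (T *ᵥ u) = s}, 2 * (‖stepFun T g u - h u‖ₑ ^ 2 + ‖h u‖ₑ ^ 2) := by
        refine lintegral_mono fun u => le_trans ?_ (ennreal_add_sq_le _ _)
        gcongr
        calc ‖stepFun T g u‖ₑ = ‖(stepFun T g u - h u) + h u‖ₑ := by rw [sub_add_cancel]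
          _ ≤ _ := enorm_add_le _ _
    _ ≤ _ := by
        rw [lintegral_const_mul' _ _ ENNReal.ofNat_ne_top]
        gcongr
        rw [lintegral_add_right' _ (hh.restrict.enorm.pow_const 2)]
        exact add_le_add_left (setLIntegral_le_lintegral _ _) _

/-- Convergence in `L²` of the step functions yields the hypotheses of the central limit theorem
for their coefficients, the cells being asymptotically negligible. -/
lemma tendsto_of_stepFun {ι : Type*} {l : Filter ι} {T : ι → Matrix (Fin 2) (Fin 2) ℝ}
    (hT : Tendsto (fun r => |(T r).det|) l atTop) {g : ι → (Fin 2 → ℤ) → ℝ}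
    {h : (Fin 2 → ℝ) → ℝ} (hh : MemLp h 2 volume)
    (hconv : Tendsto (fun r => eLpNorm (fun u => stepFun (T r) (g r) u - h u) 2 volume) l (𝓝 0)) :
    (∀ᶠ r in l, Summable fun s => g r s ^ 2) ∧
      Tendsto (fun r => ∑' s, g r s ^ 2) l (𝓝 (∫ u, h u ^ 2)) ∧
      ∀ δ > 0, ∀ᶠ r in l, ∀ s, |g r s| ≤ δ := by
  have hdet : ∀ᶠ r in l, (T r).det ≠ 0 :=
    (hT.eventually_gt_atTop 0).mono fun r hr => abs_pos.1 hr
  have hm := fun r => (measurable_stepFun (T r) (g r)).aestronglyMeasurable (μ := volume)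
  have hnorm : Tendsto (fun r => eLpNorm (stepFun (T r) (g r)) 2 volume) l
      (𝓝 (eLpNorm h 2 volume)) := by
    have h1 : Tendsto (fun r => eLpNorm h 2 volume -
        eLpNorm (fun u => stepFun (T r) (g r) u - h u) 2 volume) l (𝓝 (eLpNorm h 2 volume)) := by
      simpa using ENNReal.Tendsto.sub (tendsto_const_nhds (x := eLpNorm h 2 volume)) hconv
        (Or.inl hh.2.ne)
    have h2 : Tendsto (fun r => eLpNorm h 2 volume +
        eLpNorm (fun u => stepFun (T r) (g r) u - h u) 2 volume) l (𝓝 (eLpNorm h 2 volume)) := by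
      simpa using (tendsto_const_nhds (x := eLpNorm h 2 volume)).add hconv
    refine tendsto_of_tendsto_of_tendsto_of_le_of_le h1 h2 (fun r => ?_) fun r => ?_
    · refine tsub_le_iff_right.2 ?_
      have := eLpNorm_sub_le (hm r) ((hm r).sub hh.1) (p := 2) (by norm_num)
      rwa [sub_sub_cancel] at this
    · have := eLpNorm_add_le hh.1 ((hm r).sub hh.1) (p := 2) (by norm_num)
      rwa [add_sub_cancel] at this
  have hsq : Tendsto (fun r => ∑' s, ‖g r s‖ₑ ^ 2) l (𝓝 (∫⁻ u, ‖h u‖ₑ ^ 2)) := by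
    rw [← eLpNorm_two_sq]
    refine (ENNReal.Tendsto.pow (n := 2) hnorm).congr' ?_
    filter_upwards [hdet] with r hr
    rw [eLpNorm_two_sq, lintegral_stepFun_sq hr]
  have hfin : ∫⁻ u, ‖h u‖ₑ ^ 2 ≠ ∞ := by
    rw [← eLpNorm_two_sq]
    exact ENNReal.pow_ne_top hh.2.ne
  refine ⟨?_, ?_, fun δ hδ => ?_⟩
  · filter_upwards [hsq.eventually (gt_mem_nhds hfin.lt_top)] with r hr
    exact summable_sq_of_tsum_ne_top hr.ne
  · have h3 : ∫ u, h u ^ 2 = (∫⁻ u, ‖h u‖ₑ ^ 2).toReal := by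
      rw [integral_eq_lintegral_of_nonneg_ae (Eventually.of_forall fun u => sq_nonneg _)
        (hh.1.pow 2)]
      congr 1
      refine lintegral_congr fun u => ?_
      rw [← enorm_sq_toReal, ENNReal.ofReal_toReal (by finiteness)]
    rw [h3]
    refine ((ENNReal.tendsto_toReal hfin).comp hsq).congr fun r => ?_
    rw [Function.comp_apply, tsum_sq_eq_toReal]
  · have hε : ENNReal.ofReal (δ ^ 2) / 4 ≠ 0 := by
      simp [hδ.ne']
    obtain ⟨η, hη, hη'⟩ := exists_pos_setLIntegral_lt_of_measure_lt hfin hε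
    have h4 : Tendsto (fun r => ENNReal.ofReal |(T r).det|⁻¹) l (𝓝 0) := by
      simpa using ENNReal.tendsto_ofReal (tendsto_inv_atTop_zero.comp hT)
    have h5 : Tendsto (fun r => ∫⁻ u, ‖stepFun (T r) (g r) u - h u‖ₑ ^ 2) l (𝓝 0) := by
      simpa [eLpNorm_two_sq] using ENNReal.Tendsto.pow (n := 2) hconv
    filter_upwards [hdet, h4.eventually (gt_mem_nhds hη),
      h5.eventually (gt_mem_nhds (pos_iff_ne_zero.2 hε))] with r h6 h7 h8 s
    have h9 := enorm_sq_le_of_stepFun h6 (g r) hh.1.aemeasurable s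
    have h10 := hη' {u | ceilPt (T r *ᵥ u) = s} (by rwa [volume_cell h6])
    have h11 : ‖g r s‖ₑ ^ 2 ≤ ENNReal.ofReal (δ ^ 2) := by
      refine h9.trans ((mul_le_mul_right (add_le_add h8.le h10.le) 2).trans (le_of_eq ?_))
      rw [← two_mul, ← mul_assoc]
      norm_num
      exact ENNReal.mul_div_cancel (by norm_num) (by norm_num)
    rw [Real.enorm_eq_ofReal_abs, ← ENNReal.ofReal_pow (abs_nonneg _),
      ENNReal.ofReal_le_ofReal_iff (by positivity)] at h11
    exact (pow_le_pow_iff_left₀ (abs_nonneg _) hδ.le two_ne_zero).1 h11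

/-! ### The coefficients of the moving average -/

lemma exists_le_rho_mulVec {q₁ q₂ : ℝ} (h₁ : 0 < q₁) (h₂ : 0 < q₂)
    {B : Matrix (Fin 2) (Fin 2) ℝ} (hB : B.det ≠ 0) :
    ∃ c > 0, ∀ v : Fin 2 → ℝ, 1 ≤ ‖v‖ → c ≤ rho q₁ q₂ (B *ᵥ v) := by
  have hc : Continuous fun v : Fin 2 → ℝ => rho q₁ q₂ (B *ᵥ v) :=
    (continuous_rho h₁ h₂).comp (continuous_const.matrix_mulVec continuous_id)
  obtain ⟨v₀, hv₀, hmin⟩ := (isCompact_sphere (0 : Fin 2 → ℝ) 1).exists_isMinOn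
    (NormedSpace.sphere_nonempty.2 zero_le_one) hc.continuousOn
  have hv₀' : v₀ ≠ 0 := by
    rintro rfl
    simp at hv₀
  refine ⟨rho q₁ q₂ (B *ᵥ v₀),
    rho_pos q₁ q₂ fun h => hv₀' (Matrix.eq_zero_of_mulVec_eq_zero hB h), fun v hv => ?_⟩
  have hv0 : 0 < ‖v‖ := zero_lt_one.trans_le hv
  have h3 : rho q₁ q₂ (B *ᵥ v₀) ≤ rho q₁ q₂ (B *ᵥ (‖v‖⁻¹ • v)) :=
    hmin (by simp [norm_smul, hv0.ne'])
  refine h3.trans ?_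
  have h4 : ∀ i, |(B *ᵥ (‖v‖⁻¹ • v)) i| ≤ |(B *ᵥ v) i| := by
    intro i
    rw [Matrix.mulVec_smul, Pi.smul_apply, smul_eq_mul, abs_mul, abs_inv, abs_norm]
    exact mul_le_of_le_one_left (abs_nonneg _) (inv_le_one_of_one_le₀ hv)
  exact add_le_add (Real.rpow_le_rpow (abs_nonneg _) (h4 0) h₁.le)
    (Real.rpow_le_rpow (abs_nonneg _) (h4 1) h₂.le)

lemma one_le_norm_intCast {m : Fin 2 → ℤ} (hm : m ≠ 0) : 1 ≤ ‖fun i => (m i : ℝ)‖ := by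
  obtain ⟨i, hi⟩ := Function.ne_iff.1 hm
  refine le_trans ?_ (norm_le_pi_norm (fun i => (m i : ℝ)) i)
  rw [Real.norm_eq_abs, ← Int.cast_abs]
  exact_mod_cast Int.one_le_abs hi

section Bound

variable {q₁ q₂ : ℝ} {Lplus Lminus : ℝ → ℝ} {B : Matrix (Fin 2) (Fin 2) ℝ} {b : (Fin 2 → ℤ) → ℝ}

/-- The coefficient at a lattice point is bounded by a multiple of `1 / (1 + ρ(B v))`, uniformly
over the points `v` at distance at most one. -/
lemma IsCoefficients.exists_bound (hb : IsCoefficients q₁ q₂ Lplus Lminus B b) :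
    ∃ C : ℝ, 0 < C ∧ ∀ (m : Fin 2 → ℤ) (e : Fin 2 → ℝ), ‖e‖ ≤ 1 →
      |b m| * (1 + rho q₁ q₂ (B *ᵥ ((fun i => (m i : ℝ)) + e))) ≤ C := by
  have h₁ := hb.q₁_pos
  have h₂ := hb.q₂_pos
  obtain ⟨o, ho, hbo⟩ := hb.asymptotics
  obtain ⟨C₀, hC₀⟩ := ho.abs.bddAbove_range_of_cofinite
  have hC₀' : ∀ m, |o m| ≤ C₀ := fun m => hC₀ ⟨m, rfl⟩
  obtain ⟨C₁, hC₁, hL⟩ := exists_abs_angular_le (q₂ := q₂) h₁ hb.continuousOn_Lplus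
    hb.continuousOn_Lminus
  obtain ⟨c, hc, hρ⟩ := exists_le_rho_mulVec h₁ h₂ hb.det_ne_zero
  obtain ⟨K, hK, hadd⟩ := exists_rho_add_le h₁ h₂
  have hcont : Continuous fun v : Fin 2 → ℝ => rho q₁ q₂ (B *ᵥ v) :=
    (continuous_rho h₁ h₂).comp (continuous_const.matrix_mulVec continuous_id)
  obtain ⟨M, hM⟩ := (isCompact_closedBall (0 : Fin 2 → ℝ) 1).exists_bound_of_continuousOn
    hcont.continuousOn
  have hC₀0 : 0 ≤ C₀ := (abs_nonneg _).trans (hC₀' 0)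
  have hM0 : 0 ≤ M := (norm_nonneg _).trans (hM 0 (by simp))
  have hK0 : 0 ≤ K := zero_le_one.trans hK
  have hprod : ∀ m : Fin 2 → ℤ, m ≠ 0 →
      |b m| * rho q₁ q₂ (B *ᵥ fun i => (m i : ℝ)) ≤ C₁ + C₀ := by
    intro m hm
    have hpos := hc.trans_le (hρ _ (one_le_norm_intCast hm))
    rw [hbo m hm, abs_mul, abs_inv, abs_of_pos hpos, mul_right_comm, inv_mul_cancel₀ hpos.ne',
      one_mul]
    exact (abs_add_le _ _).trans (add_le_add (hL _) (hC₀' m))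
  have habs : ∀ m, |b m| ≤ |b 0| + (C₁ + C₀) / c := by
    intro m
    by_cases hm : m = 0
    · rw [hm]
      exact le_add_of_nonneg_right (by positivity)
    · refine le_add_of_nonneg_of_le (abs_nonneg _) ((le_div_iff₀ hc).2 ?_)
      exact (mul_le_mul_of_nonneg_left (hρ _ (one_le_norm_intCast hm)) (abs_nonneg _)).trans
        (hprod m hm)
  have hprod' : ∀ m : Fin 2 → ℤ,
      |b m| * rho q₁ q₂ (B *ᵥ fun i => (m i : ℝ)) ≤ C₁ + C₀ := by
    intro m
    by_cases hm : m = 0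
    · have h0 : (fun i => (m i : ℝ)) = 0 := by
        ext i
        simp [hm]
      rw [h0, Matrix.mulVec_zero, rho]
      simp only [Pi.zero_apply, abs_zero, Real.zero_rpow h₁.ne', Real.zero_rpow h₂.ne',
        add_zero, mul_zero]
      positivity
    · exact hprod m hm
  refine ⟨(|b 0| + (C₁ + C₀) / c) * (1 + K * M) + K * (C₁ + C₀) + 1, by positivity,
    fun m e he => ?_⟩
  have h5 : rho q₁ q₂ (B *ᵥ ((fun i => (m i : ℝ)) + e))
      ≤ K * (rho q₁ q₂ (B *ᵥ fun i => (m i : ℝ)) + M) := by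
    rw [Matrix.mulVec_add]
    refine (hadd _ _).trans ?_
    gcongr
    exact (le_abs_self _).trans (hM e (by simpa using he))
  calc |b m| * (1 + rho q₁ q₂ (B *ᵥ ((fun i => (m i : ℝ)) + e)))
      ≤ |b m| * (1 + K * (rho q₁ q₂ (B *ᵥ fun i => (m i : ℝ)) + M)) := by gcongr
    _ = |b m| * (1 + K * M) + K * (|b m| * rho q₁ q₂ (B *ᵥ fun i => (m i : ℝ))) := by ring
    _ ≤ (|b 0| + (C₁ + C₀) / c) * (1 + K * M) + K * (C₁ + C₀) := by
      gcongr
      · exact habs m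
      · exact hprod' m
    _ ≤ _ := le_add_of_nonneg_right zero_le_one

lemma IsCoefficients.summable_sq (hb : IsCoefficients q₁ q₂ Lplus Lminus B b) :
    Summable fun s => b s ^ 2 := by
  obtain ⟨C, hC, hbd⟩ := hb.exists_bound
  refine summable_sq_of_tsum_ne_top (ne_of_lt ?_)
  rw [← lintegral_ceilPt fun s => ‖b s‖ₑ ^ 2]
  calc ∫⁻ v, ‖b (ceilPt v)‖ₑ ^ 2
      ≤ ∫⁻ v, ENNReal.ofReal C ^ 2 * oneAddRhoInv q₁ q₂ (B *ᵥ v) ^ 2 := by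
        refine lintegral_mono fun v => ?_
        rw [← mul_pow]
        gcongr
        have h1 := hbd (ceilPt v) (v - fun i => (ceilPt v i : ℝ)) (norm_ceilPt_sub_le v)
        rw [add_sub_cancel] at h1
        have h2 : 0 < 1 + rho q₁ q₂ (B *ᵥ v) :=
          add_pos_of_pos_of_nonneg one_pos (rho_nonneg _ _ _)
        rw [oneAddRhoInv, ← ENNReal.ofReal_inv_of_pos h2, ← ENNReal.ofReal_mul hC.le,
          Real.enorm_eq_ofReal_abs]
        exact ENNReal.ofReal_le_ofReal ((le_div_iff₀ h2).2 h1)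
    _ < ∞ := by
        rw [lintegral_const_mul' _ _ (by finiteness),
          lintegral_comp_mulVec hb.det_ne_zero (f := fun v => oneAddRhoInv q₁ q₂ v ^ 2)
            ((measurable_oneAddRhoInv q₁ q₂).pow_const 2)]
        have := lintegral_oneAddRhoInv_sq_lt_top hb.q₁_pos hb.q₂_pos hb.Q_lt_two
        finiteness

lemma IsCoefficients.exists_isLinearField (hb : IsCoefficients q₁ q₂ Lplus Lminus B b)
    {Ω : Type*} [MeasurableSpace Ω] {P : Measure Ω} {ε : (Fin 2 → ℤ) → Ω → ℝ}
    (hε : IsStandardIID P ε) : ∃ X, IsLinearField P b ε X := by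
  have h1 : ∀ t : Fin 2 → ℤ, ∃ Y, IsL2Series P ε (fun s => b (t - s)) Y := fun t =>
    exists_isL2Series hε ((Equiv.subLeft t).summable_iff.2 hb.summable_sq)
  choose X hX using h1
  exact ⟨X, hX⟩

end Bound

/-! ### Discretisation of the kernels -/

/-- The lattice points in `∏ᵢ (0, ℓᵢ xᵢ]`. -/
def boxPts (ℓ x : Fin 2 → ℝ) : Finset (Fin 2 → ℤ) :=
  Fintype.piFinset fun i => Finset.Ioc (0 : ℤ) ⌊ℓ i * x i⌋

lemma mem_boxPts {ℓ x : Fin 2 → ℝ} {t : Fin 2 → ℤ} :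
    t ∈ boxPts ℓ x ↔ ∀ i, 0 < t i ∧ t i ≤ ⌊ℓ i * x i⌋ := by
  simp [boxPts, Fintype.mem_piFinset, Finset.mem_Ioc]

lemma mem_rect_of_ceilPt_mem {ℓ x τ : Fin 2 → ℝ} (hℓ : ∀ i, 0 < ℓ i)
    (h : ceilPt (Matrix.diagonal ℓ *ᵥ τ) ∈ boxPts ℓ x) : τ ∈ rect x := by
  intro i _
  obtain ⟨h1, h2⟩ := mem_boxPts.1 h i
  rw [ceilPt, Matrix.mulVec_diagonal] at h1 h2
  exact ⟨pos_of_mul_pos_right (Int.ceil_pos.1 h1) (hℓ i).le, le_of_mul_le_mul_left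
    ((Int.le_ceil _).trans ((Int.cast_le.2 h2).trans (Int.floor_le _))) (hℓ i)⟩

lemma sum_boxPts_eq_integral {ℓ : Fin 2 → ℝ} (hℓ : ∀ i, 0 < ℓ i) (x : Fin 2 → ℝ)
    (φ : (Fin 2 → ℤ) → ℝ) :
    ∑ t ∈ boxPts ℓ x, φ t = ℓ 0 * ℓ 1 * ∫ τ in rect x,
      if ceilPt (Matrix.diagonal ℓ *ᵥ τ) ∈ boxPts ℓ x
        then φ (ceilPt (Matrix.diagonal ℓ *ᵥ τ)) else 0 := by
  have hd : (Matrix.diagonal ℓ).det = ℓ 0 * ℓ 1 := by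
    rw [Matrix.det_diagonal, Fin.prod_univ_two]
  have hpos : 0 < ℓ 0 * ℓ 1 := mul_pos (hℓ 0) (hℓ 1)
  rw [setIntegral_eq_integral_of_forall_compl_eq_zero, ← integral_ceilPt_ite,
    integral_comp_mulVec (T := Matrix.diagonal ℓ)
      (f := fun v => if ceilPt v ∈ boxPts ℓ x then φ (ceilPt v) else 0) (by rw [hd]; exact hpos.ne'),
    hd, abs_of_pos hpos, ← mul_assoc, mul_inv_cancel₀ hpos.ne', one_mul]
  · exact ((measurable_of_countable fun t => if t ∈ boxPts ℓ x then φ t else 0).comp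
      measurable_ceilPt).aestronglyMeasurable
  · intro τ hτ
    exact if_neg fun h => hτ (mem_rect_of_ceilPt_mem hℓ h)

/-- The discretisation `ν b(⌈ℓτ⌉ - ⌈Tu⌉)` of `a_∞(Dτ - u)` on the lattice box. -/
def latticeKernel (b : (Fin 2 → ℤ) → ℝ) (ℓ : Fin 2 → ℝ) (T : Matrix (Fin 2) (Fin 2) ℝ) (ν : ℝ)
    (x u τ : Fin 2 → ℝ) : ℝ :=
  if ceilPt (Matrix.diagonal ℓ *ᵥ τ) ∈ boxPts ℓ x
    then ν * b (ceilPt (Matrix.diagonal ℓ *ᵥ τ) - ceilPt (T *ᵥ u)) else 0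

lemma measurable_latticeKernel (b : (Fin 2 → ℤ) → ℝ) (ℓ : Fin 2 → ℝ)
    (T : Matrix (Fin 2) (Fin 2) ℝ) (ν : ℝ) (x : Fin 2 → ℝ) :
    Measurable (Function.uncurry (latticeKernel b ℓ T ν x)) := by
  have h1 : Measurable fun p : (Fin 2 → ℝ) × (Fin 2 → ℝ) =>
      (ceilPt (T *ᵥ p.1), ceilPt (Matrix.diagonal ℓ *ᵥ p.2)) :=
    ((measurable_ceilPt_mulVec T).comp measurable_fst).prodMk
      ((measurable_ceilPt_mulVec _).comp measurable_snd)
  exact (measurable_of_countable fun p : (Fin 2 → ℤ) × (Fin 2 → ℤ) =>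
    if p.2 ∈ boxPts ℓ x then ν * b (p.2 - p.1) else 0).comp h1

lemma norm_ceilPt_sub_sub_le (v w : Fin 2 → ℝ) :
    ‖(v - w) - fun i => ((ceilPt v - ceilPt w) i : ℝ)‖ ≤ 1 := by
  refine (pi_norm_le_iff_of_nonneg zero_le_one).2 fun i => ?_
  rw [Pi.sub_apply, Pi.sub_apply, Pi.sub_apply, Int.cast_sub, Real.norm_eq_abs, abs_le]
  have h1 := Int.le_ceil (v i)
  have h2 := Int.ceil_lt_add_one (v i)
  have h3 := Int.le_ceil (w i)
  have h4 := Int.ceil_lt_add_one (w i)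
  simp only [ceilPt]
  constructor <;> linarith

lemma dilation_mul_dilation_inv (q₁ q₂ : ℝ) {ν : ℝ} (hν : 0 < ν) :
    dilation q₁ q₂ ν * dilation q₁ q₂ ν⁻¹ = 1 := by
  rw [dilation, dilation, Matrix.diagonal_mul_diagonal, ← Matrix.diagonal_one]
  congr 1
  ext i
  rw [← Real.mul_rpow hν.le (inv_nonneg.2 hν.le), mul_inv_cancel₀ hν.ne', Real.one_rpow]

lemma tendsto_dilation_inv {q₁ q₂ : ℝ} (h₁ : 0 < q₁) (h₂ : 0 < q₂) {ι : Type*} {l : Filter ι}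
    {ν : ι → ℝ} (hν : Tendsto ν l atTop) :
    Tendsto (fun r => dilation q₁ q₂ (ν r)⁻¹) l (𝓝 0) := by
  rw [← Matrix.diagonal_zero]
  refine ((Continuous.matrix_diagonal continuous_id).tendsto _).comp (tendsto_pi_nhds.2 fun i => ?_)
  have hi : 0 < 1 / ![q₁, q₂] i := by
    fin_cases i
    · exact one_div_pos.2 h₁
    · exact one_div_pos.2 h₂
  have h3 := (tendsto_inv_atTop_zero.comp hν).rpow_const (p := 1 / ![q₁, q₂] i) (Or.inr hi.le)
  rwa [Real.zero_rpow hi.ne'] at h3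

section Discretisation

variable {q₁ q₂ : ℝ} {Lplus Lminus : ℝ → ℝ} {B : Matrix (Fin 2) (Fin 2) ℝ} {b : (Fin 2 → ℤ) → ℝ}

/-- The change of variables by which the lattice coefficients turn into values of the homogeneous
function `a_∞` at `A τ - u`, where `A = diag(ν^{-1/qᵢ}) B diag(ℓ)`. -/
lemma mulVec_sub_eq_dilation (hB : B.det ≠ 0) (ℓ : Fin 2 → ℝ) {ν : ℝ} (hν : 0 < ν)
    (u τ : Fin 2 → ℝ) :
    B *ᵥ (Matrix.diagonal ℓ *ᵥ τ - (B⁻¹ * dilation q₁ q₂ ν) *ᵥ u) =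
      dilation q₁ q₂ ν *ᵥ ((dilation q₁ q₂ ν⁻¹ * B * Matrix.diagonal ℓ) *ᵥ τ - u) := by
  rw [Matrix.mulVec_sub, Matrix.mulVec_sub, Matrix.mulVec_mulVec, Matrix.mulVec_mulVec,
    Matrix.mulVec_mulVec, ← mul_assoc, Matrix.mul_nonsing_inv _ (isUnit_iff_ne_zero.2 hB), one_mul,
    ← mul_assoc, ← mul_assoc, dilation_mul_dilation_inv _ _ hν, one_mul]

lemma enorm_latticeKernel_le (h₁ : 0 < q₁) (h₂ : 0 < q₂) (hB : B.det ≠ 0) {C : ℝ} (hC : 0 < C)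
    (hb : ∀ (m : Fin 2 → ℤ) (e : Fin 2 → ℝ), ‖e‖ ≤ 1 →
      |b m| * (1 + rho q₁ q₂ (B *ᵥ ((fun i => (m i : ℝ)) + e))) ≤ C)
    (ℓ : Fin 2 → ℝ) {ν : ℝ} (hν : 0 < ν) (x u τ : Fin 2 → ℝ) :
    ‖latticeKernel b ℓ (B⁻¹ * dilation q₁ q₂ ν) ν x u τ‖ₑ ≤ ENNReal.ofReal C *
      rhoInv q₁ q₂ ((dilation q₁ q₂ ν⁻¹ * B * Matrix.diagonal ℓ) *ᵥ τ - u) := by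
  unfold latticeKernel
  split_ifs
  swap
  · simp
  have h3 := hb (ceilPt (Matrix.diagonal ℓ *ᵥ τ) - ceilPt ((B⁻¹ * dilation q₁ q₂ ν) *ᵥ u)) _
    (norm_ceilPt_sub_sub_le (Matrix.diagonal ℓ *ᵥ τ) ((B⁻¹ * dilation q₁ q₂ ν) *ᵥ u))
  rw [add_sub_cancel, mulVec_sub_eq_dilation hB ℓ hν, rho_dilation h₁ h₂ hν] at h3
  set w := (dilation q₁ q₂ ν⁻¹ * B * Matrix.diagonal ℓ) *ᵥ τ - u
  set y := b (ceilPt (Matrix.diagonal ℓ *ᵥ τ) - ceilPt ((B⁻¹ * dilation q₁ q₂ ν) *ᵥ u))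
  rcases (rho_nonneg q₁ q₂ w).eq_or_lt with h0 | h0
  · rw [rhoInv, ← h0]
    simp [hC]
  · rw [rhoInv, ← ENNReal.ofReal_inv_of_pos h0, ← ENNReal.ofReal_mul hC.le,
      Real.enorm_eq_ofReal_abs]
    refine ENNReal.ofReal_le_ofReal ((le_div_iff₀ h0).2 ?_)
    rw [abs_mul, abs_of_pos hν]
    nlinarith [abs_nonneg y]

lemma tendsto_latticeKernel (hb : IsCoefficients q₁ q₂ Lplus Lminus B b) {ι : Type*} {l : Filter ι}
    {ν : ι → ℝ} (hν : Tendsto ν l atTop) {ℓ : ι → Fin 2 → ℝ}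
    (hℓ : ∀ i, Tendsto (fun r => ℓ r i) l atTop) {D : Matrix (Fin 2) (Fin 2) ℝ}
    (hA : Tendsto (fun r => dilation q₁ q₂ (ν r)⁻¹ * B * Matrix.diagonal (ℓ r)) l (𝓝 D))
    {x u τ : Fin 2 → ℝ} (h0 : ∀ i, 0 < τ i) (hx : ∀ i, τ i < x i) (hw : (D *ᵥ τ - u) 1 ≠ 0) :
    Tendsto (fun r => latticeKernel b (ℓ r) (B⁻¹ * dilation q₁ q₂ (ν r)) (ν r) x u τ) l
      (𝓝 (aInfty q₁ q₂ Lplus Lminus (D *ᵥ τ - u))) := by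
  have h₁ := hb.q₁_pos
  have h₂ := hb.q₂_pos
  obtain ⟨o, ho, hbo⟩ := hb.asymptotics
  set m : ι → Fin 2 → ℤ := fun r =>
    ceilPt (Matrix.diagonal (ℓ r) *ᵥ τ) - ceilPt ((B⁻¹ * dilation q₁ q₂ (ν r)) *ᵥ u)
  obtain ⟨e, he, hme⟩ : ∃ e : ι → Fin 2 → ℝ, (∀ r, ‖e r‖ ≤ 1) ∧ ∀ r, (fun i => (m r i : ℝ)) =
      (Matrix.diagonal (ℓ r) *ᵥ τ - (B⁻¹ * dilation q₁ q₂ (ν r)) *ᵥ u) - e r :=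
    ⟨_, fun r => norm_ceilPt_sub_sub_le (Matrix.diagonal (ℓ r) *ᵥ τ)
      ((B⁻¹ * dilation q₁ q₂ (ν r)) *ᵥ u), fun r => (sub_sub_cancel _ _).symm⟩
  set w : ι → Fin 2 → ℝ := fun r =>
    dilation q₁ q₂ (ν r)⁻¹ *ᵥ (B *ᵥ fun i => (m r i : ℝ)) with hwr
  have hν0 : ∀ᶠ r in l, 0 < ν r := hν.eventually_gt_atTop 0
  -- the rescaled lattice points converge
  have hlim : Tendsto w l (𝓝 (D *ᵥ τ - u)) := by
    have h3 : Tendsto (fun r => (dilation q₁ q₂ (ν r)⁻¹ * B * Matrix.diagonal (ℓ r)) *ᵥ τ - u) l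
        (𝓝 (D *ᵥ τ - u)) :=
      (((continuous_id.matrix_mulVec continuous_const).tendsto D).comp hA).sub_const u
    have h4 : Tendsto (fun r => dilation q₁ q₂ (ν r)⁻¹ *ᵥ (B *ᵥ e r)) l (𝓝 0) := by
      refine tendsto_pi_nhds.2 fun i => ?_
      have h5 : ∀ k, Tendsto (fun r => (dilation q₁ q₂ (ν r)⁻¹ * B) i k) l (𝓝 0) := by
        intro k
        have h6 := (tendsto_dilation_inv h₁ h₂ hν).mul_const B
        rw [zero_mul] at h6
        exact tendsto_pi_nhds.1 (tendsto_pi_nhds.1 h6 i) k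
      have h7 : ∀ k, Tendsto (fun r => (dilation q₁ q₂ (ν r)⁻¹ * B) i k * e r k) l (𝓝 0) :=
        fun k => (h5 k).zero_mul_isBoundedUnder_le <| isBoundedUnder_of ⟨1, fun r =>
          (norm_le_pi_norm (e r) k).trans (he r)⟩
      have h8 := tendsto_finsetSum Finset.univ fun k _ => h7 k
      rw [Finset.sum_const_zero] at h8
      refine h8.congr fun r => ?_
      rw [Matrix.mulVec_mulVec]
      rfl
    have h9 := h3.sub h4
    rw [sub_zero] at h9
    refine h9.congr' ?_
    filter_upwards [hν0] with r hr
    have h10 := mulVec_sub_eq_dilation (q₁ := q₁) (q₂ := q₂) hb.det_ne_zero (ℓ r) hr u τ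
    have h11 : ∀ v, dilation q₁ q₂ (ν r)⁻¹ *ᵥ (dilation q₁ q₂ (ν r) *ᵥ v) = v := by
      intro v
      have h12 := dilation_mul_dilation_inv q₁ q₂ (inv_pos.2 hr)
      rw [inv_inv] at h12
      rw [Matrix.mulVec_mulVec, h12, Matrix.one_mulVec]
    rw [hwr]
    simp only
    rw [hme r, Matrix.mulVec_sub B, h10, Matrix.mulVec_sub (dilation q₁ q₂ (ν r)⁻¹), h11]
  have hBm : ∀ᶠ r in l, (B *ᵥ fun i => (m r i : ℝ)) = dilation q₁ q₂ (ν r) *ᵥ w r := by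
    filter_upwards [hν0] with r hr
    rw [hwr]
    simp only
    rw [Matrix.mulVec_mulVec, dilation_mul_dilation_inv q₁ q₂ hr, Matrix.one_mulVec]
  have hρ0 : 0 < rho q₁ q₂ (D *ᵥ τ - u) := rho_pos q₁ q₂ fun h => hw (by rw [h]; rfl)
  have hρ : Tendsto (fun r => rho q₁ q₂ (w r)) l (𝓝 (rho q₁ q₂ (D *ᵥ τ - u))) :=
    ((continuous_rho h₁ h₂).tendsto _).comp hlim
  -- the lattice points leave every finite set
  have hcof : Tendsto m l cofinite := by
    refine le_cofinite_iff_eventually_ne.2 fun m₀ => ?_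
    have h3 : Tendsto (fun r => rho q₁ q₂ (B *ᵥ fun i => (m r i : ℝ))) l atTop := by
      refine (hν.atTop_mul_pos hρ0 hρ).congr' ?_
      filter_upwards [hν0, hBm] with r hr h4
      rw [h4, rho_dilation h₁ h₂ hr]
    rw [eventually_map]
    filter_upwards [h3.eventually_gt_atTop (rho q₁ q₂ (B *ᵥ fun i => (m₀ i : ℝ)))] with r hr h4
    rw [h4] at hr
    exact lt_irrefl _ hr
  have hbox : ∀ᶠ r in l, ceilPt (Matrix.diagonal (ℓ r) *ᵥ τ) ∈ boxPts (ℓ r) x := by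
    have h3 : ∀ i, ∀ᶠ r in l, 0 < ℓ r i ∧ 1 ≤ ℓ r i * (x i - τ i) := fun i =>
      ((hℓ i).eventually_gt_atTop 0).and
        (((hℓ i).atTop_mul_const (sub_pos.2 (hx i))).eventually_ge_atTop 1)
    filter_upwards [eventually_all.2 h3] with r hr
    refine mem_boxPts.2 fun i => ?_
    rw [ceilPt, Matrix.mulVec_diagonal]
    refine ⟨Int.ceil_pos.2 (mul_pos (hr i).1 (h0 i)), Int.le_floor.2 ?_⟩
    have h4 := Int.ceil_lt_add_one (ℓ r i * τ i)
    have h5 := (hr i).2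
    rw [mul_sub] at h5
    linarith
  have hmain : Tendsto (fun r => (rho q₁ q₂ (w r))⁻¹ *
      (angular q₁ q₂ Lplus Lminus (w r) + o (m r))) l
      (𝓝 (aInfty q₁ q₂ Lplus Lminus (D *ᵥ τ - u))) := by
    have h3 := ((continuousAt_angular h₁ h₂ hb.continuousOn_Lplus hb.continuousOn_Lminus
      hw).tendsto.comp hlim).add (ho.comp hcof)
    rw [add_zero] at h3
    exact (hρ.inv₀ hρ0.ne').mul h3
  refine hmain.congr' ?_
  filter_upwards [hν0, hBm, hbox, hcof.eventually (eventually_cofinite_ne 0)] with r h3 h4 h5 h6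
  rw [latticeKernel, if_pos h5]
  change _ = ν r * b (m r)
  rw [hbo _ h6, h4, rho_dilation h₁ h₂ h3, angular_dilation h₁ h₂ h3, mul_inv, ← mul_assoc,
    ← mul_assoc, mul_inv_cancel₀ h3.ne', one_mul]

end Discretisation

/-! ### Convergence of the partial sums -/

lemma tendsto_eLpNorm_two_of_sq {ι α : Type*} [MeasurableSpace α] {μ : Measure α} {l : Filter ι}
    {f : ι → α → ℝ} (h : Tendsto (fun r => ∫⁻ a, ‖f r a‖ₑ ^ 2 ∂μ) l (𝓝 0)) :
    Tendsto (fun r => eLpNorm (f r) 2 μ) l (𝓝 0) := by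
  have h1 := (ENNReal.continuous_rpow_const (y := 1 / 2)).tendsto 0 |>.comp h
  rw [ENNReal.zero_rpow_of_pos (by norm_num)] at h1
  refine h1.congr fun r => ?_
  rw [Function.comp_apply, ← eLpNorm_two_sq, ← ENNReal.rpow_natCast, ← ENNReal.rpow_mul]
  norm_num

section PartialSums

variable {q₁ q₂ : ℝ} {Lplus Lminus : ℝ → ℝ} {B : Matrix (Fin 2) (Fin 2) ℝ} {b : (Fin 2 → ℤ) → ℝ}

/-- The coefficients of the innovations in the normalised sum of `X` over a lattice box. -/
def sumCoeff (b : (Fin 2 → ℤ) → ℝ) (ℓ x : Fin 2 → ℝ) (N : ℝ) (s : Fin 2 → ℤ) : ℝ :=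
  N⁻¹ * ∑ t ∈ boxPts ℓ x, b (t - s)

/-- The step function of the normalised coefficients is an average of the lattice kernel. The power of
`ν` in the normalisation is the quotient of the square root of `|det T| = ν^Q / |det B|`, where
`T = B⁻¹ diag(ν^{1/qᵢ})`, and the factor `ν` in the lattice kernel. -/
lemma stepFun_sumCoeff (hB : B.det ≠ 0) (b : (Fin 2 → ℤ) → ℝ) {ℓ : Fin 2 → ℝ}
    (hℓ : ∀ i, 0 < ℓ i) {ν : ℝ} (hν : 0 < ν) (x u : Fin 2 → ℝ) :
    stepFun (B⁻¹ * dilation q₁ q₂ ν) (sumCoeff b ℓ x (ℓ 0 * ℓ 1 * ν ^ (bigQ q₁ q₂ / 2 - 1))) u =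
      |B.det| ^ (-(1 / 2) : ℝ) *
        ∫ τ in rect x, latticeKernel b ℓ (B⁻¹ * dilation q₁ q₂ ν) ν x u τ := by
  set T := B⁻¹ * dilation q₁ q₂ ν with hTdef
  have hdB : 0 < |B.det| := abs_pos.2 hB
  have hT : √|T.det| = |B.det| ^ (-(1 / 2) : ℝ) * ν ^ (bigQ q₁ q₂ / 2) := by
    rw [hTdef, Matrix.det_mul, Matrix.det_nonsing_inv, det_dilation hν, Ring.inverse_eq_inv',
      abs_mul, abs_inv, abs_of_pos (Real.rpow_pos_of_pos hν _), Real.sqrt_eq_rpow,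
      Real.mul_rpow (by positivity) (by positivity), Real.inv_rpow hdB.le, ← Real.rpow_neg hdB.le,
      ← Real.rpow_mul hν.le]
    congr 2
    ring
  have hk : ∀ τ, latticeKernel b ℓ T ν x u τ = ν * if ceilPt (Matrix.diagonal ℓ *ᵥ τ) ∈ boxPts ℓ x
      then b (ceilPt (Matrix.diagonal ℓ *ᵥ τ) - ceilPt (T *ᵥ u)) else 0 := by
    intro τ
    rw [latticeKernel, mul_ite, mul_zero]
  simp only [hk]
  rw [integral_const_mul, stepFun, sumCoeff, hT,
    sum_boxPts_eq_integral hℓ x fun t => b (t - ceilPt (T *ᵥ u)), Real.rpow_sub_one hν.ne']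
  have h1 := (hℓ 0).ne'
  have h2 := (hℓ 1).ne'
  have h3 := (Real.rpow_pos_of_pos hν (bigQ q₁ q₂ / 2)).ne'
  field_simp

lemma ae_ae_mulVec_sub_ne_zero (D : Matrix (Fin 2) (Fin 2) ℝ) (x : Fin 2 → ℝ) :
    ∀ᵐ u : Fin 2 → ℝ, ∀ᵐ τ ∂volume.restrict (rect x), (D *ᵥ τ - u) 1 ≠ 0 := by
  have hm : MeasurableSet {p : (Fin 2 → ℝ) × (Fin 2 → ℝ) | (D *ᵥ p.2 - p.1) 1 ≠ 0} :=
    ((measurable_pi_apply 1).comp (measurable_mulVec_sub D)) (measurableSet_singleton 0).compl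
  rw [Measure.ae_ae_comm (p := fun u τ => (D *ᵥ τ - u) 1 ≠ 0) hm]
  refine Eventually.of_forall fun τ => ?_
  have h1 : ∀ᵐ u : Fin 2 → ℝ, u 1 ≠ (D *ᵥ τ) 1 := by
    rw [ae_iff, volume_pi]
    simpa using Measure.pi_hyperplane (fun _ : Fin 2 => (volume : Measure ℝ)) 1 ((D *ᵥ τ) 1)
  filter_upwards [h1] with u hu
  rw [Pi.sub_apply, sub_ne_zero]
  exact hu.symm

lemma ae_forall_lt_of_rect (x : Fin 2 → ℝ) :
    ∀ᵐ τ ∂volume.restrict (rect x), ∀ i, 0 < τ i ∧ τ i < x i := by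
  have h1 : ∀ i : Fin 2, ∀ᵐ τ : Fin 2 → ℝ, τ i ≠ x i := by
    intro i
    rw [ae_iff, volume_pi]
    simpa using Measure.pi_hyperplane (fun _ : Fin 2 => (volume : Measure ℝ)) i (x i)
  filter_upwards [ae_restrict_mem (measurableSet_rect x), ae_restrict_of_ae (ae_all_iff.2 h1)]
    with τ h2 h3 i
  exact ⟨(h2 i trivial).1, (h2 i trivial).2.lt_of_ne (h3 i)⟩

lemma integrableOn_of_enorm_le_rhoInv {C : ℝ≥0∞} (hC : C ≠ ∞) {f : (Fin 2 → ℝ) → ℝ}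
    (hf : Measurable f) {A : Matrix (Fin 2) (Fin 2) ℝ} {x u : Fin 2 → ℝ}
    (hfb : ∀ τ, ‖f τ‖ₑ ≤ C * rhoInv q₁ q₂ (A *ᵥ τ - u))
    (h : ∫⁻ τ in rect x, rhoInv q₁ q₂ (A *ᵥ τ - u) < ∞) : IntegrableOn f (rect x) := by
  refine ⟨hf.aestronglyMeasurable, (lintegral_mono hfb).trans_lt ?_⟩
  rw [lintegral_const_mul' _ _ hC]
  finiteness

/-- In the scaling limit the normalised coefficients converge in `L²` to the kernel of `Ṽ_D`. -/
lemma tendsto_stepFun_sumCoeff (hq : IsAdmissible q₁ q₂)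
    (hb : IsCoefficients q₁ q₂ Lplus Lminus B b) {ι : Type*} {l : Filter ι}
    [l.IsCountablyGenerated] {ν : ι → ℝ} (hν : Tendsto ν l atTop) {ℓ : ι → Fin 2 → ℝ}
    (hℓ : ∀ i, Tendsto (fun r => ℓ r i) l atTop) {D : Matrix (Fin 2) (Fin 2) ℝ}
    (hA : Tendsto (fun r => dilation q₁ q₂ (ν r)⁻¹ * B * Matrix.diagonal (ℓ r)) l (𝓝 D))
    {j k : Fin 2} (hD : D j k ≠ 0) (x : Fin 2 → ℝ) :
    Tendsto (fun r => eLpNorm (fun u => stepFun (B⁻¹ * dilation q₁ q₂ (ν r)) (sumCoeff b (ℓ r) x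
      (ℓ r 0 * ℓ r 1 * ν r ^ (bigQ q₁ q₂ / 2 - 1))) u - kernel q₁ q₂ Lplus Lminus B D x u)
      2 volume) l (𝓝 0) := by
  have h₁ := hb.q₁_pos
  have h₂ := hb.q₂_pos
  obtain ⟨C₁, hC₁, hbd⟩ := hb.exists_bound
  obtain ⟨C₂, hC₂, hbd'⟩ := exists_enorm_aInfty_le (q₂ := q₂) h₁ hb.continuousOn_Lplus
    hb.continuousOn_Lminus
  have hν0 : ∀ᶠ r in l, 0 < ν r := hν.eventually_gt_atTop 0
  have hℓ0 : ∀ᶠ r in l, ∀ i, 0 < ℓ r i :=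
    eventually_all.2 fun i => (hℓ i).eventually_gt_atTop 0
  have hA0 : ∀ᶠ r in l, (dilation q₁ q₂ (ν r)⁻¹ * B * Matrix.diagonal (ℓ r)) j k ≠ 0 :=
    (tendsto_pi_nhds.1 (tendsto_pi_nhds.1 hA j) k).eventually_ne hD
  have hga := measurable_aInfty_mulVec_sub (q₂ := q₂) h₁ hb.continuousOn_Lplus
    hb.continuousOn_Lminus D
  have hfm := fun r => measurable_latticeKernel b (ℓ r) (B⁻¹ * dilation q₁ q₂ (ν r)) (ν r) x
  have hmain := tendsto_lintegral_sq_average hq hA hD x hfm hga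
    (C := ENNReal.ofReal C₁ + C₂) (by finiteness)
    (by
      filter_upwards [hν0] with r hr u τ _
      refine (enorm_latticeKernel_le h₁ h₂ hb.det_ne_zero hC₁ hbd (ℓ r) hr x u τ).trans ?_
      gcongr
      exact le_self_add)
    (fun u τ _ => (hbd' _).trans (by gcongr; exact le_add_self))
    (by
      filter_upwards [ae_ae_mulVec_sub_ne_zero D x] with u hu
      filter_upwards [hu, ae_forall_lt_of_rect x] with τ h3 h4
      exact tendsto_latticeKernel hb hν hℓ hA (fun i => (h4 i).1) (fun i => (h4 i).2) h3)
  refine tendsto_eLpNorm_two_of_sq ?_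
  have hmul := ENNReal.Tendsto.const_mul (a := ‖|B.det| ^ (-(1 / 2) : ℝ)‖ₑ ^ 2) hmain
    (Or.inr (by finiteness))
  rw [mul_zero] at hmul
  refine tendsto_of_tendsto_of_tendsto_of_le_of_le' tendsto_const_nhds hmul
    (Eventually.of_forall fun r => zero_le) ?_
  filter_upwards [hν0, hℓ0, hA0] with r h3 h4 h5
  rw [← lintegral_const_mul' _ _ (by finiteness)]
  refine lintegral_mono_ae ?_
  filter_upwards [ae_lintegral_rhoInv_lt_top hq h5 x, ae_lintegral_rhoInv_lt_top hq hD x]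
    with u h6 h7
  have h8 : IntegrableOn (latticeKernel b (ℓ r) (B⁻¹ * dilation q₁ q₂ (ν r)) (ν r) x u) (rect x) :=
    integrableOn_of_enorm_le_rhoInv ENNReal.ofReal_ne_top ((hfm r).comp measurable_prodMk_left)
      (enorm_latticeKernel_le h₁ h₂ hb.det_ne_zero hC₁ hbd (ℓ r) h3 x u) h6
  have h9 : IntegrableOn (fun τ => aInfty q₁ q₂ Lplus Lminus (D *ᵥ τ - u)) (rect x) :=
    integrableOn_of_enorm_le_rhoInv hC₂ (hga.comp measurable_prodMk_left) (fun τ => hbd' _) h7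
  rw [stepFun_sumCoeff hb.det_ne_zero b h4 h3, kernel, ← mul_sub, ← integral_sub h8 h9, enorm_mul,
    mul_pow]
  gcongr
  exact enorm_integral_le_lintegral_enorm _

/-- The central limit theorem for the normalised sums over lattice boxes with side lengths
`ℓ₁ x₁, ℓ₂ x₂`: the field `Ṽ_D` arises if the matrices `diag(ν^{-1/qᵢ}) B diag(ℓᵢ)` converge to
`D ≠ 0`. -/
theorem fddTendsto_vtilde {Ω : Type*} [MeasurableSpace Ω] {P : Measure Ω} [IsProbabilityMeasure P]
    {Ω' : Type*} [MeasurableSpace Ω'] {P' : Measure Ω'} [IsProbabilityMeasure P']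
    {ε X : (Fin 2 → ℤ) → Ω → ℝ} (hε : IsStandardIID P ε)
    {I : Lp ℝ 2 (volume : Measure (Fin 2 → ℝ)) →ₗ[ℝ] Lp ℝ 2 P'} (hI : IsWhiteNoiseIntegral P' I)
    (hq : IsAdmissible q₁ q₂) (hb : IsCoefficients q₁ q₂ Lplus Lminus B b)
    (hX : IsLinearField P b ε X) {γ : ℝ} (hγ : 0 < γ) {ν : ℝ → ℝ} (hν : Tendsto ν atTop atTop)
    {D : Matrix (Fin 2) (Fin 2) ℝ}
    (hA : Tendsto (fun r : ℝ => dilation q₁ q₂ (ν r)⁻¹ * B * Matrix.diagonal ![r, r ^ γ]) atTop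
      (𝓝 D)) {j k : Fin 2} (hD : D j k ≠ 0) {N : ℝ → ℝ}
    (hN : ∀ᶠ r in atTop, N r = r * r ^ γ * ν r ^ (bigQ q₁ q₂ / 2 - 1)) :
    FddTendsto P P' (fun r x ω => (N r)⁻¹ * partialSum X γ r x ω)
      (Vtilde I q₁ q₂ Lplus Lminus B D) := by
  intro n x hx
  set ℓ : ℝ → Fin 2 → ℝ := fun r => ![r, r ^ γ] with hℓdef
  have hℓ : ∀ i, Tendsto (fun r => ℓ r i) atTop atTop := by
    intro i
    fin_cases i
    · exact tendsto_id
    · exact tendsto_rpow_atTop hγ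
  have hL2 : ∀ r k, IsL2Series P ε (sumCoeff b (ℓ r) (x k) (N r))
      (fun ω => (N r)⁻¹ * partialSum X γ r (x k) ω) := by
    intro r k
    exact (IsL2Series.sum hε (boxPts (ℓ r) (x k)) (g := fun t s => b (t - s))
      fun t _ => hX t).const_mul _
  have hker : ∀ k, MemLp (kernel q₁ q₂ Lplus Lminus B D (x k)) 2 volume := fun k =>
    (wellDefined_of_ne_zero hq hb.continuousOn_Lplus hb.continuousOn_Lminus B hD (x k) (hx k)).2
  refine tendstoInDistribution_of_charFun_linearComb (fun r k => (hL2 r k).1.aemeasurable)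
    (fun k => (Lp.aestronglyMeasurable _).aemeasurable) fun θ => ?_
  set h : (Fin 2 → ℝ) → ℝ := fun u => ∑ k, θ k * kernel q₁ q₂ Lplus Lminus B D (x k) u with hh
  have hmem : MemLp h 2 volume := memLp_finsetSum _ fun k _ => (hker k).const_mul (θ k)
  -- the limit is Gaussian with variance `∫ h²`
  have hlimit : charFun (P'.map fun ω => ∑ k, θ k * Vtilde I q₁ q₂ Lplus Lminus B D (x k) ω) 1
      = Complex.exp (-((∫ u, h u ^ 2) / 2 : ℝ)) := by
    have h1 : (∑ k, θ k • toL2 (kernel q₁ q₂ Lplus Lminus B D (x k))) = hmem.toLp h := by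
      refine Lp.ext ?_
      refine EventuallyEq.trans ?_ hmem.coeFn_toLp.symm
      have h2 : ∀ k, (toL2 (kernel q₁ q₂ Lplus Lminus B D (x k)) : (Fin 2 → ℝ) → ℝ)
          =ᵐ[volume] kernel q₁ q₂ Lplus Lminus B D (x k) := by
        intro k
        rw [toL2_of_memLp (hker k)]
        exact (hker k).coeFn_toLp
      have h3 : ∀ k, (θ k • toL2 (kernel q₁ q₂ Lplus Lminus B D (x k)) :
          Lp ℝ 2 (volume : Measure (Fin 2 → ℝ))) =ᵐ[volume]
          θ k • (toL2 (kernel q₁ q₂ Lplus Lminus B D (x k)) : (Fin 2 → ℝ) → ℝ) :=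
        fun k => Lp.coeFn_smul _ _
      have h4 := Lp.coeFn_finsetSum Finset.univ
        fun k => θ k • toL2 (kernel q₁ q₂ Lplus Lminus B D (x k))
      filter_upwards [h4, ae_all_iff.2 h2, ae_all_iff.2 h3] with u h5 h6 h7
      rw [h5, Finset.sum_apply]
      refine Finset.sum_congr rfl fun k _ => ?_
      rw [h7, Pi.smul_apply, h6, smul_eq_mul]
    have h2 := coeFn_map_sum I Finset.univ θ fun k => toL2 (kernel q₁ q₂ Lplus Lminus B D (x k))
    have h3 : ‖hmem.toLp h‖ ^ 2 = ∫ u, h u ^ 2 := by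
      rw [← real_inner_self_eq_norm_sq, L2.inner_def]
      refine integral_congr_ae ?_
      filter_upwards [hmem.coeFn_toLp] with u hu
      rw [hu]
      simp [pow_two]
    simp only [Vtilde]
    rw [Measure.map_congr h2, hI.charFun_one, h1, h3]
  rw [hlimit]
  set T : ℝ → Matrix (Fin 2) (Fin 2) ℝ := fun r => B⁻¹ * dilation q₁ q₂ (ν r) with hTdef
  have hν0 : ∀ᶠ r in atTop, 0 < ν r := hν.eventually_gt_atTop 0
  have hT : Tendsto (fun r => |(T r).det|) atTop atTop := by
    have hQ : 0 < bigQ q₁ q₂ := zero_lt_one.trans hb.one_lt_Q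
    have h1 := ((tendsto_rpow_atTop hQ).comp hν).const_mul_atTop
      (inv_pos.2 (abs_pos.2 hb.det_ne_zero))
    refine h1.congr' ?_
    filter_upwards [hν0] with r hr
    rw [hTdef]
    simp only
    rw [Matrix.det_mul, Matrix.det_nonsing_inv, det_dilation hr, Ring.inverse_eq_inv',
      abs_mul, abs_inv, abs_of_pos (Real.rpow_pos_of_pos hr _), Function.comp_apply]
  have hconv : Tendsto (fun r => eLpNorm (fun u => stepFun (T r)
      (fun s => ∑ k, θ k * sumCoeff b (ℓ r) (x k) (N r) s) u - h u) 2 volume) atTop (𝓝 0) := by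
    have h1 : ∀ k, Tendsto (fun r => ‖θ k‖ₑ * eLpNorm (fun u => stepFun (T r) (sumCoeff b (ℓ r) (x k)
        (ℓ r 0 * ℓ r 1 * ν r ^ (bigQ q₁ q₂ / 2 - 1))) u - kernel q₁ q₂ Lplus Lminus B D (x k) u)
        2 volume) atTop (𝓝 0) := by
      intro k
      have h2 := ENNReal.Tendsto.const_mul (a := ‖θ k‖ₑ)
        (tendsto_stepFun_sumCoeff hq hb hν hℓ hA hD (x k)) (Or.inr (by finiteness))
      rwa [mul_zero] at h2
    have h3 := tendsto_finsetSum Finset.univ fun k _ => h1 k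
    rw [Finset.sum_const_zero] at h3
    refine tendsto_of_tendsto_of_tendsto_of_le_of_le' tendsto_const_nhds h3
      (Eventually.of_forall fun r => zero_le) ?_
    filter_upwards [hN] with r hr
    have h4 : (fun u => stepFun (T r) (fun s => ∑ k, θ k * sumCoeff b (ℓ r) (x k) (N r) s) u - h u)
        = ∑ k, θ k • fun u => stepFun (T r) (sumCoeff b (ℓ r) (x k)
        (ℓ r 0 * ℓ r 1 * ν r ^ (bigQ q₁ q₂ / 2 - 1))) u - kernel q₁ q₂ Lplus Lminus B D (x k) u := by
      ext u
      rw [Finset.sum_apply, hh, stepFun, Finset.mul_sum, ← Finset.sum_sub_distrib, hr]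
      refine Finset.sum_congr rfl fun k _ => ?_
      rw [Pi.smul_apply, smul_eq_mul, mul_sub, stepFun]
      simp only [hℓdef, Matrix.cons_val_zero, Matrix.cons_val_one]
      ring
    rw [h4]
    refine (eLpNorm_sum_le (fun k _ => ?_) (by norm_num)).trans (le_of_eq ?_)
    · exact ((measurable_stepFun _ _).aestronglyMeasurable.sub (hker k).1).const_smul _
    · exact Finset.sum_congr rfl fun k _ => eLpNorm_const_smul _ _ _ _
  obtain ⟨hsum, hv, hmax⟩ := tendsto_of_stepFun hT hmem hconv
  exact tendsto_charFun_of_isL2Series hε (Eventually.of_forall fun r =>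
    IsL2Series.sum hε Finset.univ fun k _ => (hL2 r k).const_mul (θ k)) hsum hv hmax

end PartialSums

/-! ### Power scaling and the critical exponents -/

/-- For `q₁ < q₂` the condition `Q̃₁ > 1` is stronger than its analogue for `q₂`. -/
lemma isAdmissible_of_one_lt_Qtilde {q₁ q₂ : ℝ} (h₁ : 0 < q₁) (h₂ : 0 < q₂)
    (hQ₂ : bigQ q₁ q₂ < 2) (hq : q₁ < q₂) (hQ : 1 < Qtilde q₁ q₂ q₁) : IsAdmissible q₁ q₂ := by
  have h3 : 1 / (2 * q₁) = 1 / q₁ / 2 := by field_simp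
  have h4 : 1 / (2 * q₂) = 1 / q₂ / 2 := by field_simp
  have h5 : 1 / q₂ < 1 / q₁ := one_div_lt_one_div_of_lt h₁ hq
  rw [Qtilde, bigQ, h3] at hQ
  refine ⟨fun i => ?_, hQ₂, fun i j hij => ?_⟩
  · fin_cases i
    · exact h₁
    · exact h₂
  · fin_cases i <;> fin_cases j
    · exact absurd rfl hij
    · change 1 < 1 / (2 * q₁) + 1 / q₂
      linarith
    · change 1 < 1 / (2 * q₂) + 1 / q₁
      linarith
    · exact absurd rfl hij

section Exponents

variable {q₁ q₂ : ℝ} {Lplus Lminus : ℝ → ℝ} {B : Matrix (Fin 2) (Fin 2) ℝ} {b : (Fin 2 → ℤ) → ℝ}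

/-- With `ν = r^κ` the entry `(i, k)` of `diag(ν^{-1/qᵢ}) B diag(r, r^γ)` is
`B i k * r^(gₖ - κ/qᵢ)`, where `g = (1, γ)`. The limit exists if `gₖ ≤ κ/qᵢ` whenever `B i k ≠ 0`,
and keeps the entries with `gₖ = κ/qᵢ`. -/
lemma tendsto_dilation_mul_diagonal {γ κ : ℝ} {D : Matrix (Fin 2) (Fin 2) ℝ}
    (hle : ∀ i k, B i k = 0 ∨ (![1, γ] : Fin 2 → ℝ) k ≤ κ / ![q₁, q₂] i)
    (hDdef : ∀ i k, D i k = if (![1, γ] : Fin 2 → ℝ) k = κ / ![q₁, q₂] i then B i k else 0) :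
    Tendsto (fun r : ℝ => dilation q₁ q₂ (r ^ κ)⁻¹ * B * Matrix.diagonal ![r, r ^ γ]) atTop
      (𝓝 D) := by
  refine tendsto_pi_nhds.2 fun i => tendsto_pi_nhds.2 fun k => ?_
  have h1 : ∀ᶠ r : ℝ in atTop, r ^ ((![1, γ] : Fin 2 → ℝ) k - κ / ![q₁, q₂] i) * B i k =
      (dilation q₁ q₂ (r ^ κ)⁻¹ * B * Matrix.diagonal ![r, r ^ γ]) i k := by
    filter_upwards [eventually_gt_atTop 0] with r hr
    have h2 : (![r, r ^ γ] : Fin 2 → ℝ) k = r ^ (![1, γ] : Fin 2 → ℝ) k := by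
      fin_cases k
      · exact (Real.rpow_one r).symm
      · rfl
    rw [Matrix.mul_diagonal, dilation, Matrix.diagonal_mul, h2, ← Real.rpow_neg hr.le,
      ← Real.rpow_mul hr.le, sub_eq_add_neg, Real.rpow_add hr]
    ring_nf
  refine Tendsto.congr' h1 ?_
  rw [hDdef]
  rcases eq_or_ne (B i k) 0 with h0 | h0
  · simp [h0]
  split_ifs with h2
  · simp [h2]
  · have h3 := ((hle i k).resolve_left h0).lt_of_ne h2
    have h4 := (tendsto_rpow_neg_atTop (sub_pos.2 h3)).mul_const (B i k)
    rwa [zero_mul, neg_sub] at h4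

/-- The scaling limit of the partial sums under the power scaling `ν = r^κ`. -/
theorem fddTendsto_partialSum {Ω : Type*} [MeasurableSpace Ω] {P : Measure Ω}
    [IsProbabilityMeasure P] {Ω' : Type*} [MeasurableSpace Ω'] {P' : Measure Ω'}
    [IsProbabilityMeasure P'] {ε X : (Fin 2 → ℤ) → Ω → ℝ} (hε : IsStandardIID P ε)
    {I : Lp ℝ 2 (volume : Measure (Fin 2 → ℝ)) →ₗ[ℝ] Lp ℝ 2 P'} (hI : IsWhiteNoiseIntegral P' I)
    (hq : IsAdmissible q₁ q₂) (hb : IsCoefficients q₁ q₂ Lplus Lminus B b)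
    (hX : IsLinearField P b ε X) {γ κ β : ℝ} (hγ : 0 < γ) (hκ : 0 < κ)
    {D : Matrix (Fin 2) (Fin 2) ℝ}
    (hle : ∀ i k, B i k = 0 ∨ (![1, γ] : Fin 2 → ℝ) k ≤ κ / ![q₁, q₂] i)
    (hDdef : ∀ i k, D i k = if (![1, γ] : Fin 2 → ℝ) k = κ / ![q₁, q₂] i then B i k else 0)
    {j k : Fin 2} (hD : D j k ≠ 0) (hβ : β = 1 + γ + κ * (bigQ q₁ q₂ / 2 - 1)) :
    FddTendsto P P' (fun r x ω => (r ^ β)⁻¹ * partialSum X γ r x ω)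
      (Vtilde I q₁ q₂ Lplus Lminus B D) := by
  refine fddTendsto_vtilde hε hI hq hb hX hγ (tendsto_rpow_atTop hκ)
    (tendsto_dilation_mul_diagonal hle hDdef) hD ?_
  filter_upwards [eventually_gt_atTop 0] with r hr
  rw [hβ, Real.rpow_add hr, Real.rpow_add hr, Real.rpow_one, Real.rpow_mul hr.le]

end Exponents

lemma Bt22_eq_single (B : Matrix (Fin 2) (Fin 2) ℝ) : Bt22 B = Matrix.single 1 1 (B 1 1) := by
  ext i j
  fin_cases i <;> fin_cases j <;> simp [Bt22]

lemma Bt21_eq_single (B : Matrix (Fin 2) (Fin 2) ℝ) : Bt21 B = Matrix.single 1 0 (B 1 0) := by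
  ext i j
  fin_cases i <;> fin_cases j <;> simp [Bt21]

lemma Bt11_eq_single (B : Matrix (Fin 2) (Fin 2) ℝ) : Bt11 B = Matrix.single 0 0 (B 0 0) := by
  ext i j
  fin_cases i <;> fin_cases j <;> simp [Bt11]

end AnisoScaling

end

theorem theorem1
    {Ω : Type*} [MeasurableSpace Ω] (P : Measure Ω) [IsProbabilityMeasure P]
    {Ω' : Type*} [MeasurableSpace Ω'] (P' : Measure Ω') [IsProbabilityMeasure P']
    (q₁ q₂ : ℝ) (Lplus Lminus : ℝ → ℝ) (B : Matrix (Fin 2) (Fin 2) ℝ)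
    (b : (Fin 2 → ℤ) → ℝ) (ε : (Fin 2 → ℤ) → Ω → ℝ)
    (I : Lp ℝ 2 (volume : Measure (Fin 2 → ℝ)) →ₗ[ℝ] Lp ℝ 2 P')
    (hε : AnisoScaling.IsStandardIID P ε)
    (hb : AnisoScaling.IsCoefficients q₁ q₂ Lplus Lminus B b)
    (hI : AnisoScaling.IsWhiteNoiseIntegral P' I)
    (hq : q₁ < q₂) (hQ : 1 < AnisoScaling.Qtilde q₁ q₂ q₁) :
    let H₁ : ℝ := AnisoScaling.Htilde q₁ q₂ q₁
    let H₂ : ℝ := AnisoScaling.Htilde q₁ q₂ q₂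
    let V : Matrix (Fin 2) (Fin 2) ℝ → (Fin 2 → ℝ) → Ω' → ℝ :=
      fun D => AnisoScaling.Vtilde I q₁ q₂ Lplus Lminus B D
    let V22 := V (AnisoScaling.Bt22 B)
    let V21 := V (AnisoScaling.Bt21 B)
    let V20 := V (AnisoScaling.Bt20 B)
    let V11 := V (AnisoScaling.Bt11 B)
    let V00 := V (AnisoScaling.Bt00 B)
    let WD : Matrix (Fin 2) (Fin 2) ℝ → Prop :=
      fun D => AnisoScaling.WellDefined q₁ q₂ Lplus Lminus B D
    -- the linear random field exists
    (∃ X, AnisoScaling.IsLinearField P b ε X) ∧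
    -- incongruous scaling, critical point `1`
    (B 1 0 * B 1 1 ≠ 0 →
      (WD (AnisoScaling.Bt22 B) ∧ WD (AnisoScaling.Bt21 B) ∧ WD (AnisoScaling.Bt20 B)) ∧
      AnisoScaling.IsScaledFBS P' (AnisoScaling.sigmaOf P' V22) 1 H₂ V22 ∧
      AnisoScaling.IsScaledFBS P' (AnisoScaling.sigmaOf P' V21) H₂ 1 V21 ∧
      ((∃ z ∈ Set.Icc (-1 : ℝ) 1, Lplus z ≠ 0 ∨ Lminus z ≠ 0) →
        ∀ a : ℝ, 0 < a → ¬ AnisoScaling.FddEq P' V22 (fun x ω' => a * V21 x ω')) ∧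
      ∀ X, AnisoScaling.IsLinearField P b ε X → ∀ γ : ℝ, 0 < γ →
        (1 < γ → AnisoScaling.FddTendsto P P'
          (fun r x ω => (r ^ (1 + γ * H₂))⁻¹ * AnisoScaling.partialSum X γ r x ω) V22) ∧
        (γ < 1 → AnisoScaling.FddTendsto P P'
          (fun r x ω => (r ^ (γ + H₂))⁻¹ * AnisoScaling.partialSum X γ r x ω) V21) ∧
        (γ = 1 → AnisoScaling.FddTendsto P P'
          (fun r x ω => (r ^ (1 + H₂))⁻¹ * AnisoScaling.partialSum X γ r x ω) V20)) ∧
    -- congruous scaling, critical point `q₁ / q₂`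
    (B 1 0 = 0 →
      (WD (AnisoScaling.Bt22 B) ∧ WD (AnisoScaling.Bt11 B) ∧ WD (AnisoScaling.Bt00 B)) ∧
      AnisoScaling.IsScaledFBS P' (AnisoScaling.sigmaOf P' V22) 1 H₂ V22 ∧
      AnisoScaling.IsScaledFBS P' (AnisoScaling.sigmaOf P' V11) H₁ 1 V11 ∧
      ((∃ z ∈ Set.Icc (-1 : ℝ) 1, Lplus z ≠ 0 ∨ Lminus z ≠ 0) →
        ∀ a : ℝ, 0 < a → ¬ AnisoScaling.FddEq P' V22 (fun x ω' => a * V11 x ω')) ∧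
      ∀ X, AnisoScaling.IsLinearField P b ε X → ∀ γ : ℝ, 0 < γ →
        (q₁ / q₂ < γ → AnisoScaling.FddTendsto P P'
          (fun r x ω => (r ^ (1 + γ * H₂))⁻¹ * AnisoScaling.partialSum X γ r x ω) V22) ∧
        (γ < q₁ / q₂ → AnisoScaling.FddTendsto P P'
          (fun r x ω => (r ^ (γ + H₁))⁻¹ * AnisoScaling.partialSum X γ r x ω) V11) ∧
        (γ = q₁ / q₂ → AnisoScaling.FddTendsto P P'
          (fun r x ω => (r ^ (1 + q₁ / q₂ * H₂))⁻¹ * AnisoScaling.partialSum X γ r x ω) V00)) := by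
  have h₁ := hb.q₁_pos
  have h₂ := hb.q₂_pos
  have hp := hb.continuousOn_Lplus
  have hm := hb.continuousOn_Lminus
  have hadm := AnisoScaling.isAdmissible_of_one_lt_Qtilde h₁ h₂ hb.Q_lt_two hq hQ
  intro H₁ H₂ V V22 V21 V20 V11 V00 WD
  have hfbs22 : B 1 1 ≠ 0 →
      AnisoScaling.IsScaledFBS P' (AnisoScaling.sigmaOf P' V22) 1 H₂ V22 := by
    intro h
    have h3 := AnisoScaling.isScaledFBS_single_one hI hadm hp hm B 1 h
    rwa [← AnisoScaling.Bt22_eq_single] at h3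
  have hσ22 : B 1 1 ≠ 0 → (∃ z ∈ Set.Icc (-1 : ℝ) 1, Lplus z ≠ 0 ∨ Lminus z ≠ 0) →
      AnisoScaling.sigmaOf P' V22 ≠ 0 := by
    intro h hL
    have h3 := AnisoScaling.sigmaOf_vtilde_single_ne_zero hI hadm hp hm hb.det_ne_zero 1 1 h hL
    rwa [← AnisoScaling.Bt22_eq_single] at h3
  have hH₂ : H₂ < 1 := (AnisoScaling.htilde_mem hadm 1).2
  have hratio : q₁ / q₂ < 1 := (div_lt_one h₂).2 hq
  have hratio' : 1 < q₂ / q₁ := (one_lt_div h₁).2 hq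
  refine ⟨hb.exists_isLinearField hε, fun hB => ?_, fun hB => ?_⟩
  · have h10 : B 1 0 ≠ 0 := left_ne_zero_of_mul hB
    have h11 : B 1 1 ≠ 0 := right_ne_zero_of_mul hB
    have hfbs21 : AnisoScaling.IsScaledFBS P' (AnisoScaling.sigmaOf P' V21) H₂ 1 V21 := by
      have h3 := AnisoScaling.isScaledFBS_single_zero hI hadm hp hm B 1 h10
      rwa [← AnisoScaling.Bt21_eq_single] at h3
    refine ⟨⟨AnisoScaling.wellDefined_of_ne_zero hadm hp hm B (j := 1) (k := 1) h11,
      AnisoScaling.wellDefined_of_ne_zero hadm hp hm B (j := 1) (k := 0) h10,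
      AnisoScaling.wellDefined_of_ne_zero hadm hp hm B (j := 1) (k := 0) h10⟩,
      hfbs22 h11, hfbs21,
      fun hL a _ => (hfbs22 h11).not_fddEq hfbs21 (hσ22 h11 hL) hH₂ a,
      fun X hX γ hγ => ⟨fun hγ1 => ?_, fun hγ1 => ?_, fun hγ1 => ?_⟩⟩
    -- `γ > 1`, with `ν = r^(γ q₂)`: the entry `b₂₂` dominates
    · have e2 : γ * q₂ / q₂ = γ := mul_div_cancel_right₀ γ h₂.ne'
      have e1 : γ < γ * q₂ / q₁ := by
        rw [mul_div_assoc]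
        exact lt_mul_of_one_lt_right hγ hratio'
      refine AnisoScaling.fddTendsto_partialSum hε hI hadm hb hX hγ (mul_pos hγ h₂) ?_ ?_
        (j := 1) (k := 1) h11 (by simp only [H₂, AnisoScaling.Htilde]; ring)
      · refine Fin.forall_fin_two.2 ⟨Fin.forall_fin_two.2 ⟨Or.inr ?_, Or.inr ?_⟩,
          Fin.forall_fin_two.2 ⟨Or.inr ?_, Or.inr ?_⟩⟩ <;> simp <;> linarith
      · refine Fin.forall_fin_two.2 ⟨Fin.forall_fin_two.2 ⟨?_, ?_⟩,
          Fin.forall_fin_two.2 ⟨?_, ?_⟩⟩ <;> simp [AnisoScaling.Bt22, e2, e1.ne, (hγ1.trans e1).ne, hγ1.ne]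
    -- `γ < 1`, with `ν = r^q₂`: the entry `b₂₁` dominates
    · have e2 : q₂ / q₂ = 1 := div_self h₂.ne'
      refine AnisoScaling.fddTendsto_partialSum hε hI hadm hb hX hγ h₂ ?_ ?_
        (j := 1) (k := 0) h10 (by simp only [H₂, AnisoScaling.Htilde]; ring)
      · refine Fin.forall_fin_two.2 ⟨Fin.forall_fin_two.2 ⟨Or.inr ?_, Or.inr ?_⟩,
          Fin.forall_fin_two.2 ⟨Or.inr ?_, Or.inr ?_⟩⟩ <;> simp <;> linarith
      · refine Fin.forall_fin_two.2 ⟨Fin.forall_fin_two.2 ⟨?_, ?_⟩,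
          Fin.forall_fin_two.2 ⟨?_, ?_⟩⟩ <;> simp [AnisoScaling.Bt21, e2, hratio'.ne, (hγ1.trans hratio').ne, hγ1.ne]
    -- `γ = 1`, with `ν = r^q₂`: the second row is balanced
    · have e2 : q₂ / q₂ = 1 := div_self h₂.ne'
      refine AnisoScaling.fddTendsto_partialSum hε hI hadm hb hX hγ h₂ ?_ ?_
        (j := 1) (k := 0) h10 (by simp only [H₂, AnisoScaling.Htilde, hγ1]; ring)
      · refine Fin.forall_fin_two.2 ⟨Fin.forall_fin_two.2 ⟨Or.inr ?_, Or.inr ?_⟩,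
          Fin.forall_fin_two.2 ⟨Or.inr ?_, Or.inr ?_⟩⟩ <;> simp <;> linarith
      · refine Fin.forall_fin_two.2 ⟨Fin.forall_fin_two.2 ⟨?_, ?_⟩,
          Fin.forall_fin_two.2 ⟨?_, ?_⟩⟩ <;> simp [AnisoScaling.Bt20, e2, hγ1, hratio'.ne]
  · have hdet : B 0 0 * B 1 1 ≠ 0 := by
      have h3 := hb.det_ne_zero
      rwa [Matrix.det_fin_two, hB, mul_zero, sub_zero] at h3
    have h00 : B 0 0 ≠ 0 := left_ne_zero_of_mul hdet
    have h11 : B 1 1 ≠ 0 := right_ne_zero_of_mul hdet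
    have hfbs11 : AnisoScaling.IsScaledFBS P' (AnisoScaling.sigmaOf P' V11) H₁ 1 V11 := by
      have h3 := AnisoScaling.isScaledFBS_single_zero hI hadm hp hm B 0 h00
      rwa [← AnisoScaling.Bt11_eq_single] at h3
    refine ⟨⟨AnisoScaling.wellDefined_of_ne_zero hadm hp hm B (j := 1) (k := 1) h11,
      AnisoScaling.wellDefined_of_ne_zero hadm hp hm B (j := 0) (k := 0) h00,
      AnisoScaling.wellDefined_of_ne_zero hadm hp hm B (j := 0) (k := 0) h00⟩,
      hfbs22 h11, hfbs11,
      fun hL a _ => (hfbs22 h11).not_fddEq hfbs11 (hσ22 h11 hL) hH₂ a,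
      fun X hX γ hγ => ⟨fun hγ1 => ?_, fun hγ1 => ?_, fun hγ1 => ?_⟩⟩
    -- `γ > q₁/q₂`, with `ν = r^(γ q₂)`: the entry `b₂₂` dominates
    · have e2 : γ * q₂ / q₂ = γ := mul_div_cancel_right₀ γ h₂.ne'
      have e1 : γ < γ * q₂ / q₁ := by
        rw [mul_div_assoc]
        exact lt_mul_of_one_lt_right hγ hratio'
      have e3 : 1 < γ * q₂ / q₁ := by
        rw [one_lt_div h₁]
        exact (div_lt_iff₀ h₂).1 hγ1
      refine AnisoScaling.fddTendsto_partialSum hε hI hadm hb hX hγ (mul_pos hγ h₂) ?_ ?_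
        (j := 1) (k := 1) h11 (by simp only [H₂, AnisoScaling.Htilde]; ring)
      · refine Fin.forall_fin_two.2 ⟨Fin.forall_fin_two.2 ⟨Or.inr ?_, Or.inr ?_⟩,
          Fin.forall_fin_two.2 ⟨Or.inl hB, Or.inr ?_⟩⟩ <;> simp <;> linarith
      · refine Fin.forall_fin_two.2 ⟨Fin.forall_fin_two.2 ⟨?_, ?_⟩,
          Fin.forall_fin_two.2 ⟨?_, ?_⟩⟩ <;> simp [AnisoScaling.Bt22, e2, hB, e1.ne, e3.ne]
    -- `γ < q₁/q₂`, with `ν = r^q₁`: the entry `b₁₁` dominates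
    · have e1 : q₁ / q₁ = 1 := div_self h₁.ne'
      refine AnisoScaling.fddTendsto_partialSum hε hI hadm hb hX hγ h₁ ?_ ?_
        (j := 0) (k := 0) h00 (by simp only [H₁, AnisoScaling.Htilde]; ring)
      · refine Fin.forall_fin_two.2 ⟨Fin.forall_fin_two.2 ⟨Or.inr ?_, Or.inr ?_⟩,
          Fin.forall_fin_two.2 ⟨Or.inl hB, Or.inr ?_⟩⟩ <;> simp <;> linarith
      · refine Fin.forall_fin_two.2 ⟨Fin.forall_fin_two.2 ⟨?_, ?_⟩,
          Fin.forall_fin_two.2 ⟨?_, ?_⟩⟩ <;> simp [AnisoScaling.Bt11, e1, hB, (hγ1.trans hratio).ne, hγ1.ne]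
    -- `γ = q₁/q₂`, with `ν = r^q₁`: the diagonal entries are balanced
    · have e1 : q₁ / q₁ = 1 := div_self h₁.ne'
      have e3 : 1 + q₁ / q₂ * H₂ = 1 + γ + q₁ * (AnisoScaling.bigQ q₁ q₂ / 2 - 1) := by
        simp only [H₂, AnisoScaling.Htilde, hγ1]
        field_simp
        ring
      refine AnisoScaling.fddTendsto_partialSum hε hI hadm hb hX hγ h₁ ?_ ?_
        (j := 0) (k := 0) h00 e3
      · refine Fin.forall_fin_two.2 ⟨Fin.forall_fin_two.2 ⟨Or.inr ?_, Or.inr ?_⟩,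
          Fin.forall_fin_two.2 ⟨Or.inl hB, Or.inr ?_⟩⟩ <;> simp <;> linarith
      · refine Fin.forall_fin_two.2 ⟨Fin.forall_fin_two.2 ⟨?_, ?_⟩,
          Fin.forall_fin_two.2 ⟨?_, ?_⟩⟩ <;> simp [AnisoScaling.Bt00, e1, hB, hγ1, hratio.ne]
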